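/- Let $\mathcal M\subset\mathcal B(H)$ be a von Neumann algebra with a normal faithful tracial state $\tau$, let $L_0(\mathcal M,\tau)$ be the algebra of $\tau$-measurable operators, and let $1\le p\le\infty$. For $f\in L_0(\mathcal M,\tau)$ write $\|f\|_p\in[0,\infty]$ for its $L_p(\mathcal M,\tau)$-norm, with $\|f\|_p=\infty$ if $f\notin L_p(\mathcal M,\tau)$ (so $\|f\|_\infty$ is the operator norm, and $\|f\|_p=\tau(|f|^p)^{1/p}$ for $p<\infty$). For a projection $e\in\mathcal M$ put $e^\perp=1-e$. A sequence $(f_n)_n$ in $L_0(\mathcal M,\tau)$ converges *bilaterally almost uniformly* to $f\in L_0(\mathcal M,\tau)$ if for every $\varepsilon>0$ there is a projection $e\in\mathcal M$ with $\tau(e)<\varepsilon$ and $\|e^\perp(f_n-f)e^\perp\|_\infty\to0$. Let $$\|(f_n)_n\|_{L_p[\ell_\infty]}=\inf\Big\{\|\alpha\|_{2p}\,\sup_n\|h_n\|_\infty\,\|\beta\|_{2p}\Big\},$$ the infimum being over all factorizations $f_n=\alpha h_n\beta$ with $\alpha,\beta\in L_{2p}(\mathcal M,\tau)$ and $(h_n)_n$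 a bounded sequence in $\mathcal M$ (it is $\infty$ if there is none), and let $L_p(\mathcal M;\ell_\infty)$ be the space of sequences for which this is finite. For a sequence $(f_n)_n$ in $L_p(\mathcal M,\tau)$ put $$\Big\|{\limsup_{n\to\infty}}^{+}f_n\Big\|_p=\sup_{\varepsilon>0}\ \inf_{\substack{e\in\mathcal M\text{ projection}\\ \tau(e)<\varepsilon}}\ \inf_{N}\ \big\|(e^\perp f_ne^\perp)_{n>N}\big\|_{L_p[\ell_\infty]}\in[0,\infty].$$ Let $L_p^{\mathrm{loc}}(\mathcal M;c_0)$ be the closure in $L_p(\mathcal M;\ell_\infty)$ of the space of those $(h_n)_n\in L_p(\mathcal M;\ell_\infty)$ such that for every $\varepsilon>0$ there are a projection $e\in\mathcal M$ and an $N$ with $\tau(e)<\varepsilon$ and $e^\perp h_ne^\perp=0$ for all $n>N$. **Proposition.** Let $(f_n)_n\subset L_p(\mathcal M,\tau)$ converge bilaterally almost uniformly to $f\in L_0(\mathcal M,\tau)$. Then $$\Big\|{\limsup_{n\to\infty}}^{+}f_n\Big\|_p=\|f\|_p .$$ If moreover $(f_n)_n\in L_p(\mathcal M;\ell_\infty)$,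 then also the norm of the class of $(f_n)_n$ in the quotient $L_p(\mathcal M;\ell_\infty)/L_p^{\mathrm{loc}}(\mathcal M;c_0)$ equals $\|f\|_p$. -/

import Mathlib

open Filter Topology
open scoped ENNReal ComplexOrder

noncomputable section

namespace NCInt

universe u

/-- A von Neumann algebra is closed under multiplication by complex scalars. -/
instance instSMulMemClass {H : Type u} [NormedAddCommGroup H] [InnerProductSpace ℂ H]
    [CompleteSpace H] : SMulMemClass (VonNeumannAlgebra H) ℂ (H →L[ℂ] H) where
  smul_mem {S} c x hx := S.toStarSubalgebra.smul_mem (x := x) hx c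

variable {H : Type u} [NormedAddCommGroup H] [InnerProductSpace ℂ H] [CompleteSpace H]

/-! ### Normal faithful tracial states -/

/-- The weak-* (that is, σ-weak) topology which a von Neumann algebra inherits from `B(H)`: the
coarsest one for which all functionals `x ↦ ∑ i, ⟪ξ i, x (η i)⟫`, where `ξ` and `η` are
square-summable sequences of vectors, are continuous. -/
@[reducible] def ultraweak (M : VonNeumannAlgebra H) : TopologicalSpace M :=
  TopologicalSpace.induced
    (fun (x : M) (v : lp (fun _ : ℕ => H) 2 × lp (fun _ : ℕ => H) 2) =>
      ∑' i : ℕ, inner ℂ (v.1 i) ((x : H →L[ℂ] H) (v.2 i)))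
    Pi.topologicalSpace

/-- A normal faithful tracial state on a von Neumann algebra; a von Neumann algebra with such a
state is a finite von Neumann algebra (a quantum probability space). -/
structure FiniteTrace (M : VonNeumannAlgebra H) where
  /-- the underlying functional -/
  toLinearMap : M →ₗ[ℂ] ℂ
  map_one : toLinearMap 1 = 1
  map_star_mul_self_nonneg : ∀ x : M, 0 ≤ toLinearMap (star x * x)
  map_mul_comm : ∀ x y : M, toLinearMap (x * y) = toLinearMap (y * x)
  faithful : ∀ x : M, toLinearMap (star x * x) = 0 → x = 0
  normal : Continuous[ultraweak M, inferInstance] toLinearMap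

variable {M : VonNeumannAlgebra H}

/-- The real part of `τ x`; it equals `τ x` for self-adjoint `x`, and is used for these only. -/
def FiniteTrace.tr (τ : FiniteTrace M) (x : M) : ℝ := (τ.toLinearMap x).re

/-! ### Projections and the trace -/

section Projections

variable (τ : FiniteTrace M)

lemma FiniteTrace.tr_add (x y : M) : τ.tr (x + y) = τ.tr x + τ.tr y := by
  simp [FiniteTrace.tr]

lemma FiniteTrace.tr_sub (x y : M) : τ.tr (x - y) = τ.tr x - τ.tr y := by
  simp [FiniteTrace.tr]

lemma FiniteTrace.tr_comm (x y : M) : τ.tr (x * y) = τ.tr (y * x) := by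
  simp [FiniteTrace.tr, τ.map_mul_comm x y]

lemma FiniteTrace.tr_nonneg (x : M) : 0 ≤ τ.tr (star x * x) :=
  (Complex.le_def.mp (τ.map_star_mul_self_nonneg x)).1

lemma FiniteTrace.tr_proj_nonneg {e : M} (he : IsStarProjection e) : 0 ≤ τ.tr e := by
  have := τ.tr_nonneg e
  rwa [he.isSelfAdjoint.star_eq, he.isIdempotentElem.eq] at this

/-- Bounded strong convergence of a sequence implies convergence of the traces. -/
lemma FiniteTrace.tendsto_tr {x : ℕ → M} {y : M} {C : ℝ}
    (hC : ∀ n, ‖(x n : H →L[ℂ] H)‖ ≤ C)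
    (h : ∀ v : H, Tendsto (fun n => (x n : H →L[ℂ] H) v) atTop (𝓝 ((y : H →L[ℂ] H) v))) :
    Tendsto (fun n => τ.tr (x n)) atTop (𝓝 (τ.tr y)) := by
  have key : Tendsto x atTop (@nhds M (ultraweak M) y) := by
    unfold ultraweak
    rw [nhds_induced, tendsto_comap_iff, tendsto_pi_nhds]
    rintro ⟨ξ, η⟩
    have hs : Summable fun i => ‖ξ i‖ * (C * ‖η i‖) := by
      have h1 : Summable fun i => ‖ξ i‖ ^ (2 : ℝ) := by
        simpa using (lp.memℓp ξ).summable (by norm_num)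
      have h2 : Summable fun i => ‖η i‖ ^ (2 : ℝ) := by
        simpa using (lp.memℓp η).summable (by norm_num)
      have := (Real.summable_mul_of_Lp_Lq_of_nonneg (p := 2) (q := 2)
        (by exact ⟨by norm_num, by norm_num, by norm_num⟩)
        (fun i => norm_nonneg (ξ i)) (fun i => norm_nonneg (η i)) h1 h2)
      refine (this.mul_left C).congr fun i => by ring
    refine tendsto_tsum_of_dominated_convergence hs (fun i => ?_) (.of_forall fun n i => ?_)
    · exact (tendsto_const_nhds (x := ξ i)).inner (h (η i))
    · refine (norm_inner_le_norm _ _).trans ?_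
      gcongr
      exact ((x n : H →L[ℂ] H).le_opNorm _).trans (by gcongr; exact hC n)
  have hc : Tendsto τ.toLinearMap (@nhds M (ultraweak M) y) (𝓝 (τ.toLinearMap y)) :=
    @Continuous.tendsto _ _ (ultraweak M) _ _ τ.normal y
  exact (Complex.continuous_re.tendsto _).comp (hc.comp key)

/-- The contraction estimate for `1 - a⋆ a`. -/
lemma norm_sub_star_mul_self (a : H →L[ℂ] H) (ha : ‖a‖ ≤ 1) (v : H) :
    ‖v - (star a * a) v‖ ^ 2 + ‖a v‖ ^ 2 ≤ ‖v‖ ^ 2 := by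
  have h1 : ‖v - (star a * a) v‖ ^ 2
      = ‖v‖ ^ 2 - 2 * ‖a v‖ ^ 2 + ‖(star a * a) v‖ ^ 2 := by
    rw [@norm_sub_sq ℂ]
    congr 2
    rw [mul_apply_eq_comp, ContinuousLinearMap.star_eq_adjoint,
      ContinuousLinearMap.adjoint_inner_right, inner_self_eq_norm_sq]
  have h2 : ‖(star a * a) v‖ ≤ ‖a v‖ := by
    rw [mul_apply_eq_comp]
    refine ((star a).le_opNorm _).trans ?_
    rw [norm_star]
    exact mul_le_of_le_one_left (norm_nonneg _) ha
  have h3 : ‖(star a * a) v‖ ^ 2 ≤ ‖a v‖ ^ 2 := by gcongr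
  linarith

/-- `τ ((1 - a⋆ a) ^ k) = τ ((1 - a a⋆) ^ k)`. -/
lemma FiniteTrace.tr_one_sub_pow (a : M) (k : ℕ) :
    τ.tr ((1 - star a * a) ^ k) = τ.tr ((1 - a * star a) ^ k) := by
  have comm : ∀ k : ℕ, a * (1 - star a * a) ^ k = (1 - a * star a) ^ k * a := by
    intro k
    induction k with
    | zero => simp
    | succ k ih =>
      rw [pow_succ, ← mul_assoc, ih, pow_succ, mul_assoc, mul_assoc]
      congr 1
      noncomm_ring
  induction k with
  | zero => simp
  | succ k ih =>
    rw [pow_succ', sub_mul, one_mul, τ.tr_sub, ih, pow_succ, mul_sub, mul_one, τ.tr_sub]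
    congr 1
    rw [mul_assoc, comm, ← mul_assoc, mul_assoc, τ.tr_comm, mul_assoc]

/-- The traces of the powers of `(1 - a⋆ a) ^ 2` are bounded below by `τ (1 - e)` if `e a = a`. -/
lemma FiniteTrace.tr_one_sub_pow_ge {a e : M} (he : IsStarProjection e) (hea : e * a = a)
    (k : ℕ) : 1 - τ.tr e ≤ τ.tr ((1 - star a * a) ^ (2 * k)) := by
  rw [τ.tr_one_sub_pow]
  have hae : star a * e = star a := by
    have := congrArg star hea
    rwa [star_mul, he.isSelfAdjoint.star_eq] at this
  set d : M := 1 - a * star a with hd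
  have hds : star d = d := by simp [hd]
  have hd1 : d * (1 - e) = 1 - e := by
    rw [hd, sub_mul, one_mul, mul_sub, mul_one, mul_assoc, hae, sub_self, sub_zero]
  have hd2 : ∀ j : ℕ, d ^ j * (1 - e) = 1 - e := by
    intro j
    induction j with
    | zero => simp
    | succ j ih => rw [pow_succ, mul_assoc, hd1, ih]
  have h1 : d ^ (2 * k) = d ^ (2 * k) * e + (1 - e) := by
    rw [← hd2 (2 * k)]; noncomm_ring
  have h2 : τ.tr (d ^ (2 * k) * e) = τ.tr (star (d ^ k * e) * (d ^ k * e)) := by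
    rw [star_mul, star_pow, hds, he.isSelfAdjoint.star_eq, mul_assoc, τ.tr_comm e]
    rw [mul_assoc, mul_assoc, he.isIdempotentElem.eq, ← mul_assoc, ← pow_add, two_mul]
  have h3 : τ.tr (1 - e) = 1 - τ.tr e := by
    rw [τ.tr_sub]; simp [FiniteTrace.tr, τ.map_one]
  rw [h1, τ.tr_add, h2, h3]
  linarith [τ.tr_nonneg (d ^ k * e)]

/-- The right support projection of a contraction `a`, whose trace is at most that of every
projection `e` with `e a = a`. -/
lemma FiniteTrace.exists_support_aux {a : M} (ha : ‖(a : H →L[ℂ] H)‖ ≤ 1) :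
    ∃ q : M, IsStarProjection q ∧ a * q = a ∧ (∀ f : M, a * f = 0 → q * f = 0) ∧
      ∀ e : M, IsStarProjection e → e * a = a → τ.tr q ≤ τ.tr e := by
  set a' : H →L[ℂ] H := (a : H →L[ℂ] H) with ha'
  let K : Submodule ℂ H := LinearMap.ker (a' : H →ₗ[ℂ] H)
  have hKc : IsClosed (K : Set H) := a'.isClosed_ker
  have : CompleteSpace K := hKc.completeSpace_coe
  have memK : ∀ v, v ∈ K ↔ a' v = 0 := fun v => Iff.rfl
  have hPM : K.starProjection ∈ M := by
    rw [VonNeumannAlgebra.IsStarProjection.mem_iff isStarProjection_starProjection]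
    intro y hy v hv
    rw [Submodule.range_starProjection] at hv ⊢
    rw [VonNeumannAlgebra.mem_commutant_iff] at hy
    have := congrArg (fun T : H →L[ℂ] H => T v) (hy a' a.2)
    simp only [mul_apply_eq_comp] at this
    change a' (y v) = 0
    rw [this, (memK v).1 hv, map_zero]
  let P : M := ⟨K.starProjection, hPM⟩
  have hP : IsStarProjection P := by
    have h := isStarProjection_starProjection (U := K)
    exact ⟨Subtype.ext h.isIdempotentElem.eq, Subtype.ext h.isSelfAdjoint.star_eq⟩
  have haP : a * P = 0 := by
    apply Subtype.ext
    ext v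
    exact (memK _).1 (Submodule.starProjection_apply_mem K v)
  refine ⟨1 - P, hP.one_sub, by rw [mul_sub, haP, mul_one, sub_zero], ?_, ?_⟩
  · intro f hf
    rw [sub_mul, one_mul, sub_eq_zero]
    apply Subtype.ext
    ext v
    have hv : (f : H →L[ℂ] H) v ∈ K := by
      rw [memK]
      exact congrArg (fun T : M => (T : H →L[ℂ] H) v) hf
    exact (Submodule.starProjection_eq_self_iff.2 hv).symm
  · intro e he hea
    let c : M := star a * a
    let T : H →L[ℂ] H := ((1 - c : M) : H →L[ℂ] H) ^ 2
    have hTv : ∀ v, ((1 - c : M) : H →L[ℂ] H) v = v - (star a' * a') v := fun v => rfl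
    have hc1 : ‖((1 - c : M) : H →L[ℂ] H)‖ ≤ 1 := by
      refine ContinuousLinearMap.opNorm_le_bound _ zero_le_one fun v => ?_
      rw [hTv, one_mul]
      have := norm_sub_star_mul_self a' ha v
      exact abs_le_of_sq_le_sq' (by nlinarith [sq_nonneg ‖a' v‖]) (norm_nonneg _) |>.2
    have hT1 : ‖T‖ ≤ 1 := by
      rw [show T = _ from pow_two _]
      exact (norm_mul_le _ _).trans (mul_le_one₀ hc1 (norm_nonneg _) hc1)
    have hfix : T.eqLocus (1 : H →L[ℂ] H) = K := by
      ext v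
      rw [memK]
      constructor
      · intro hv
        have hv' : ((1 - c : M) : H →L[ℂ] H) (((1 - c : M) : H →L[ℂ] H) v) = v := by
          have : T v = v := hv
          simpa [T, pow_two] using this
        have h1 := norm_sub_star_mul_self a' ha v
        have h2 : ‖v‖ ≤ ‖v - (star a' * a') v‖ := by
          rw [← hTv]
          calc ‖v‖ = _ := by rw [hv']
            _ ≤ _ := ContinuousLinearMap.le_of_opNorm_le _ hc1 _
            _ = _ := one_mul _
        have h3 : ‖v‖ ^ 2 ≤ ‖v - (star a' * a') v‖ ^ 2 := by gcongr
        have : ‖a' v‖ ^ 2 ≤ 0 := by linarith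
        simpa using this
      · intro hv
        have h1 : ((1 - c : M) : H →L[ℂ] H) v = v := by
          rw [hTv, mul_apply_eq_comp, hv, map_zero, sub_zero]
        change T v = v
        simp only [T, pow_two, mul_apply_eq_comp, h1]
    let A : ℕ → M := fun n => (n : ℂ)⁻¹ • ∑ k ∈ Finset.range n, (1 - c) ^ (2 * k)
    have hA : ∀ n, (A n : H →L[ℂ] H)
        = (n : ℂ)⁻¹ • ∑ k ∈ Finset.range n, T ^ k := by
      intro n
      simp only [A, T, ← pow_mul]
      push_cast
      rfl
    have hlim := τ.tendsto_tr (x := A) (y := P) (C := 1) ?_ ?_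
    · have h1 : ∀ n ≥ 1, 1 - τ.tr e ≤ τ.tr (A n) := by
        intro n hn
        have hn' : (0 : ℝ) < n := by exact_mod_cast hn
        have h2 : τ.tr (A n) = (n : ℝ)⁻¹ * ∑ k ∈ Finset.range n, τ.tr ((1 - c) ^ (2 * k)) := by
          simp only [A, FiniteTrace.tr, map_smul, map_sum, smul_eq_mul]
          rw [show ((n : ℂ)⁻¹) = (((n : ℝ)⁻¹ : ℝ) : ℂ) by push_cast; rfl, Complex.re_ofReal_mul,
            Complex.re_sum]
        rw [h2, ← div_eq_inv_mul, le_div_iff₀ hn']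
        calc (1 - τ.tr e) * n = ∑ k ∈ Finset.range n, (1 - τ.tr e) := by
              rw [Finset.sum_const, Finset.card_range, nsmul_eq_mul, mul_comm]
          _ ≤ _ := Finset.sum_le_sum fun k _ => τ.tr_one_sub_pow_ge he hea k
      have h2 : 1 - τ.tr e ≤ τ.tr P :=
        ge_of_tendsto hlim (eventually_atTop.2 ⟨1, h1⟩)
      have h3 : τ.tr (1 - P) = 1 - τ.tr P := by
        rw [τ.tr_sub]; simp [FiniteTrace.tr, τ.map_one]
      linarith
    · intro n
      rw [hA, norm_smul, norm_inv, Complex.norm_natCast]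
      have : ‖∑ k ∈ Finset.range n, T ^ k‖ ≤ n := by
        refine (norm_sum_le _ _).trans ?_
        calc ∑ k ∈ Finset.range n, ‖T ^ k‖ ≤ ∑ k ∈ Finset.range n, (1 : ℝ) := by
              refine Finset.sum_le_sum fun k _ => ?_
              refine ContinuousLinearMap.opNorm_le_bound _ zero_le_one fun v => ?_
              clear * - hT1
              induction k with
              | zero => simp
              | succ k ih =>
                rw [pow_succ', mul_apply_eq_comp]
                refine (ContinuousLinearMap.le_of_opNorm_le _ hT1 _).trans ?_
                rw [one_mul]
                exact ih
          _ = n := by simp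
      exact inv_mul_le_one_of_le₀ this (Nat.cast_nonneg n)
    · intro v
      have h := T.tendsto_birkhoffAverage_orthogonalProjection hT1 v
      have h2 : (((T.eqLocus (1 : H →L[ℂ] H)).orthogonalProjectionOnto v : _) : H)
          = (P : H →L[ℂ] H) v := by
        change (T.eqLocus (1 : H →L[ℂ] H)).starProjection v = K.starProjection v
        simp only [hfix]
      rw [h2] at h
      refine h.congr fun n => ?_
      rw [hA]
      simp [birkhoffAverage, birkhoffSum]

/-- The right support projection of `a`. -/
lemma FiniteTrace.exists_support (a : M) :
    ∃ q : M, IsStarProjection q ∧ a * q = a ∧ (∀ f : M, a * f = 0 → q * f = 0) ∧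
      ∀ e : M, IsStarProjection e → e * a = a → τ.tr q ≤ τ.tr e := by
  set r : ℂ := ((‖(a : H →L[ℂ] H)‖ + 1 : ℝ) : ℂ)⁻¹ with hr
  have hpos : 0 < ‖(a : H →L[ℂ] H)‖ + 1 := by positivity
  have hr0 : r ≠ 0 := by
    rw [hr]; exact inv_ne_zero (by exact_mod_cast hpos.ne')
  have hn : ‖((r • a : M) : H →L[ℂ] H)‖ ≤ 1 := by
    change ‖r • (a : H →L[ℂ] H)‖ ≤ 1
    rw [norm_smul, hr, norm_inv, Complex.norm_real, Real.norm_of_nonneg hpos.le]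
    exact inv_mul_le_one_of_le₀ (by linarith) hpos.le
  have hl : ∀ x : M, r • a * x = r • (a * x) := fun x => Subtype.ext (smul_mul_assoc r _ _)
  have hr' : ∀ x : M, x * r • a = r • (x * a) := fun x => Subtype.ext (mul_smul_comm r _ _)
  obtain ⟨q, hq, h1, h2, h3⟩ := τ.exists_support_aux hn
  refine ⟨q, hq, ?_, fun f hf => h2 f ?_, fun e he hea => h3 e he ?_⟩
  · rw [hl] at h1
    exact smul_right_injective _ hr0 h1
  · rw [hl, hf, smul_zero]
  · rw [hr', hea]

/-- Two projections have an upper bound of trace at most the sum of their traces. -/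
lemma FiniteTrace.exists_sup {e f : M} (he : IsStarProjection e) (hf : IsStarProjection f) :
    ∃ g : M, IsStarProjection g ∧ e * (1 - g) = 0 ∧ f * (1 - g) = 0 ∧
      τ.tr g ≤ τ.tr e + τ.tr f := by
  obtain ⟨q, hq, h1, h2, h3⟩ := τ.exists_support (e * (1 - f))
  have hqf : q * f = 0 := h2 f (by
    rw [mul_assoc, sub_mul, one_mul, hf.isIdempotentElem.eq, sub_self, mul_zero])
  have hfq : f * q = 0 := by
    have := congrArg star hqf
    rwa [star_mul, hq.isSelfAdjoint.star_eq, hf.isSelfAdjoint.star_eq, star_zero] at this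
  have hsplit : 1 - (f + q) = (1 - f) * (1 - q) := by
    rw [mul_sub, mul_one, sub_mul, one_mul, hfq]; abel
  refine ⟨f + q, ⟨?_, ?_⟩, ?_, ?_, ?_⟩
  · change (f + q) * (f + q) = f + q
    rw [add_mul, mul_add, mul_add, hf.isIdempotentElem.eq, hq.isIdempotentElem.eq, hfq, hqf]
    abel
  · exact hf.isSelfAdjoint.add hq.isSelfAdjoint
  · rw [hsplit, ← mul_assoc, mul_sub, mul_one, h1, sub_self]
  · rw [mul_sub, mul_one, mul_add, hf.isIdempotentElem.eq, hfq, add_zero, sub_self]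
  · rw [τ.tr_add, add_comm]
    have := h3 e he (by rw [← mul_assoc, he.isIdempotentElem.eq])
    linarith

end Projections

/-! ### Measurable operators -/

/-- The basic neighbourhoods of zero for convergence in measure. -/
def measureNhd (τ : FiniteTrace M) (ε δ : ℝ) : Set M :=
  {x | ∃ e : M, IsStarProjection e ∧ τ.tr e < δ ∧ ‖x * (1 - e)‖ < ε}

lemma norm_one_sub_proj_le {e : M} (he : IsStarProjection e) (x : M) :
    ‖x * (1 - e)‖ ≤ ‖x‖ := by
  refine (norm_mul_le _ _).trans (mul_le_of_le_one_right (norm_nonneg _) ?_)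
  have h : IsStarProjection (((1 - e : M) : H →L[ℂ] H)) :=
    ⟨congrArg Subtype.val he.one_sub.isIdempotentElem.eq,
      congrArg Subtype.val he.one_sub.isSelfAdjoint.star_eq⟩
  exact h.norm_le

lemma mul_one_sub_of_mul_one_sub_eq_zero {e g : M} (h : e * (1 - g) = 0) :
    (1 - e) * (1 - g) = 1 - g := by
  rw [sub_mul, one_mul, h, sub_zero]

lemma zero_mem_measureNhd (τ : FiniteTrace M) {ε δ : ℝ} (hε : 0 < ε) (hδ : 0 < δ) :
    (0 : M) ∈ measureNhd τ ε δ :=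
  ⟨0, .zero _, by simpa [FiniteTrace.tr] using hδ, by simpa using hε⟩

lemma measureNhd_mono (τ : FiniteTrace M) {ε ε' δ δ' : ℝ} (h : ε ≤ ε') (h' : δ ≤ δ') :
    measureNhd τ ε δ ⊆ measureNhd τ ε' δ' :=
  fun _ ⟨e, he, h1, h2⟩ => ⟨e, he, h1.trans_le h', h2.trans_le h⟩

lemma neg_mem_measureNhd (τ : FiniteTrace M) {ε δ : ℝ} {x : M} (hx : x ∈ measureNhd τ ε δ) :
    -x ∈ measureNhd τ ε δ := by
  obtain ⟨e, he, h1, h2⟩ := hx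
  exact ⟨e, he, h1, by rwa [neg_mul, norm_neg]⟩

lemma add_mem_measureNhd (τ : FiniteTrace M) {ε ε' δ δ' : ℝ} {x y : M}
    (hx : x ∈ measureNhd τ ε δ) (hy : y ∈ measureNhd τ ε' δ') :
    x + y ∈ measureNhd τ (ε + ε') (δ + δ') := by
  obtain ⟨e, he, h1, h2⟩ := hx
  obtain ⟨f, hf, h3, h4⟩ := hy
  obtain ⟨g, hg, h5, h6, h7⟩ := τ.exists_sup he hf
  refine ⟨g, hg, by linarith, ?_⟩
  have hx : ‖x * (1 - g)‖ < ε := by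
    rw [← mul_one_sub_of_mul_one_sub_eq_zero h5, ← mul_assoc]
    exact (norm_one_sub_proj_le hg _).trans_lt h2
  have hy : ‖y * (1 - g)‖ < ε' := by
    rw [← mul_one_sub_of_mul_one_sub_eq_zero h6, ← mul_assoc]
    exact (norm_one_sub_proj_le hg _).trans_lt h4
  rw [add_mul]
  exact (norm_add_le _ _).trans_lt (add_lt_add hx hy)

lemma mul_mem_measureNhd (τ : FiniteTrace M) {ε ε' δ δ' : ℝ} {x y : M}
    (hx : x ∈ measureNhd τ ε δ) (hy : y ∈ measureNhd τ ε' δ') :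
    x * y ∈ measureNhd τ (ε * ε') (δ + δ') := by
  obtain ⟨e, he, h1, h2⟩ := hx
  obtain ⟨f, hf, h3, h4⟩ := hy
  obtain ⟨q, hq, h5, -, h6⟩ := τ.exists_support (e * y)
  obtain ⟨g, hg, h7, h8, h9⟩ := τ.exists_sup hq hf
  have h10 := h6 e he (by rw [← mul_assoc, he.isIdempotentElem.eq])
  refine ⟨g, hg, by linarith, ?_⟩
  have hy : ‖y * (1 - g)‖ < ε' := by
    rw [← mul_one_sub_of_mul_one_sub_eq_zero h8, ← mul_assoc]
    exact (norm_one_sub_proj_le hg _).trans_lt h4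
  have hz : e * y * (1 - g) = 0 := by
    rw [← h5, mul_assoc (e * y), h7, mul_zero]
  have : x * y * (1 - g) = (x * (1 - e)) * (y * (1 - g)) := by
    have : (x * (1 - e)) * (y * (1 - g)) = x * y * (1 - g) - x * (e * y * (1 - g)) := by
      noncomm_ring
    rw [this, hz, mul_zero, sub_zero]
  rw [this]
  exact (norm_mul_le _ _).trans_lt (mul_lt_mul'' h2 hy (norm_nonneg _) (norm_nonneg _))

lemma mem_measureNhd_of_norm_lt (τ : FiniteTrace M) {ε δ : ℝ} (hδ : 0 < δ) {x : M}
    (hx : ‖x‖ < ε) : x ∈ measureNhd τ ε δ :=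
  ⟨0, .zero _, by simpa [FiniteTrace.tr] using hδ, by simpa using hx⟩

/-- The filter basis at zero of the topology of convergence in measure. -/
@[reducible] def measureBasis (τ : FiniteTrace M) : RingFilterBasis M where
  sets := {U | ∃ ε > 0, ∃ δ > 0, U = measureNhd τ ε δ}
  nonempty := ⟨_, 1, one_pos, 1, one_pos, rfl⟩
  inter_sets := by
    rintro _ _ ⟨ε, hε, δ, hδ, rfl⟩ ⟨ε', hε', δ', hδ', rfl⟩
    exact ⟨_, ⟨min ε ε', lt_min hε hε', min δ δ', lt_min hδ hδ', rfl⟩, Set.subset_inter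
      (measureNhd_mono τ (min_le_left _ _) (min_le_left _ _))
      (measureNhd_mono τ (min_le_right _ _) (min_le_right _ _))⟩
  zero' := by
    rintro _ ⟨ε, hε, δ, hδ, rfl⟩
    exact zero_mem_measureNhd τ hε hδ
  add' := by
    rintro _ ⟨ε, hε, δ, hδ, rfl⟩
    refine ⟨_, ⟨ε / 2, half_pos hε, δ / 2, half_pos hδ, rfl⟩, ?_⟩
    rintro _ ⟨x, hx, y, hy, rfl⟩
    simpa using add_mem_measureNhd τ hx hy
  neg' := by
    rintro _ ⟨ε, hε, δ, hδ, rfl⟩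
    exact ⟨_, ⟨ε, hε, δ, hδ, rfl⟩, fun x hx => neg_mem_measureNhd τ hx⟩
  conj' := by
    rintro x _ ⟨ε, hε, δ, hδ, rfl⟩
    exact ⟨_, ⟨ε, hε, δ, hδ, rfl⟩, fun y hy => by simpa using hy⟩
  mul' := by
    rintro _ ⟨ε, hε, δ, hδ, rfl⟩
    refine ⟨_, ⟨min ε 1, lt_min hε one_pos, δ / 2, half_pos hδ, rfl⟩, ?_⟩
    rintro _ ⟨x, hx, y, hy, rfl⟩
    refine measureNhd_mono τ ?_ (add_halves δ).le (mul_mem_measureNhd τ hx hy)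
    calc min ε 1 * min ε 1 ≤ ε * 1 := by
          gcongr
          · exact min_le_left _ _
          · exact min_le_right _ _
      _ = ε := mul_one ε
  mul_left' := by
    rintro x _ ⟨ε, hε, δ, hδ, rfl⟩
    have hx : 0 < ‖x‖ + 1 := by positivity
    refine ⟨_, ⟨ε / (‖x‖ + 1), div_pos hε hx, δ / 2, half_pos hδ, rfl⟩, fun y hy => ?_⟩
    refine measureNhd_mono τ ?_ (add_halves δ).le (mul_mem_measureNhd τ
      (mem_measureNhd_of_norm_lt τ (half_pos hδ) (lt_add_one ‖x‖)) hy)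
    rw [mul_div_cancel₀ _ hx.ne']
  mul_right' := by
    rintro x _ ⟨ε, hε, δ, hδ, rfl⟩
    have hx : 0 < ‖x‖ + 1 := by positivity
    refine ⟨_, ⟨ε / (‖x‖ + 1), div_pos hε hx, δ / 2, half_pos hδ, rfl⟩, fun y hy => ?_⟩
    refine measureNhd_mono τ ?_ (add_halves δ).le (mul_mem_measureNhd τ hy
      (mem_measureNhd_of_norm_lt τ (half_pos hδ) (lt_add_one ‖x‖)))
    rw [div_mul_cancel₀ _ hx.ne']

/-- The algebra `M` regarded with the topology of convergence in measure. -/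
def MeasureAlg (_τ : FiniteTrace M) : Type u := M

variable (τ : FiniteTrace M)

instance : Ring (MeasureAlg τ) := inferInstanceAs (Ring M)

instance : TopologicalSpace (MeasureAlg τ) := (measureBasis τ).topology

instance : IsTopologicalRing (MeasureAlg τ) := (measureBasis τ).isTopologicalRing

instance : UniformSpace (MeasureAlg τ) := IsTopologicalAddGroup.rightUniformSpace (MeasureAlg τ)

instance : IsUniformAddGroup (MeasureAlg τ) := isUniformAddGroup_of_addCommGroup

/-- The ring `L₀(M, τ)` of `τ`-measurable operators, as the completion of `M` for the topology of
convergence in measure. -/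
abbrev L0 : Type u := UniformSpace.Completion (MeasureAlg τ)

/-- The inclusion of `M` in `L₀(M, τ)`. -/
def toL0 : M →+* L0 τ :=
  (UniformSpace.Completion.coeRingHom : MeasureAlg τ →+* UniformSpace.Completion (MeasureAlg τ))

/-- The compression `e⊥ f e⊥` of a measurable operator, where `e⊥ = 1 - e`. -/
def corner (e : M) (f : L0 τ) : L0 τ := toL0 τ (1 - e) * f * toL0 τ (1 - e)

/-! ### Noncommutative `L_p` spaces -/

lemma abs_rpow_mem (x : M) (p : ℝ) : CFC.abs (x : H →L[ℂ] H) ^ p ∈ M := by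
  suffices h : CFC.abs (x : H →L[ℂ] H) ^ p ∈ M.commutant.commutant by
    rwa [VonNeumannAlgebra.commutant_commutant] at h
  rw [VonNeumannAlgebra.mem_commutant_iff]
  intro z hz
  have h1 : Commute (star (x : H →L[ℂ] H) * x) z :=
    VonNeumannAlgebra.mem_commutant_iff.1 hz _ (star x * x).2
  have h2 : Commute (CFC.abs (x : H →L[ℂ] H)) z := h1.cfcₙ_nnreal _
  exact (h2.cfc_nnreal _).symm.eq

/-- The element `|x| ^ p` of `M`, where `|x| = (x⋆ x) ^ (1/2)`. -/
def absPow (x : M) (p : ℝ) : M := ⟨CFC.abs (x : H →L[ℂ] H) ^ p, abs_rpow_mem x p⟩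

/-- The norm `τ(|x| ^ p) ^ (1/p)` of an element of `M`, for finite `p`. -/
def pNorm (p : ℝ) (x : M) : ℝ := τ.tr (absPow x p) ^ (1 / p)

/-- A sequence in `M` which is Cauchy for the `p`-norm. -/
def IsCauchyLp (p : ℝ) (x : ℕ → M) : Prop :=
  ∀ ε : ℝ, 0 < ε → ∃ N : ℕ, ∀ m ≥ N, ∀ n ≥ N, pNorm τ p (x m - x n) < ε

/-- The `L_p`-norm of a measurable operator, with value `∞` outside `L_p(M, τ)`. For `p = ∞` it is
the operator norm on `L_∞(M, τ) = M`. For finite `p`, `L_p(M, τ)` is the closure of `M` for the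
`p`-norm, inside `L₀(M, τ)`: it consists of the limits in measure `f` of the sequences `x k` in `M`
which are Cauchy for the `p`-norm, and the norm of `f` is the limit of the norms of the `x k`. -/
def lpNorm (p : ℝ≥0∞) (f : L0 τ) : ℝ≥0∞ :=
  open Classical in
  if p = ∞ then ⨅ (x : M) (_ : toL0 τ x = f), ‖x‖ₑ
  else ⨅ (x : ℕ → M) (_ : IsCauchyLp τ p.toReal x)
    (_ : Tendsto (fun k => toL0 τ (x k)) atTop (𝓝 f)),
    liminf (fun k => ENNReal.ofReal (pNorm τ p.toReal (x k))) atTop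

/-- Membership in `L_p(M, τ)`. -/
def MemLp (p : ℝ≥0∞) (f : L0 τ) : Prop := lpNorm τ p f < ∞

/-- Bilateral almost uniform convergence. -/
def TendstoBAU (f : ℕ → L0 τ) (g : L0 τ) : Prop :=
  ∀ ε : ℝ, 0 < ε → ∃ e : M, IsStarProjection e ∧ τ.tr e < ε ∧
    Tendsto (fun n => lpNorm τ ∞ (corner τ e (f n - g))) atTop (𝓝 0)

/-! ### The mixed norm spaces -/

/-- The norm of `L_p(M; ℓ_∞)`: the infimum of `‖α‖_{2p} (sup_n ‖h n‖_∞) ‖β‖_{2p}` over all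
factorizations `f n = α (h n) β` with `α, β ∈ L_{2p}(M, τ)` and `h` a bounded sequence in `M`;
its value is `∞` if there is no such factorization. -/
def lpLinftyNorm (p : ℝ≥0∞) (f : ℕ → L0 τ) : ℝ≥0∞ :=
  ⨅ (α : L0 τ) (β : L0 τ) (h : ℕ → M) (_ : MemLp τ (2 * p) α) (_ : MemLp τ (2 * p) β)
    (_ : BddAbove (Set.range fun n => ‖h n‖)) (_ : ∀ n, f n = α * toL0 τ (h n) * β),
    lpNorm τ (2 * p) α * (⨆ n, ‖h n‖ₑ) * lpNorm τ (2 * p) β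

/-- Membership in `L_p(M; ℓ_∞)`. -/
def MemLpLinfty (p : ℝ≥0∞) (f : ℕ → L0 τ) : Prop := lpLinftyNorm τ p f < ∞

/-- The `L_p`-norm of the noncommutative `limsup⁺` of an arbitrary sequence, in its localized form:
`sup_{ε > 0} inf_{τ(e) < ε} inf_N ‖(e⊥ f_n e⊥)_{n > N}‖_{L_p(M; ℓ_∞)}`. -/
def limsupNorm (p : ℝ≥0∞) (f : ℕ → L0 τ) : ℝ≥0∞ :=
  ⨆ (ε : ℝ) (_ : 0 < ε), ⨅ (e : M) (_ : IsStarProjection e) (_ : τ.tr e < ε), ⨅ N : ℕ,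
    lpLinftyNorm τ p (fun k => corner τ e (f (N + 1 + k)))

/-- The space of bilaterally almost finite sequences in `L_p(M; ℓ_∞)`. -/
def IsAlmostFinite (p : ℝ≥0∞) (h : ℕ → L0 τ) : Prop :=
  MemLpLinfty τ p h ∧ ∀ ε : ℝ, 0 < ε → ∃ e : M, IsStarProjection e ∧ τ.tr e < ε ∧
    ∃ N : ℕ, ∀ n > N, corner τ e (h n) = 0

/-- Membership in `L_p^loc(M; c₀)`, the closure of the bilaterally almost finite sequences
in `L_p(M; ℓ_∞)`. -/
def MemLpLocC0 (p : ℝ≥0∞) (h : ℕ → L0 τ) : Prop :=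
  MemLpLinfty τ p h ∧ ∀ δ : ℝ≥0∞, 0 < δ → ∃ g : ℕ → L0 τ, IsAlmostFinite τ p g ∧
    lpLinftyNorm τ p (fun n => h n - g n) < δ

/-- The quotient norm of `L_p(M; ℓ_∞) / L_p^loc(M; c₀)`. -/
def limsupQuotientNorm (p : ℝ≥0∞) (f : ℕ → L0 τ) : ℝ≥0∞ :=
  ⨅ (h : ℕ → L0 τ) (_ : MemLpLocC0 τ p h), lpLinftyNorm τ p (fun n => f n - h n)

end NCInt

end

noncomputable section

namespace NCInt

universe u

set_option linter.unusedSectionVars false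

/-! ### Continuous functional calculus for nonnegative elements -/

section Calculus

variable {A : Type*} [CStarAlgebra A] [PartialOrder A] [StarOrderedRing A]

/-! Both quantities are squeezed against the norm of the limit `g`.

Lower bounds (`TendstoBAU.lpNorm_le`). Suppose that, off projections of arbitrarily small trace, the
compressions of `f n` eventually have `p`-norm at most `C`. Joining such a projection with an
exceptional projection of the bilateral convergence gives `E` of small trace for which the
compression of `g` differs from that of `f n` by an operator of small norm, so its `p`-norm is at
most `C`. These compressions tend to `g` in measure as the trace of `E` tends to zero, and balls of
`L_p` are closed in measure, so `g` has norm at most `C`. Hölder's inequality bounds each term of a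
sequence by its mixed norm, which yields such a `C` from either quantity.

Upper bounds (`exists_lpLinftyNorm_add_le`). The limit has an almost optimal factorization `g = α t
β` whose outer factors have bounded inverses `a`, `b`. A uniformly small bounded perturbation is
then absorbed in the middle: `g + y n = α (t + a (y n) b) β`. Off a small projection `f n` is of
this form for large `n`, which bounds the limsup. For the quotient, `y n` is the compression of `f n
- g` by a projection `e (k n)`, where `e m` has trace below `2⁻ᵐ` and `k n` grows slowly. The
remainder `f n - g - y n` is killed off the supremum of the tail of the `e m`, hence is almost
finite; it has finite mixed norm because two outer factors in `L_{2p}` can be replaced by a common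
one (`MemLpLinfty.sub`).

What carries this is the theory of `L_p` inside a completion. Up to an arbitrarily small enlargement
of the radius, a ball of `L_p` is the closure in measure of a ball of `M`
(`mem_closure_of_lpNorm_lt`, `lpNorm_le_of_mem_closure`), so inequalities pass from bounded
operators to `L_p` by continuity. For bounded operators they come from Young's inequality and
duality, in any C⋆-algebra with a tracial state. Unbounded functional calculus is replaced by
continuous functions of the resolvents `(1 + b k)⁻¹` along an approximating sequence. -/

lemma spectrum_subset_Ici {a : A} (ha : 0 ≤ a) : spectrum ℝ a ⊆ Set.Ici 0 :=
  fun _ ht => spectrum_nonneg_of_nonneg ha ht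

lemma spectrum_subset_Icc {a : A} (ha : 0 ≤ a) {R : ℝ} (hR : ‖a‖ ≤ R) :
    spectrum ℝ a ⊆ Set.Icc 0 R := fun t ht =>
  ⟨spectrum_nonneg_of_nonneg ha ht, (le_abs_self t).trans
    ((IsometricContinuousFunctionalCalculus.norm_spectrum_le (𝕜 := ℝ) a ht).trans hR)⟩

lemma continuousOn_spectrum {f : ℝ → ℝ} (hf : ContinuousOn f (Set.Ici 0)) {a : A} (ha : 0 ≤ a) :
    ContinuousOn f (spectrum ℝ a) := hf.mono (spectrum_subset_Ici ha)

/-- Uniform polynomial approximation of the functional calculus on bounded sets. -/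
lemma exists_polynomial_near_cfc {f : ℝ → ℝ} (hf : ContinuousOn f (Set.Ici 0)) (R : ℝ) {ε : ℝ}
    (hε : 0 < ε) : ∃ P : Polynomial ℝ, ∀ a : A, 0 ≤ a → ‖a‖ ≤ R →
      ‖cfc f a - Polynomial.aeval a P‖ ≤ ε := by
  obtain ⟨P, hP⟩ := exists_polynomial_near_of_continuousOn 0 R f
    (hf.mono Set.Icc_subset_Ici_self) ε hε
  refine ⟨P, fun a ha hR => ?_⟩
  have h1 := continuousOn_spectrum hf ha
  rw [← cfc_polynomial P a, ← cfc_sub f P.eval a]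
  refine norm_cfc_le hε.le fun t ht => ?_
  rw [← norm_neg, neg_sub]
  exact (hP t (spectrum_subset_Icc ha hR ht)).le

lemma mul_aeval_star_mul_self (x : A) (P : Polynomial ℝ) :
    x * Polynomial.aeval (star x * x) P = Polynomial.aeval (x * star x) P * x := by
  induction P using Polynomial.induction_on' with
  | add p q hp hq => simp [mul_add, add_mul, hp, hq]
  | monomial n r =>
    rw [Polynomial.aeval_monomial, Polynomial.aeval_monomial, ← mul_assoc,
      ← Algebra.commutes r x, mul_assoc, mul_assoc]
    congr 1
    induction n with
    | zero => simp
    | succ n ih => rw [pow_succ, ← mul_assoc, ih, pow_succ]; simp only [mul_assoc]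

/-- The functional calculus of `x⋆ x` and that of `x x⋆` are intertwined by `x`. -/
lemma mul_cfc_star_mul_self (x : A) {f : ℝ → ℝ} (hf : ContinuousOn f (Set.Ici 0)) :
    x * cfc f (star x * x) = cfc f (x * star x) * x := by
  rw [← sub_eq_zero, ← norm_eq_zero]
  refine le_antisymm (le_of_forall_pos_le_add fun ε hε => ?_) (norm_nonneg _)
  have hx : 0 < 2 * (‖x‖ + 1) := by positivity
  -- One polynomial serves both `x⋆ x` and `x x⋆`, since the approximation is uniform on a ball
  -- containing both.
  obtain ⟨P, hP⟩ := exists_polynomial_near_cfc (A := A) hf (max ‖star x * x‖ ‖x * star x‖)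
    (div_pos hε hx)
  have h1 := hP _ (star_mul_self_nonneg x) (le_max_left _ _)
  have h2 := hP _ (mul_star_self_nonneg x) (le_max_right _ _)
  have h3 : x * cfc f (star x * x) - cfc f (x * star x) * x
      = x * (cfc f (star x * x) - Polynomial.aeval (star x * x) P)
        - (cfc f (x * star x) - Polynomial.aeval (x * star x) P) * x := by
    rw [mul_sub, sub_mul, mul_aeval_star_mul_self]; abel
  rw [h3, zero_add]
  calc _ ≤ ‖x‖ * (ε / (2 * (‖x‖ + 1))) + (ε / (2 * (‖x‖ + 1))) * ‖x‖ :=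
        (norm_sub_le _ _).trans (add_le_add
          ((norm_mul_le _ _).trans (by gcongr)) ((norm_mul_le _ _).trans (by gcongr)))
    _ ≤ (‖x‖ + 1) * (ε / (2 * (‖x‖ + 1))) + (ε / (2 * (‖x‖ + 1))) * (‖x‖ + 1) := by
        gcongr <;> linarith
    _ = ε := by field_simp; ring

end Calculus

/-! ### Tracial states on C⋆-algebras -/

/-- A tracial state on a C⋆-algebra, given by its real part. -/
structure TracialState (A : Type*) [CStarAlgebra A] where
  /-- the real part of the state -/
  tr : A →ₗ[ℝ] ℝ
  tr_comm : ∀ x y, tr (x * y) = tr (y * x)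
  tr_star_mul_self : ∀ x, 0 ≤ tr (star x * x)
  tr_star : ∀ x, tr (star x) = tr x
  tr_one : tr 1 = 1

namespace TracialState

variable {A : Type*} [CStarAlgebra A] [PartialOrder A] [StarOrderedRing A] (φ : TracialState A)

lemma tr_nonneg {a : A} (ha : 0 ≤ a) : 0 ≤ φ.tr a := by
  obtain ⟨b, rfl⟩ := CStarAlgebra.nonneg_iff_eq_star_mul_self.1 ha
  exact φ.tr_star_mul_self b

lemma tr_mono {a b : A} (h : a ≤ b) : φ.tr a ≤ φ.tr b := by
  have := φ.tr_nonneg (sub_nonneg.2 h)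
  rw [map_sub] at this
  linarith

lemma tr_algebraMap (r : ℝ) : φ.tr (algebraMap ℝ A r) = r := by
  rw [Algebra.algebraMap_eq_smul_one, map_smul, φ.tr_one, smul_eq_mul, mul_one]

lemma cauchy_schwarz (x y : A) :
    φ.tr (star x * y) ^ 2 ≤ φ.tr (star x * x) * φ.tr (star y * y) := by
  have hs : φ.tr (star y * x) = φ.tr (star x * y) := by
    rw [← φ.tr_star]; simp
  have key : ∀ t : ℝ, 0 ≤ φ.tr (star x * x) * (t * t) + 2 * φ.tr (star x * y) * t
      + φ.tr (star y * y) := by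
    intro t
    have h := φ.tr_star_mul_self (t • x + y)
    have : φ.tr (star (t • x + y) * (t • x + y)) = φ.tr (star x * x) * (t * t)
        + 2 * φ.tr (star x * y) * t + φ.tr (star y * y) := by
      simp only [star_add, star_smul, star_trivial, add_mul, mul_add, smul_mul_assoc,
        mul_smul_comm, map_add, map_smul, smul_eq_mul, hs]
      ring
    rwa [this] at h
  have := discrim_le_zero key
  rw [discrim] at this
  linarith

lemma abs_tr_le (x : A) : |φ.tr x| ≤ ‖x‖ := by
  have h := φ.cauchy_schwarz 1 x
  have h2 : φ.tr (star x * x) ≤ ‖x‖ ^ 2 := by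
    have := φ.tr_mono (CStarAlgebra.star_mul_le_algebraMap_norm_sq (a := x))
    rwa [tr_algebraMap] at this
  rw [star_one, one_mul, mul_one, φ.tr_one, one_mul] at h
  exact abs_le_of_sq_le_sq (h.trans h2) (norm_nonneg _)

lemma continuous_tr : Continuous φ.tr :=
  AddMonoidHomClass.continuous_of_bound φ.tr 1 fun x => by simpa using φ.abs_tr_le x

/-- The product need not be nonnegative, but writing `a = c⋆ c`, traciality turns it into the
nonnegative `c b c⋆`. -/
lemma tr_mul_nonneg {a b : A} (ha : 0 ≤ a) (hb : 0 ≤ b) : 0 ≤ φ.tr (a * b) := by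
  obtain ⟨c, rfl⟩ := CStarAlgebra.nonneg_iff_eq_star_mul_self.1 ha
  rw [mul_assoc, φ.tr_comm]
  exact φ.tr_nonneg (star_right_conjugate_nonneg hb c)

lemma tr_mul_mono {a b c : A} (ha : 0 ≤ a) (hbc : b ≤ c) : φ.tr (a * b) ≤ φ.tr (a * c) := by
  have := φ.tr_mul_nonneg ha (sub_nonneg.2 hbc)
  rw [mul_sub, map_sub] at this
  linarith

lemma tr_aeval_star_mul_self (x : A) (P : Polynomial ℝ) :
    φ.tr (Polynomial.aeval (star x * x) P) = φ.tr (Polynomial.aeval (x * star x) P) := by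
  induction P using Polynomial.induction_on' with
  | add p q hp hq => simp [hp, hq]
  | monomial n r =>
    rw [Polynomial.aeval_monomial, Polynomial.aeval_monomial, ← Algebra.smul_def,
      ← Algebra.smul_def, map_smul, map_smul]
    congr 1
    cases n with
    | zero => simp
    | succ n =>
      have h := mul_aeval_star_mul_self x (Polynomial.X ^ n)
      simp only [map_pow, Polynomial.aeval_X] at h
      rw [pow_succ', mul_assoc, φ.tr_comm, h, mul_assoc, ← pow_succ]

/-- A trace does not distinguish functions of `x⋆ x` from those of `x x⋆`. -/
lemma tr_cfc_star_mul_self (x : A) {f : ℝ → ℝ} (hf : ContinuousOn f (Set.Ici 0)) :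
    φ.tr (cfc f (star x * x)) = φ.tr (cfc f (x * star x)) := by
  rw [← sub_eq_zero, ← abs_eq_zero]
  refine le_antisymm (le_of_forall_pos_le_add fun ε hε => ?_) (abs_nonneg _)
  obtain ⟨P, hP⟩ := exists_polynomial_near_cfc (A := A) hf (max ‖star x * x‖ ‖x * star x‖)
    (half_pos hε)
  have h1 := (φ.abs_tr_le _).trans (hP _ (star_mul_self_nonneg x) (le_max_left _ _))
  have h2 := (φ.abs_tr_le _).trans (hP _ (mul_star_self_nonneg x) (le_max_right _ _))
  rw [map_sub, abs_le] at h1 h2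
  rw [φ.tr_aeval_star_mul_self] at h1
  rw [zero_add, abs_le]
  constructor <;> linarith

/-- A positivity principle: if `∑ i, f i s • y i` is nonnegative for all `s` in `[0, 1]`, then the
trace of `∑ i, f i c * y i` is nonnegative for all `c` between `0` and `1`. -/
lemma tr_sum_cfc_mul_nonneg {ι : Type*} (s : Finset ι) (f : ι → ℝ → ℝ) (y : ι → A)
    (hf : ∀ i, ContinuousOn (f i) (Set.Icc 0 1))
    (h : ∀ t ∈ Set.Icc (0 : ℝ) 1, 0 ≤ ∑ i ∈ s, f i t • y i) {c : A} (hc : 0 ≤ c) (hc1 : ‖c‖ ≤ 1) :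
    0 ≤ ∑ i ∈ s, φ.tr (cfc (f i) c * y i) := by
  have hsp := spectrum_subset_Icc hc hc1
  let F : ι → C(unitInterval, ℝ) := fun i => ⟨fun t => f i t, (hf i).domRestrict⟩
  let B : ℕ → ℕ → A := fun n k => Polynomial.aeval c (bernsteinPolynomial ℝ n k)
  have hBe : ∀ n k (t : unitInterval), (bernsteinPolynomial ℝ n k).eval (t : ℝ)
      = bernstein n k t := fun n k t => rfl
  have hB : ∀ n k, 0 ≤ B n k := by
    intro n k
    simp only [B]
    rw [← cfc_polynomial _ c]
    refine cfc_nonneg fun t ht => ?_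
    rw [hBe n k ⟨t, hsp ht⟩]
    exact bernstein_nonneg
  -- Bernstein approximation of `f i c`. Its coefficients `B n k` are nonnegative and do not depend
  -- on `i`, so regrouping over `k` gives traces of products of two nonnegative elements. This
  -- substitutes `c` for the scalar variable although `c` need not commute with the `y i`.
  let G : ι → ℕ → A := fun i n => ∑ k : Fin (n + 1), F i (bernstein.z k) • B n k
  have hlim : ∀ i, Tendsto (G i) atTop (𝓝 (cfc (f i) c)) := by
    intro i
    rw [Metric.tendsto_atTop]
    intro ε hε
    have h1 := (Metric.tendsto_atTop.1 (bernsteinApproximation_uniform (F i))) (ε / 2) (half_pos hε)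
    obtain ⟨N, hN⟩ := h1
    refine ⟨N, fun n hn => ?_⟩
    let Q : Polynomial ℝ := ∑ k : Fin (n + 1),
      Polynomial.C (F i (bernstein.z k)) * bernsteinPolynomial ℝ n k
    have h2 : G i n = cfc Q.eval c := by
      rw [cfc_polynomial _ c]
      simp [Q, G, B, Algebra.smul_def]
    rw [dist_eq_norm, h2, ← cfc_sub _ _ c Q.continuous.continuousOn ((hf i).mono hsp)]
    refine (norm_cfc_le (half_pos hε).le fun t ht => ?_).trans_lt (half_lt_self hε)
    have h3 := (ContinuousMap.dist_apply_le_dist (⟨t, hsp ht⟩ : unitInterval)).trans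
      (hN n hn).le
    rw [bernsteinApproximation.apply, dist_eq_norm] at h3
    refine le_trans (le_of_eq ?_) h3
    congr 2
    simp only [Q, Polynomial.eval_finsetSum, Polynomial.eval_mul, Polynomial.eval_C]
    refine Finset.sum_congr rfl fun k _ => ?_
    rw [smul_eq_mul, mul_comm]
    rfl
  have hlim2 : Tendsto (fun n => ∑ i ∈ s, φ.tr (G i n * y i)) atTop
      (𝓝 (∑ i ∈ s, φ.tr (cfc (f i) c * y i))) :=
    tendsto_finsetSum _ fun i _ => (φ.continuous_tr.tendsto _).comp ((hlim i).mul_const _)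
  refine ge_of_tendsto' hlim2 fun n => ?_
  have : ∑ i ∈ s, φ.tr (G i n * y i)
      = ∑ k : Fin (n + 1), φ.tr (B n k * ∑ i ∈ s, F i (bernstein.z k) • y i) := by
    simp only [G, Finset.sum_mul, map_sum, Finset.mul_sum, smul_mul_assoc, mul_smul_comm]
    rw [Finset.sum_comm]
  rw [this]
  exact Finset.sum_nonneg fun k _ => φ.tr_mul_nonneg (hB n k) (h _ (bernstein.z k).2)

end TracialState

/-! ### Powers of nonnegative elements -/

section Powers

variable {A : Type*} [CStarAlgebra A] [PartialOrder A] [StarOrderedRing A]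

/-- The real power of a nonnegative element of a C⋆-algebra. -/
def powR (r : ℝ) (a : A) : A := cfc (fun t : ℝ => t ^ r) a

lemma continuousOn_rpow {r : ℝ} (hr : 0 ≤ r) : ContinuousOn (fun t : ℝ => t ^ r) (Set.Ici 0) :=
  (Real.continuous_rpow_const hr).continuousOn

lemma powR_nonneg (r : ℝ) {a : A} (ha : 0 ≤ a) : 0 ≤ powR r a :=
  cfc_nonneg fun _ ht => Real.rpow_nonneg (spectrum_subset_Ici ha ht) _

lemma powR_one {a : A} (ha : 0 ≤ a) : powR 1 a = a := by
  simp only [powR, Real.rpow_one]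
  exact cfc_id' ℝ a

lemma cfc_comp_Ici {f g : ℝ → ℝ} (hf : ContinuousOn f (Set.Ici 0))
    (hg : ContinuousOn g (Set.Ici 0)) (hf0 : ∀ t, 0 ≤ t → 0 ≤ f t) {a : A} (ha : 0 ≤ a) :
    cfc g (cfc f a) = cfc (fun t => g (f t)) a :=
  (cfc_comp' g f a (hg.mono (by
    rintro _ ⟨t, ht, rfl⟩; exact hf0 t (spectrum_subset_Ici ha ht)))
    (continuousOn_spectrum hf ha)).symm

lemma cfc_mul_Ici {f g : ℝ → ℝ} (hf : ContinuousOn f (Set.Ici 0))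
    (hg : ContinuousOn g (Set.Ici 0)) {a : A} (ha : 0 ≤ a) :
    cfc f a * cfc g a = cfc (fun t => f t * g t) a :=
  (cfc_mul f g a (continuousOn_spectrum hf ha) (continuousOn_spectrum hg ha)).symm

lemma cfc_congr_Ici {f g : ℝ → ℝ} (h : ∀ t, 0 ≤ t → f t = g t) {a : A} (ha : 0 ≤ a) :
    cfc f a = cfc g a :=
  cfc_congr fun t ht => h t (spectrum_subset_Ici ha ht)

lemma powR_mul {r s : ℝ} (hr : 0 ≤ r) (hs : 0 ≤ s) {a : A} (ha : 0 ≤ a) :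
    powR r a * powR s a = powR (r + s) a := by
  rw [powR, powR, cfc_mul_Ici (continuousOn_rpow hr) (continuousOn_rpow hs) ha]
  exact cfc_congr_Ici (fun t ht => (Real.rpow_add_of_nonneg ht hr hs).symm) ha

lemma powR_powR {r s : ℝ} (hr : 0 ≤ r) (hs : 0 ≤ s) {a : A} (ha : 0 ≤ a) :
    powR s (powR r a) = powR (r * s) a := by
  rw [powR, powR, cfc_comp_Ici (continuousOn_rpow hr) (continuousOn_rpow hs)
    (fun t ht => Real.rpow_nonneg ht _) ha]
  exact cfc_congr_Ici (fun t ht => (Real.rpow_mul ht r s).symm) ha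

lemma powR_smul {r : ℝ} (hr : 0 ≤ r) {c : ℝ} (hc : 0 ≤ c) {a : A} (ha : 0 ≤ a) :
    powR r (c • a) = c ^ r • powR r a := by
  have h1 := continuousOn_spectrum (continuousOn_rpow hr) ha
  rw [powR, powR, ← cfc_const_mul _ _ a h1, ← cfc_comp_const_mul c (fun t : ℝ => t ^ r) a
    (Real.continuous_rpow_const hr).continuousOn]
  exact cfc_congr_Ici (fun t ht => Real.mul_rpow hc ht) ha

lemma powR_algebraMap (r c : ℝ) : powR r (algebraMap ℝ A c) = algebraMap ℝ A (c ^ r) :=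
  cfc_algebraMap c _

/-- The absolute value `(x⋆ x) ^ (1/2)`. -/
def mabs (x : A) : A := powR (1 / 2) (star x * x)

lemma mabs_nonneg (x : A) : 0 ≤ mabs x := powR_nonneg _ (star_mul_self_nonneg x)

lemma powR_mabs {r : ℝ} (hr : 0 ≤ r) (x : A) : powR r (mabs x) = powR (r / 2) (star x * x) := by
  rw [mabs, powR_powR (by norm_num) hr (star_mul_self_nonneg x)]
  congr 1; ring

end Powers

/-- Optimization of Young's inequality. -/
lemma le_rpow_mul_of_young {p X Y Z : ℝ} (hp : 1 ≤ p) (hY : 0 ≤ Y) (hZ : 0 ≤ Z)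
    (h : ∀ l : ℝ, 0 < l → p * (l * X) ≤ (p - 1) * Y + l ^ p * Z) :
    X ≤ (Y ^ (1 / p)) ^ (p - 1) * Z ^ (1 / p) := by
  have hp0 : 0 < p := by linarith
  have key : ∀ e : ℝ, 0 < e → X ≤ (Y ^ (1 / p) + e) ^ (p - 1) * (Z ^ (1 / p) + e) := by
    intro e he
    set y := Y ^ (1 / p) + e with hy
    set z := Z ^ (1 / p) + e with hz
    have hy0 : 0 < y := by have := Real.rpow_nonneg hY (1 / p); linarith
    have hz0 : 0 < z := by have := Real.rpow_nonneg hZ (1 / p); linarith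
    have hYy : Y ≤ y ^ p := by
      calc Y = (Y ^ (1 / p)) ^ p := by rw [← Real.rpow_mul hY, one_div_mul_cancel hp0.ne',
            Real.rpow_one]
        _ ≤ y ^ p := by
          apply Real.rpow_le_rpow (Real.rpow_nonneg hY _) _ hp0.le; linarith
    have hZz : Z ≤ z ^ p := by
      calc Z = (Z ^ (1 / p)) ^ p := by rw [← Real.rpow_mul hZ, one_div_mul_cancel hp0.ne',
            Real.rpow_one]
        _ ≤ z ^ p := by
          apply Real.rpow_le_rpow (Real.rpow_nonneg hZ _) _ hp0.le; linarith
    -- The optimal parameter; the summand `e` keeps both numbers positive.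
    have h1 := h (y / z) (div_pos hy0 hz0)
    have h2 : (y / z) ^ p * Z ≤ y ^ p := by
      rw [Real.div_rpow hy0.le hz0.le, div_mul_eq_mul_div, div_le_iff₀ (Real.rpow_pos_of_pos hz0 _)]
      exact mul_le_mul_of_nonneg_left hZz (Real.rpow_nonneg hy0.le _)
    have h3 : (p - 1) * Y ≤ (p - 1) * y ^ p := mul_le_mul_of_nonneg_left hYy (by linarith)
    have h4 : p * (y / z * X) ≤ p * y ^ p := by linarith
    have h5 := le_of_mul_le_mul_left h4 hp0
    have h6 : y ^ p = y ^ (p - 1) * y := by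
      rw [Real.rpow_sub_one hy0.ne', div_mul_cancel₀ _ hy0.ne']
    rw [h6, div_mul_eq_mul_div, div_le_iff₀ hz0] at h5
    have h7 : y * X ≤ y * (y ^ (p - 1) * z) := by linarith
    exact le_of_mul_le_mul_left h7 hy0
  have hc : Tendsto (fun e : ℝ => (Y ^ (1 / p) + e) ^ (p - 1) * (Z ^ (1 / p) + e)) (𝓝[>] 0)
      (𝓝 ((Y ^ (1 / p) + 0) ^ (p - 1) * (Z ^ (1 / p) + 0))) := by
    have : Continuous (fun e : ℝ => (Y ^ (1 / p) + e) ^ (p - 1) * (Z ^ (1 / p) + e)) :=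
      ((Real.continuous_rpow_const (by linarith)).comp (by fun_prop)).mul (by fun_prop)
    exact (this.tendsto 0).mono_left nhdsWithin_le_nhds
  rw [add_zero, add_zero] at hc
  exact ge_of_tendsto hc (eventually_mem_nhdsWithin.mono key)

/-- The cancellation which ends each duality argument below; it avoids a separate treatment of norm
zero. -/
lemma le_of_rpow_le_rpow_sub_one_mul {p a K : ℝ} (ha : 0 ≤ a) (hK : 0 ≤ K)
    (h : a ^ p ≤ a ^ (p - 1) * K) : a ≤ K := by
  rcases ha.eq_or_lt with rfl | ha
  · exact hK
  · have h6 : a ^ p = a ^ (p - 1) * a := by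
      rw [Real.rpow_sub_one ha.ne', div_mul_cancel₀ _ ha.ne']
    rw [h6] at h
    exact le_of_mul_le_mul_left h (Real.rpow_pos_of_pos ha _)

/-! ### Young, Hölder and Minkowski inequalities for nonnegative elements -/

namespace TracialState

variable {A : Type*} [CStarAlgebra A] [PartialOrder A] [StarOrderedRing A] (φ : TracialState A)

/-- The `p`-norm of a nonnegative element. -/
def nrm (p : ℝ) (a : A) : ℝ := φ.tr (powR p a) ^ (1 / p)

/-- The `p`-norm. -/
def pn (p : ℝ) (x : A) : ℝ := φ.nrm p (mabs x)

variable {p : ℝ}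

lemma tr_powR_nonneg (p : ℝ) {a : A} (ha : 0 ≤ a) : 0 ≤ φ.tr (powR p a) :=
  φ.tr_nonneg (powR_nonneg p ha)

lemma nrm_nonneg (p : ℝ) {a : A} (ha : 0 ≤ a) : 0 ≤ φ.nrm p a :=
  Real.rpow_nonneg (φ.tr_powR_nonneg p ha) _

lemma pn_nonneg (p : ℝ) (x : A) : 0 ≤ φ.pn p x := φ.nrm_nonneg p (mabs_nonneg x)

lemma nrm_rpow (hp : 1 ≤ p) {a : A} (ha : 0 ≤ a) : φ.nrm p a ^ p = φ.tr (powR p a) := by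
  rw [nrm, ← Real.rpow_mul (φ.tr_powR_nonneg p ha), one_div_mul_cancel (by linarith),
    Real.rpow_one]

lemma nrm_smul (hp : 1 ≤ p) {c : ℝ} (hc : 0 ≤ c) {a : A} (ha : 0 ≤ a) :
    φ.nrm p (c • a) = c * φ.nrm p a := by
  have hp0 : p ≠ 0 := by linarith
  rw [nrm, nrm, powR_smul (by linarith) hc ha, map_smul, smul_eq_mul,
    Real.mul_rpow (Real.rpow_nonneg hc _) (φ.tr_powR_nonneg p ha), ← Real.rpow_mul hc,
    mul_one_div_cancel hp0, Real.rpow_one]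

lemma nrm_algebraMap (hp : 1 ≤ p) {c : ℝ} (hc : 0 ≤ c) : φ.nrm p (algebraMap ℝ A c) = c := by
  rw [nrm, powR_algebraMap, tr_algebraMap, ← Real.rpow_mul hc, mul_one_div_cancel (by linarith),
    Real.rpow_one]

/-- For scalars `p t^(p-1) s ≤ (p-1) t^p + s^p`. With `t` fixed, the functional calculus of `a` in
the variable `s` makes this an operator inequality; `tr_sum_cfc_mul_nonneg` then puts `c` in place
of `t`. The bound on `c` reflects the interval `[0, 1]` in that lemma. -/
lemma young_aux (hp : 1 ≤ p) {c a : A} (hc : 0 ≤ c) (hc1 : ‖c‖ ≤ 1) (ha : 0 ≤ a) :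
    p * φ.tr (powR (p - 1) c * a) ≤ (p - 1) * φ.tr (powR p c) + φ.tr (powR p a) := by
  have hp0 : 0 < p := by linarith
  have hcont : ∀ r : ℝ, 0 ≤ r → Continuous (fun t : ℝ => t ^ r) := fun r hr =>
    Real.continuous_rpow_const hr
  have h := φ.tr_sum_cfc_mul_nonneg (Finset.univ : Finset (Fin 3))
    ![fun t => -p * t ^ (p - 1), fun t => (p - 1) * t ^ p, fun _ => 1]
    ![a, 1, powR p a] (by
      intro i
      fin_cases i
      · exact (continuous_const.mul (hcont _ (by linarith))).continuousOn
      · exact (continuous_const.mul (hcont _ hp0.le)).continuousOn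
      · exact continuousOn_const) (by
      intro t ht
      have h1 := continuousOn_spectrum (continuousOn_rpow hp0.le) ha
      have h2 : ContinuousOn (fun s : ℝ => -p * t ^ (p - 1) * s) (spectrum ℝ a) := by fun_prop
      have : ∑ i : Fin 3, ((![fun t => -p * t ^ (p - 1), fun t => (p - 1) * t ^ p, fun _ => 1] :
          Fin 3 → ℝ → ℝ) i t) • ((![a, 1, powR p a] : Fin 3 → A) i)
          = cfc (fun s => -p * t ^ (p - 1) * s + ((p - 1) * t ^ p + s ^ p)) a := by
        rw [cfc_add (a := a) (fun s => -p * t ^ (p - 1) * s)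
          (fun s => (p - 1) * t ^ p + s ^ p) h2 (continuousOn_const.add h1),
          cfc_const_add _ _ a h1, cfc_const_mul_id _ a]
        simp [Fin.sum_univ_three, powR, Algebra.algebraMap_eq_smul_one, add_assoc]
      rw [this]
      refine cfc_nonneg fun s hs => ?_
      have hs0 : 0 ≤ s := spectrum_subset_Ici ha hs
      have ht0 : 0 ≤ t := ht.1
      have h3 := Real.geom_mean_le_arith_mean2_weighted (w₁ := 1 - 1 / p) (w₂ := 1 / p)
        (p₁ := t ^ p) (p₂ := s ^ p)
        (by rw [sub_nonneg, div_le_one hp0]; exact hp) (by positivity)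
        (Real.rpow_nonneg ht0 _) (Real.rpow_nonneg hs0 _) (by ring)
      rw [← Real.rpow_mul ht0, ← Real.rpow_mul hs0, mul_one_div_cancel hp0.ne', Real.rpow_one,
        show p * (1 - 1 / p) = p - 1 by field_simp] at h3
      have h4 : p * (t ^ (p - 1) * s) ≤ p * ((1 - 1 / p) * t ^ p + 1 / p * s ^ p) :=
        mul_le_mul_of_nonneg_left h3 hp0.le
      have h5 : p * ((1 - 1 / p) * t ^ p + 1 / p * s ^ p) = (p - 1) * t ^ p + s ^ p := by
        field_simp
      linarith) hc hc1
  have e1 : cfc (fun t : ℝ => -p * t ^ (p - 1)) c = (-p) • powR (p - 1) c :=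
    cfc_const_mul _ _ c (hcont _ (by linarith)).continuousOn
  have e2 : cfc (fun t : ℝ => (p - 1) * t ^ p) c = (p - 1) • powR p c :=
    cfc_const_mul _ _ c (hcont _ hp0.le).continuousOn
  have e3 : cfc (fun _ : ℝ => (1 : ℝ)) c = 1 := cfc_const_one ℝ c
  rw [Fin.sum_univ_three] at h
  simp only [Matrix.cons_val_zero, Matrix.cons_val_one, Matrix.cons_val, e1, e2, e3,
    smul_mul_assoc, map_smul, smul_eq_mul, mul_one, one_mul] at h
  linarith

/-- Young's inequality for a tracial state. -/
lemma young (hp : 1 ≤ p) {c a : A} (hc : 0 ≤ c) (ha : 0 ≤ a) :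
    p * φ.tr (powR (p - 1) c * a) ≤ (p - 1) * φ.tr (powR p c) + φ.tr (powR p a) := by
  have hp0 : 0 < p := by linarith
  -- Both sides are homogeneous of degree `p` under a joint scaling of `c` and `a`, which reduces to
  -- a contraction `c`.
  set k : ℝ := (‖c‖ + 1)⁻¹ with hk
  have hk0 : 0 < k := by positivity
  have h1 : ‖k • c‖ ≤ 1 := by
    rw [norm_smul, Real.norm_of_nonneg hk0.le, hk]
    exact inv_mul_le_one_of_le₀ (by linarith) (by positivity)
  have h := φ.young_aux hp (smul_nonneg hk0.le hc) h1 (smul_nonneg hk0.le ha)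
  rw [powR_smul (by linarith) hk0.le hc, powR_smul hp0.le hk0.le hc,
    powR_smul hp0.le hk0.le ha, smul_mul_smul_comm, map_smul, map_smul, map_smul] at h
  simp only [smul_eq_mul] at h
  rw [← Real.rpow_add_one hk0.ne', sub_add_cancel] at h
  have h2 : k ^ p * (p * φ.tr (powR (p - 1) c * a))
      ≤ k ^ p * ((p - 1) * φ.tr (powR p c) + φ.tr (powR p a)) := by linarith
  exact le_of_mul_le_mul_left h2 (Real.rpow_pos_of_pos hk0 _)

/-- Hölder's inequality for nonnegative elements. -/
lemma tr_powR_sub_one_mul_le (hp : 1 ≤ p) {c a : A} (hc : 0 ≤ c) (ha : 0 ≤ a) :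
    φ.tr (powR (p - 1) c * a) ≤ φ.nrm p c ^ (p - 1) * φ.nrm p a := by
  refine le_rpow_mul_of_young hp (φ.tr_powR_nonneg p hc) (φ.tr_powR_nonneg p ha) fun l hl => ?_
  have h := φ.young hp hc (smul_nonneg hl.le ha)
  rwa [mul_smul_comm, map_smul, powR_smul (by linarith) hl.le ha, map_smul] at h

lemma tr_powR_eq (hp : 1 ≤ p) {a : A} (ha : 0 ≤ a) :
    φ.tr (powR p a) = φ.tr (powR (p - 1) a * a) := by
  conv_rhs => rw [← powR_one ha, powR_powR zero_le_one (by linarith) ha, one_mul,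
    powR_mul (by linarith) zero_le_one ha, sub_add_cancel]

/-- Since `t ↦ t^p` is not operator monotone for `p > 1`, the comparison is made against the fixed
element `a^(p-1)`, where the trace is monotone, and Hölder's inequality is applied to the result.
Minkowski's inequality below pairs with `(a+b)^(p-1)` in the same way. -/
lemma nrm_mono (hp : 1 ≤ p) {a b : A} (ha : 0 ≤ a) (hab : a ≤ b) : φ.nrm p a ≤ φ.nrm p b := by
  have hb := ha.trans hab
  refine le_of_rpow_le_rpow_sub_one_mul (p := p) (φ.nrm_nonneg p ha) (φ.nrm_nonneg p hb) ?_
  rw [φ.nrm_rpow hp ha, φ.tr_powR_eq hp ha]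
  exact (φ.tr_mul_mono (powR_nonneg _ ha) hab).trans (φ.tr_powR_sub_one_mul_le hp ha hb)

lemma nrm_add_le (hp : 1 ≤ p) {a b : A} (ha : 0 ≤ a) (hb : 0 ≤ b) :
    φ.nrm p (a + b) ≤ φ.nrm p a + φ.nrm p b := by
  have hab := add_nonneg ha hb
  refine le_of_rpow_le_rpow_sub_one_mul (p := p) (φ.nrm_nonneg p hab)
    (add_nonneg (φ.nrm_nonneg p ha) (φ.nrm_nonneg p hb)) ?_
  rw [φ.nrm_rpow hp hab, φ.tr_powR_eq hp hab, mul_add (powR _ _), map_add, mul_add]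
  exact add_le_add (φ.tr_powR_sub_one_mul_le hp hab ha) (φ.tr_powR_sub_one_mul_le hp hab hb)

lemma nrm_star_mul_self (hp : 1 ≤ p) (x : A) : φ.nrm p (star x * x) = φ.nrm p (x * star x) := by
  rw [nrm, nrm, powR, powR, φ.tr_cfc_star_mul_self x (continuousOn_rpow (by linarith))]

lemma pn_star (hp : 1 ≤ p) (x : A) : φ.pn p (star x) = φ.pn p x := by
  have hp0 : 0 ≤ p := by linarith
  rw [pn, pn, nrm, nrm, powR_mabs hp0, powR_mabs hp0, powR, powR, star_star,
    φ.tr_cfc_star_mul_self x (continuousOn_rpow (by linarith))]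

lemma sq_pn_two_mul (hp : 1 ≤ p) (x : A) : φ.pn (2 * p) x ^ 2 = φ.nrm p (star x * x) := by
  have hb := star_mul_self_nonneg x
  rw [pn, nrm, nrm, powR_mabs (by linarith), mul_div_cancel_left₀ p two_ne_zero,
    ← Real.rpow_natCast, ← Real.rpow_mul (φ.tr_powR_nonneg p hb)]
  congr 1
  push_cast
  field_simp

lemma pn_rpow (hp : 1 ≤ p) (x : A) : φ.pn p x ^ p = φ.tr (powR (p / 2) (star x * x)) := by
  rw [pn, φ.nrm_rpow hp (mabs_nonneg x), powR_mabs (by linarith)]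

end TracialState

/-! ### Factoring a bounded element through its two moduli -/

section Factor

variable {A : Type*} [CStarAlgebra A] [PartialOrder A] [StarOrderedRing A]

lemma norm_one_le : ‖(1 : A)‖ ≤ 1 := by
  rcases subsingleton_or_nontrivial A with h | h
  · rw [Subsingleton.elim (1 : A) 0, norm_zero]; exact zero_le_one
  · rw [CStarRing.norm_one]

lemma star_cfc_real (f : ℝ → ℝ) (a : A) : star (cfc f a) = cfc f a :=
  (cfc_predicate f a : IsSelfAdjoint _).star_eq

lemma continuousOn_inv_sqrt_add {δ : ℝ} (hδ : 0 < δ) :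
    ContinuousOn (fun t : ℝ => (√t + δ)⁻¹) (Set.Ici 0) :=
  (Continuous.inv₀ (by fun_prop) fun t => by have := Real.sqrt_nonneg t; positivity).continuousOn

/-- The element `x ψ(x⋆ x)` has square `t ψ(t) ^ 2` evaluated at `x⋆ x`. -/
lemma star_mul_self_mul_cfc (x : A) {f : ℝ → ℝ} (hf : ContinuousOn f (Set.Ici 0)) :
    star (x * cfc f (star x * x)) * (x * cfc f (star x * x))
      = cfc (fun t => t * f t ^ 2) (star x * x) := by
  have hb := star_mul_self_nonneg x
  have hid : ContinuousOn (fun t : ℝ => t) (Set.Ici 0) := continuousOn_id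
  have h1 : star x * x = cfc (fun t : ℝ => t) (star x * x) := (cfc_id' ℝ _).symm
  calc _ = cfc f (star x * x) * (star x * x) * cfc f (star x * x) := by
        rw [star_mul, star_cfc_real]; simp only [mul_assoc]
    _ = cfc f (star x * x) * cfc (fun t : ℝ => t) (star x * x) * cfc f (star x * x) := by
        rw [← h1]
    _ = _ := by
        rw [cfc_mul_Ici hf hid hb, cfc_mul_Ici (hf.fun_mul hid) hf hb]
        exact cfc_congr_Ici (fun t _ => by ring) hb

lemma norm_mul_cfc_le (x : A) {f : ℝ → ℝ} (hf : ContinuousOn f (Set.Ici 0)) {C : ℝ} (hC : 0 ≤ C)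
    (h : ∀ t, 0 ≤ t → t * f t ^ 2 ≤ C ^ 2) : ‖x * cfc f (star x * x)‖ ≤ C := by
  have h1 : ‖x * cfc f (star x * x)‖ * ‖x * cfc f (star x * x)‖ ≤ C * C := by
    rw [← CStarRing.norm_star_mul_self, star_mul_self_mul_cfc x hf]
    refine norm_cfc_le (by positivity) fun t ht => ?_
    have ht0 : 0 ≤ t := spectrum_subset_Ici (star_mul_self_nonneg x) ht
    rw [Real.norm_of_nonneg (by positivity), ← sq]
    exact h t ht0
  exact abs_le_of_sq_le_sq' (by nlinarith) hC |>.2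

/-- A factorization of `x` through the square roots of `|x⋆| + δ` and `|x| + δ`. -/
lemma exists_factorization (x : A) {δ : ℝ} (hδ : 0 < δ) :
    x = cfc (fun t => √(√t + δ)) (x * star x) * (x * cfc (fun t => (√t + δ)⁻¹) (star x * x))
      * cfc (fun t => √(√t + δ)) (star x * x) ∧
    ‖x * cfc (fun t => (√t + δ)⁻¹) (star x * x)‖ ≤ 1 := by
  have hb := star_mul_self_nonneg x
  have hs : ContinuousOn (fun t : ℝ => √(√t + δ)) (Set.Ici 0) :=
    (by fun_prop : Continuous _).continuousOn
  have hi := continuousOn_inv_sqrt_add hδ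
  constructor
  -- Moving the left factor through `x` leaves `x` times three functions of `x⋆ x` whose product is
  -- `1`.
  · rw [← mul_assoc, ← mul_cfc_star_mul_self x hs, mul_assoc, mul_assoc, cfc_mul_Ici hi hs hb,
      cfc_mul_Ici hs (hi.fun_mul hs) hb]
    have : cfc (fun t => √(√t + δ) * ((√t + δ)⁻¹ * √(√t + δ))) (star x * x)
        = cfc (fun _ => (1 : ℝ)) (star x * x) := cfc_congr_Ici (fun t _ => by
      have h0 : 0 < √t + δ := by have := Real.sqrt_nonneg t; positivity
      have h1 : √(√t + δ) * √(√t + δ) = √t + δ := Real.mul_self_sqrt h0.le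
      field_simp
      nlinarith) hb
    rw [this, cfc_const_one ℝ (star x * x), mul_one]
  · refine norm_mul_cfc_le x hi zero_le_one fun t ht => ?_
    have h0 : 0 < √t + δ := by have := Real.sqrt_nonneg t; positivity
    rw [inv_pow, ← div_eq_mul_inv, div_le_iff₀ (by positivity)]
    nlinarith [Real.sq_sqrt ht, Real.sqrt_nonneg t]

lemma cfc_sqrt_add_sq {b : A} (hb : 0 ≤ b) {δ : ℝ} (hδ : 0 < δ) :
    cfc (fun t => √(√t + δ)) b * cfc (fun t => √(√t + δ)) b
      = powR (1 / 2) b + algebraMap ℝ A δ := by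
  have hs : ContinuousOn (fun t : ℝ => √(√t + δ)) (Set.Ici 0) :=
    (by fun_prop : Continuous _).continuousOn
  rw [cfc_mul_Ici hs hs hb, powR, ← cfc_add_const _ _ b
    (continuousOn_spectrum (continuousOn_rpow (by norm_num)) hb)]
  refine cfc_congr_Ici (fun t _ => ?_) hb
  rw [Real.mul_self_sqrt (by have := Real.sqrt_nonneg t; positivity), Real.sqrt_eq_rpow]

end Factor

/-! ### Duality for the `p`-norm: Hölder, Minkowski and the ideal property -/

namespace TracialState

variable {A : Type*} [CStarAlgebra A] [PartialOrder A] [StarOrderedRing A] (φ : TracialState A)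
variable {p : ℝ}

/-- The regularized dual element `|z| ^ ((p-1)/2) v |z⋆| ^ ((p-1)/2)`, `v = (|z| + ε)⁻¹ z⋆`. -/
def dualElt (p ε : ℝ) (z : A) : A :=
  powR ((p - 1) / 4) (star z * z) * (cfc (fun t => (√t + ε)⁻¹) (star z * z) * star z)
    * powR ((p - 1) / 4) (z * star z)

/-- The product `dualElt p ε z * z` is the function `|z|^(p-1) |z|² (|z| + ε)⁻¹` of `z⋆ z`, and `s ≤
s² (s + ε)⁻¹ + ε` for `s ≥ 0`. The regularization by `ε` avoids the polar decomposition, whose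
partial isometry need not lie in `A`. -/
lemma pn_rpow_le_tr_dualElt (hp : 1 ≤ p) {ε : ℝ} (hε : 0 < ε) (z : A) :
    φ.pn p z ^ p ≤ φ.tr (dualElt p ε z * z)
      + ε * φ.tr (powR ((p - 1) / 2) (star z * z)) := by
  have hb := star_mul_self_nonneg z
  have hk : 0 ≤ (p - 1) / 4 := by linarith
  have hP := continuousOn_rpow hk
  have hi := continuousOn_inv_sqrt_add hε
  have hid : ContinuousOn (fun t : ℝ => t) (Set.Ici 0) := continuousOn_id
  have h0 : star z * z = cfc (fun t : ℝ => t) (star z * z) := (cfc_id' ℝ _).symm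
  have e1 : dualElt p ε z * z = cfc (fun t : ℝ => t ^ ((p - 1) / 4) * (√t + ε)⁻¹ * t
      * t ^ ((p - 1) / 4)) (star z * z) := by
    calc dualElt p ε z * z = powR ((p - 1) / 4) (star z * z)
          * (cfc (fun t => (√t + ε)⁻¹) (star z * z) * star z)
          * (z * powR ((p - 1) / 4) (star z * z)) := by
          rw [dualElt, mul_assoc]
          congr 1
          exact (mul_cfc_star_mul_self z hP).symm
      _ = powR ((p - 1) / 4) (star z * z) * cfc (fun t => (√t + ε)⁻¹) (star z * z)
          * (star z * z) * powR ((p - 1) / 4) (star z * z) := by simp only [mul_assoc]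
      _ = powR ((p - 1) / 4) (star z * z) * cfc (fun t => (√t + ε)⁻¹) (star z * z)
          * cfc (fun t : ℝ => t) (star z * z) * powR ((p - 1) / 4) (star z * z) := by rw [← h0]
      _ = _ := by
          rw [powR, cfc_mul_Ici hP hi hb, cfc_mul_Ici (hP.fun_mul hi) hid hb,
            cfc_mul_Ici ((hP.fun_mul hi).fun_mul hid) hP hb]
  rw [φ.pn_rpow hp, e1, ← smul_eq_mul ε, ← map_smul, ← map_add, powR, powR]
  have hq := continuousOn_spectrum (continuousOn_rpow (r := (p - 1) / 2) (by linarith)) hb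
  have hF := continuousOn_spectrum (((hP.fun_mul hi).fun_mul hid).fun_mul hP) hb
  rw [← cfc_const_mul ε _ _ hq, ← cfc_add (a := star z * z) _ _ hF (continuousOn_const.fun_mul hq)]
  refine φ.tr_mono (cfc_mono (fun t ht => ?_)
    (continuousOn_spectrum (continuousOn_rpow (by linarith)) hb)
    (hF.fun_add (continuousOn_const.fun_mul hq)))
  have ht0 : 0 ≤ t := spectrum_subset_Ici hb ht
  have hs := Real.sqrt_nonneg t
  have hss := Real.sq_sqrt ht0
  have e2 : t ^ (p / 2) = t ^ ((p - 1) / 2) * √t := by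
    rw [Real.sqrt_eq_rpow, ← Real.rpow_add_of_nonneg ht0 (by linarith) (by norm_num)]
    congr 1; ring
  have e3 : t ^ ((p - 1) / 2) = t ^ ((p - 1) / 4) * t ^ ((p - 1) / 4) := by
    rw [← Real.rpow_add_of_nonneg ht0 hk hk]
    congr 1; ring
  have e4 : √t ≤ (√t + ε)⁻¹ * t + ε := by
    have : 0 < √t + ε := by positivity
    rw [← sub_le_iff_le_add, inv_mul_eq_div, le_div_iff₀ this]
    nlinarith
  have hr := Real.rpow_nonneg ht0 ((p - 1) / 4)
  calc t ^ (p / 2) = (t ^ ((p - 1) / 4) * t ^ ((p - 1) / 4)) * √t := by rw [e2, e3]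
    _ ≤ (t ^ ((p - 1) / 4) * t ^ ((p - 1) / 4)) * ((√t + ε)⁻¹ * t + ε) := by gcongr
    _ = _ := by rw [e3]; ring

/-- The dual element carries half of the power `p - 1` on each side. Cyclicity places one half next
to `b` and the other next to `a`; Cauchy–Schwarz separates them into `tr (|z|^(p-1) b⋆ b)` and,
after discarding the contraction `v` and the norm of `h`, `tr (|z⋆|^(p-1) a a⋆)`. Hölder's
inequality for nonnegative elements bounds both. -/
lemma tr_dualElt_mul_le (hp : 1 ≤ p) {ε : ℝ} (hε : 0 < ε) (z a h b : A) :
    φ.tr (dualElt p ε z * (a * h * b)) ≤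
      φ.pn p z ^ (p - 1) * (‖h‖ * √(φ.nrm p (a * star a) * φ.nrm p (star b * b))) := by
  have hk : 0 ≤ (p - 1) / 4 := by linarith
  have hz := star_mul_self_nonneg z
  have hz' := mul_star_self_nonneg z
  set P := powR ((p - 1) / 4) (star z * z) with hP
  set P' := powR ((p - 1) / 4) (z * star z) with hP'
  set v := cfc (fun t => (√t + ε)⁻¹) (star z * z) * star z with hv
  have hPs : star P = P := star_cfc_real _ _
  have hPs' : star P' = P' := star_cfc_real _ _
  have hPP : P * P = powR (p - 1) (mabs z) := by
    rw [hP, powR_mul hk hk hz, powR_mabs (by linarith)]; congr 1; ring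
  have hPP' : P' * P' = powR (p - 1) (mabs (star z)) := by
    rw [hP', powR_mul hk hk hz', powR_mabs (by linarith), star_star]; congr 1; ring
  have hv1 : ‖v‖ ≤ 1 := by
    have := (exists_factorization z hε).2
    rw [← norm_star, star_mul, star_cfc_real] at this
    exact this
  set n := φ.pn p z with hn
  have hn0 : 0 ≤ n := φ.pn_nonneg p z
  set N := φ.nrm p (a * star a)
  set N' := φ.nrm p (star b * b)
  have hN : 0 ≤ N := φ.nrm_nonneg p (mul_star_self_nonneg a)
  have hN' : 0 ≤ N' := φ.nrm_nonneg p (star_mul_self_nonneg b)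
  have hw : φ.tr (dualElt p ε z * (a * h * b)) = φ.tr (star (star (b * P)) * (v * P' * a * h)) := by
    have e1 : dualElt p ε z * (a * h * b) = (P * v * P' * a * h) * b := by
      simp only [dualElt, mul_assoc, hP, hP', hv]
    have e2 : star (star (b * P)) * (v * P' * a * h) = b * (P * v * P' * a * h) := by
      simp only [star_star, mul_assoc]
    rw [e1, e2, φ.tr_comm]
  have h1 : φ.tr (star (star (b * P)) * star (b * P)) ≤ n ^ (p - 1) * N' := by
    have : φ.tr (star (star (b * P)) * star (b * P)) = φ.tr (P * P * (star b * b)) := by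
      rw [star_star, star_mul, hPs, mul_assoc b, φ.tr_comm b]
      simp only [mul_assoc]
    rw [this, hPP]
    exact φ.tr_powR_sub_one_mul_le hp (mabs_nonneg z) (star_mul_self_nonneg b)
  have h2 : φ.tr (star (v * P' * a * h) * (v * P' * a * h)) ≤ ‖h‖ ^ 2 * (n ^ (p - 1) * N) := by
    have s1 : φ.tr (star (v * P' * a * h) * (v * P' * a * h))
        ≤ φ.tr (star (P' * a * h) * (P' * a * h)) := by
      refine φ.tr_mono ?_
      have : star v * v ≤ 1 := by
        have := CStarAlgebra.star_mul_le_algebraMap_norm_sq (a := v)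
        refine this.trans ?_
        rw [← map_one (algebraMap ℝ A)]
        exact algebraMap_mono A (pow_le_one₀ (norm_nonneg _) hv1)
      have h3 := star_left_conjugate_le_conjugate this (P' * a * h)
      simp only [mul_one] at h3
      refine le_trans (le_of_eq ?_) h3
      simp only [star_mul, mul_assoc]
    have s2 : φ.tr (star (P' * a * h) * (P' * a * h))
        = φ.tr (star (P' * a) * (P' * a) * (h * star h)) := by
      rw [star_mul, mul_assoc, φ.tr_comm]
      simp only [mul_assoc]
    have s3 := φ.tr_mul_mono (star_mul_self_nonneg (P' * a))
      (CStarAlgebra.mul_star_le_algebraMap_norm_sq (a := h))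
    have s4 : φ.tr (star (P' * a) * (P' * a) * algebraMap ℝ A (‖h‖ ^ 2))
        = ‖h‖ ^ 2 * φ.tr (P' * P' * (a * star a)) := by
      rw [Algebra.algebraMap_eq_smul_one, mul_smul_comm, mul_one, map_smul, smul_eq_mul,
        star_mul, hPs', mul_assoc, φ.tr_comm (star a)]
      simp only [mul_assoc]
    rw [s2] at s1
    refine s1.trans (s3.trans ?_)
    rw [s4, hPP']
    gcongr
    rw [hn, ← φ.pn_star hp z]
    exact φ.tr_powR_sub_one_mul_le hp (mabs_nonneg _) (mul_star_self_nonneg a)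
  rw [hw]
  refine le_trans (le_abs_self _) (abs_le_of_sq_le_sq (le_trans (φ.cauchy_schwarz _ _)
    ((mul_le_mul h1 h2 (φ.tr_star_mul_self _) (by positivity)).trans (le_of_eq ?_)))
    (by positivity))
  rw [mul_pow, mul_pow, Real.sq_sqrt (by positivity)]
  ring

/-- The `p`-norm of a sum of products is controlled by those of the factors. -/
lemma pn_sum_le (hp : 1 ≤ p) {ι : Type*} (s : Finset ι) (a h b : ι → A) :
    φ.pn p (∑ i ∈ s, a i * h i * b i) ≤
      ∑ i ∈ s, ‖h i‖ * √(φ.nrm p (a i * star (a i)) * φ.nrm p (star (b i) * b i)) := by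
  set z := ∑ i ∈ s, a i * h i * b i with hz
  refine le_of_rpow_le_rpow_sub_one_mul (p := p) (φ.pn_nonneg p z)
    (Finset.sum_nonneg fun i _ => by positivity) ?_
  -- The dual element of the whole sum is paired with each term separately, so one argument yields
  -- both Hölder's and Minkowski's inequality.
  have key : ∀ ε : ℝ, 0 < ε → φ.pn p z ^ p ≤ φ.pn p z ^ (p - 1) * (∑ i ∈ s, ‖h i‖
      * √(φ.nrm p (a i * star (a i)) * φ.nrm p (star (b i) * b i)))
      + ε * φ.tr (powR ((p - 1) / 2) (star z * z)) := by
    intro ε hε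
    refine (φ.pn_rpow_le_tr_dualElt hp hε z).trans (add_le_add_left ?_ _)
    conv_lhs => rw [hz, ← hz, Finset.mul_sum, map_sum]
    rw [Finset.mul_sum]
    exact Finset.sum_le_sum fun i _ => φ.tr_dualElt_mul_le hp hε z _ _ _
  set K := φ.pn p z ^ (p - 1) * (∑ i ∈ s, ‖h i‖
      * √(φ.nrm p (a i * star (a i)) * φ.nrm p (star (b i) * b i)))
  set t := φ.tr (powR ((p - 1) / 2) (star z * z))
  have hlim : Tendsto (fun ε : ℝ => K + ε * t) (𝓝[>] 0) (𝓝 (K + 0 * t)) :=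
    ((by fun_prop : Continuous fun ε : ℝ => K + ε * t).tendsto 0).mono_left nhdsWithin_le_nhds
  rw [zero_mul, add_zero] at hlim
  exact ge_of_tendsto hlim (eventually_mem_nhdsWithin.mono key)

lemma pn_mul_le (hp : 1 ≤ p) (a h b : A) :
    φ.pn p (a * h * b) ≤ ‖h‖ * √(φ.nrm p (a * star a) * φ.nrm p (star b * b)) := by
  simpa using φ.pn_sum_le hp (Finset.univ : Finset Unit) (fun _ => a) (fun _ => h) (fun _ => b)

/-- Hölder's inequality. -/
lemma pn_mul_mul_le (hp : 1 ≤ p) (a h b : A) :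
    φ.pn p (a * h * b) ≤ φ.pn (2 * p) a * ‖h‖ * φ.pn (2 * p) b := by
  have h1 := φ.pn_mul_le hp a h b
  rw [← φ.nrm_star_mul_self hp, ← φ.sq_pn_two_mul hp, ← φ.sq_pn_two_mul hp, ← mul_pow,
    Real.sqrt_sq (mul_nonneg (φ.pn_nonneg _ _) (φ.pn_nonneg _ _))] at h1
  linarith

/-- An almost optimal factorization. -/
lemma exists_factors (hp : 1 ≤ p) (x : A) {δ : ℝ} (hδ : 0 < δ) :
    ∃ a h b : A, x = a * h * b ∧ ‖h‖ ≤ 1 ∧ φ.nrm p (a * star a) ≤ φ.pn p x + δ ∧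
      φ.nrm p (star b * b) ≤ φ.pn p x + δ := by
  obtain ⟨h1, h2⟩ := exists_factorization x hδ
  have hle : ∀ y : A, φ.nrm p (mabs y + algebraMap ℝ A δ) ≤ φ.pn p y + δ := fun y => by
    refine (φ.nrm_add_le hp (mabs_nonneg y) (algebraMap_nonneg A hδ.le)).trans ?_
    rw [φ.nrm_algebraMap hp hδ.le]
    rfl
  refine ⟨_, _, _, h1, h2, ?_, ?_⟩
  · rw [star_cfc_real, cfc_sqrt_add_sq (mul_star_self_nonneg x) hδ, ← φ.pn_star hp]
    have := hle (star x)
    rwa [mabs, star_star] at this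
  · rw [star_cfc_real, cfc_sqrt_add_sq (star_mul_self_nonneg x) hδ]
    exact hle x

/-- Minkowski's inequality. -/
lemma pn_add_le (hp : 1 ≤ p) (x y : A) : φ.pn p (x + y) ≤ φ.pn p x + φ.pn p y := by
  refine le_of_forall_pos_le_add fun ε hε => ?_
  obtain ⟨a, h, b, h1, h2, h3, h4⟩ := φ.exists_factors hp x (half_pos hε)
  obtain ⟨a', h', b', h1', h2', h3', h4'⟩ := φ.exists_factors hp y (half_pos hε)
  have hx : 0 ≤ φ.pn p x + ε / 2 := add_nonneg (φ.pn_nonneg p x) (half_pos hε).le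
  have hy : 0 ≤ φ.pn p y + ε / 2 := add_nonneg (φ.pn_nonneg p y) (half_pos hε).le
  have key := φ.pn_sum_le hp (Finset.univ : Finset (Fin 2)) ![a, a'] ![h, h'] ![b, b']
  simp only [Fin.sum_univ_two, Matrix.cons_val_zero, Matrix.cons_val_one, ← h1, ← h1'] at key
  have e1 : ‖h‖ * √(φ.nrm p (a * star a) * φ.nrm p (star b * b)) ≤ φ.pn p x + ε / 2 := by
    refine (mul_le_of_le_one_left (Real.sqrt_nonneg _) h2).trans (Real.sqrt_le_iff.2 ⟨hx, ?_⟩)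
    rw [sq]
    exact mul_le_mul h3 h4 (φ.nrm_nonneg p (star_mul_self_nonneg b)) hx
  have e2 : ‖h'‖ * √(φ.nrm p (a' * star a') * φ.nrm p (star b' * b')) ≤ φ.pn p y + ε / 2 := by
    refine (mul_le_of_le_one_left (Real.sqrt_nonneg _) h2').trans (Real.sqrt_le_iff.2 ⟨hy, ?_⟩)
    rw [sq]
    exact mul_le_mul h3' h4' (φ.nrm_nonneg p (star_mul_self_nonneg b')) hy
  linarith

lemma nrm_conj_le (hp : 1 ≤ p) (a x : A) :
    φ.nrm p (star (a * x) * (a * x)) ≤ ‖a‖ ^ 2 * φ.nrm p (star x * x) := by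
  rw [← φ.nrm_smul hp (by positivity) (star_mul_self_nonneg x)]
  refine φ.nrm_mono hp (star_mul_self_nonneg _) ?_
  have h3 := star_left_conjugate_le_conjugate
    (CStarAlgebra.star_mul_le_algebraMap_norm_sq (a := a)) x
  rw [Algebra.algebraMap_eq_smul_one, mul_smul_comm, mul_one, smul_mul_assoc] at h3
  refine le_trans (le_of_eq ?_) h3
  simp only [star_mul, mul_assoc]

/-- The ideal property of the `p`-norm. -/
lemma pn_conj_le (hp : 1 ≤ p) (a x b : A) : φ.pn p (a * x * b) ≤ ‖a‖ * φ.pn p x * ‖b‖ := by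
  have key : ∀ ε : ℝ, 0 < ε → φ.pn p (a * x * b) ≤ ‖a‖ * (φ.pn p x + ε) * ‖b‖ := by
    intro ε hε
    obtain ⟨c, h, d, h1, h2, h3, h4⟩ := φ.exists_factors hp x hε
    have hx : 0 ≤ φ.pn p x + ε := add_nonneg (φ.pn_nonneg p x) hε.le
    have e : a * x * b = (a * c) * h * (d * b) := by rw [h1]; simp only [mul_assoc]
    have e1 : φ.nrm p ((a * c) * star (a * c)) ≤ ‖a‖ ^ 2 * (φ.pn p x + ε) := by
      rw [← φ.nrm_star_mul_self hp]
      refine (φ.nrm_conj_le hp a c).trans ?_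
      rw [φ.nrm_star_mul_self hp]
      gcongr
    have e2 : φ.nrm p (star (d * b) * (d * b)) ≤ ‖b‖ ^ 2 * (φ.pn p x + ε) := by
      have := φ.nrm_conj_le hp (star b) (star d)
      rw [← star_mul, star_star, norm_star, ← φ.nrm_star_mul_self hp,
        φ.nrm_star_mul_self hp (star d), star_star] at this
      exact this.trans (by gcongr)
    rw [e]
    refine (φ.pn_mul_le hp _ _ _).trans ((mul_le_of_le_one_left (Real.sqrt_nonneg _) h2).trans
      (Real.sqrt_le_iff.2 ⟨by positivity, ?_⟩))
    refine (mul_le_mul e1 e2 (φ.nrm_nonneg p (star_mul_self_nonneg _)) (by positivity)).trans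
      (le_of_eq (by ring))
  have hlim : Tendsto (fun ε : ℝ => ‖a‖ * (φ.pn p x + ε) * ‖b‖) (𝓝[>] 0)
      (𝓝 (‖a‖ * (φ.pn p x + 0) * ‖b‖)) :=
    ((by fun_prop : Continuous fun ε : ℝ => ‖a‖ * (φ.pn p x + ε) * ‖b‖).tendsto 0).mono_left
      nhdsWithin_le_nhds
  rw [add_zero] at hlim
  exact ge_of_tendsto hlim (eventually_mem_nhdsWithin.mono key)

lemma pn_one_le (hp : 1 ≤ p) : φ.pn p (1 : A) ≤ 1 := by
  have h1 := φ.pn_mul_le hp (1 : A) 1 1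
  have h2 : φ.nrm p (1 : A) = 1 := by
    have := φ.nrm_algebraMap hp (zero_le_one)
    rwa [map_one] at this
  simp only [star_one, mul_one, h2, Real.sqrt_one] at h1
  refine h1.trans ?_
  exact norm_one_le

lemma pn_le_norm (hp : 1 ≤ p) (x : A) : φ.pn p x ≤ ‖x‖ := by
  have h1 := φ.pn_conj_le hp x 1 1
  rw [mul_one, mul_one] at h1
  refine h1.trans ?_
  have h3 : ‖(1 : A)‖ ≤ 1 := norm_one_le
  have h2 := φ.pn_one_le hp
  have h4 := φ.pn_nonneg p (1 : A)
  calc ‖x‖ * φ.pn p 1 * ‖(1 : A)‖ ≤ ‖x‖ * 1 * 1 := by gcongr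
    _ = ‖x‖ := by ring

lemma pn_proj_le (hp : 1 ≤ p) {e : A} (he : IsStarProjection e) :
    φ.pn p e ≤ φ.tr e ^ (1 / p) := by
  have hee : star e * e = e := by rw [he.isSelfAdjoint.star_eq, he.isIdempotentElem.eq]
  have hee' : e * star e = e := by rw [he.isSelfAdjoint.star_eq, he.isIdempotentElem.eq]
  have he0 : 0 ≤ e := hee ▸ star_mul_self_nonneg e
  have h1 := φ.pn_mul_le hp e 1 e
  rw [mul_one, hee, hee', he.isIdempotentElem.eq, Real.sqrt_mul_self (φ.nrm_nonneg p he0)] at h1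
  have h3 : ‖(1 : A)‖ ≤ 1 := norm_one_le
  refine h1.trans ((mul_le_of_le_one_left (φ.nrm_nonneg p he0) h3).trans ?_)
  refine Real.rpow_le_rpow (φ.tr_powR_nonneg p he0) (φ.tr_mono ?_) (by positivity)
  conv_rhs => rw [← cfc_id' ℝ e]
  refine cfc_mono (fun t ht => ?_) (continuousOn_spectrum (continuousOn_rpow (by linarith)) he0)
    continuousOn_id
  have := spectrum_subset_Icc he0 he.norm_le ht
  calc t ^ p ≤ t ^ (1 : ℝ) := Real.rpow_le_rpow_of_exponent_ge_of_imp this.1 this.2 hp (by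
        intros; linarith)
    _ = t := Real.rpow_one t

/-- The `p`-norm of `x ψ(x⋆ x)`. -/
lemma pn_mul_cfc_rpow (hp : 1 ≤ p) (x : A) {f : ℝ → ℝ} (hf : ContinuousOn f (Set.Ici 0)) :
    φ.pn p (x * cfc f (star x * x)) ^ p
      = φ.tr (cfc (fun t => (√t * |f t|) ^ p) (star x * x)) := by
  have hb := star_mul_self_nonneg x
  rw [φ.pn_rpow hp, star_mul_self_mul_cfc x hf, powR,
    cfc_comp_Ici (f := fun t => t * f t ^ 2) (continuousOn_id.fun_mul (hf.fun_pow 2)) (continuousOn_rpow (by linarith))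
    (fun t ht => mul_nonneg ht (sq_nonneg _)) hb]
  congr 1
  refine cfc_congr_Ici (fun t ht => ?_) hb
  have h0 : 0 ≤ √t * |f t| := by positivity
  have : t * f t ^ 2 = (√t * |f t|) ^ (2 : ℝ) := by
    rw [Real.rpow_two, mul_pow, Real.sq_sqrt ht, sq_abs]
  rw [this, ← Real.rpow_mul h0]
  congr 1; ring

/-- Superadditivity of `t ↦ t^p` on nonnegative reals, inside the functional calculus. It turns
convergence of a monotone family of norms into the Cauchy property for the `p`-norm, including the
case `p = 1`. -/
lemma pn_mul_cfc_sub_rpow_le (hp : 1 ≤ p) (x : A) {f g : ℝ → ℝ}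
    (hf : ContinuousOn f (Set.Ici 0)) (hg : ContinuousOn g (Set.Ici 0))
    (h0 : ∀ t, 0 ≤ t → 0 ≤ g t) (hgf : ∀ t, 0 ≤ t → g t ≤ f t) :
    φ.pn p (x * cfc f (star x * x) - x * cfc g (star x * x)) ^ p
      ≤ φ.pn p (x * cfc f (star x * x)) ^ p - φ.pn p (x * cfc g (star x * x)) ^ p := by
  have hb := star_mul_self_nonneg x
  have hc : ∀ k : ℝ → ℝ, ContinuousOn k (Set.Ici 0) →
      ContinuousOn (fun t => (√t * |k t|) ^ p) (Set.Ici 0) := fun k hk =>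
    (Real.continuous_rpow_const (by linarith)).comp_continuousOn
      (Real.continuous_sqrt.continuousOn.mul hk.abs)
  rw [← mul_sub, ← cfc_sub f g _ (continuousOn_spectrum hf hb) (continuousOn_spectrum hg hb),
    φ.pn_mul_cfc_rpow hp x (hf.fun_sub hg), φ.pn_mul_cfc_rpow hp x hf,
    φ.pn_mul_cfc_rpow hp x hg, ← map_sub, ← cfc_sub _ _ _ (continuousOn_spectrum (hc f hf) hb)
    (continuousOn_spectrum (hc g hg) hb)]
  refine φ.tr_mono (cfc_mono (fun t ht => ?_) (continuousOn_spectrum (hc _ (hf.fun_sub hg)) hb)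
    ((continuousOn_spectrum (hc f hf) hb).fun_sub (continuousOn_spectrum (hc g hg) hb)))
  have ht0 : 0 ≤ t := spectrum_subset_Ici hb ht
  have h1 := h0 t ht0
  have h2 := hgf t ht0
  rw [abs_of_nonneg h1, abs_of_nonneg (h1.trans h2), abs_of_nonneg (sub_nonneg.2 h2),
    le_sub_iff_add_le]
  refine (Real.add_rpow_le_rpow_add (by positivity) (mul_nonneg (Real.sqrt_nonneg _) h1)
    hp).trans (le_of_eq ?_)
  congr 1; ring

lemma pn_mul_cfc_le (hp : 1 ≤ p) (x : A) {f : ℝ → ℝ}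
    (h1 : ∀ t, 0 ≤ t → |f t| ≤ 1) : φ.pn p (x * cfc f (star x * x)) ≤ φ.pn p x := by
  have h := φ.pn_conj_le hp 1 x (cfc f (star x * x))
  rw [one_mul] at h
  have h3 : ‖(1 : A)‖ ≤ 1 := norm_one_le
  have h4 : ‖cfc f (star x * x)‖ ≤ 1 := norm_cfc_le zero_le_one fun t ht =>
    h1 t (spectrum_subset_Ici (star_mul_self_nonneg x) ht)
  have h5 := φ.pn_nonneg p x
  calc _ ≤ ‖(1 : A)‖ * φ.pn p x * ‖cfc f (star x * x)‖ := h
    _ ≤ 1 * φ.pn p x * 1 := by gcongr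
    _ = φ.pn p x := by ring

end TracialState

section

variable {H : Type u} [NormedAddCommGroup H] [InnerProductSpace ℂ H] [CompleteSpace H]

/-! ### A von Neumann algebra as an ordered C⋆-algebra -/

instance isClosed_coe (M : VonNeumannAlgebra H) : IsClosed (M : Set (H →L[ℂ] H)) := by
  rw [← M.centralizer_centralizer]
  exact Set.isClosed_centralizer _

instance instCStarAlgebra (M : VonNeumannAlgebra H) : CStarAlgebra M :=
  StarSubalgebra.cstarAlgebra M

variable {M : VonNeumannAlgebra H}

lemma sqrt_mem {x : H →L[ℂ] H} (hx : x ∈ M) : CFC.sqrt x ∈ M := by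
  suffices h : CFC.sqrt x ∈ M.commutant.commutant by
    rwa [VonNeumannAlgebra.commutant_commutant] at h
  rw [VonNeumannAlgebra.mem_commutant_iff]
  intro z hz
  have h1 : Commute x z := VonNeumannAlgebra.mem_commutant_iff.1 hz _ hx
  exact (h1.cfcₙ_nnreal _).symm.eq

/-- The order is that of the bounded operators; the bicommutant theorem keeps square roots in `M`,
so the two notions of positivity agree. -/
instance instStarOrderedRing (M : VonNeumannAlgebra H) : StarOrderedRing M := by
  refine StarOrderedRing.of_nonneg_iff' (fun {x y} h z => ?_) fun x => ⟨fun h => ?_, ?_⟩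
  · exact add_le_add_right (α := H →L[ℂ] H) h z
  · have h' : (0 : H →L[ℂ] H) ≤ x := h
    refine ⟨⟨CFC.sqrt (x : H →L[ℂ] H), sqrt_mem x.2⟩, Subtype.ext ?_⟩
    change (x : H →L[ℂ] H) = star (CFC.sqrt (x : H →L[ℂ] H)) * CFC.sqrt (x : H →L[ℂ] H)
    rw [(CFC.sqrt_nonneg (x : H →L[ℂ] H)).isSelfAdjoint.star_eq, CFC.sqrt_mul_sqrt_self _ h']
  · rintro ⟨s, rfl⟩
    exact star_mul_self_nonneg (s : H →L[ℂ] H)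

/-- The inclusion of a von Neumann algebra in the bounded operators. -/
def inclusion (M : VonNeumannAlgebra H) : M →⋆ₐ[ℝ] (H →L[ℂ] H) where
  toFun x := x
  map_one' := rfl
  map_mul' _ _ := rfl
  map_zero' := rfl
  map_add' _ _ := rfl
  commutes' _ := rfl
  map_star' _ := rfl

lemma continuous_inclusion : Continuous (inclusion M) := continuous_subtype_val

lemma coe_powR {r : ℝ} (hr : 0 ≤ r) {a : M} (ha : 0 ≤ a) :
    ((powR r a : M) : H →L[ℂ] H) = (a : H →L[ℂ] H) ^ r := by
  have ha' : (0 : H →L[ℂ] H) ≤ a := ha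
  rw [CFC.rpow_eq_cfc_real (a := (a : H →L[ℂ] H)) ha']
  exact StarAlgHom.map_cfc (inclusion M) (fun t : ℝ => t ^ r) a
    (continuousOn_spectrum (continuousOn_rpow hr) ha) continuous_inclusion
    ha.isSelfAdjoint ha'.isSelfAdjoint

lemma absPow_eq {p : ℝ} (hp : 0 ≤ p) (x : M) : absPow x p = powR p (mabs x) := by
  apply Subtype.ext
  rw [coe_powR hp (mabs_nonneg x), mabs, coe_powR (by norm_num) (star_mul_self_nonneg x)]
  change CFC.abs (x : H →L[ℂ] H) ^ p = _
  rw [CFC.abs, CFC.sqrt_eq_rpow]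
  rfl

lemma star_I_smul_add_one_mul {A : Type*} [CStarAlgebra A] (x : A) :
    star (Complex.I • x + 1) * (Complex.I • x + 1)
      = star x * x - Complex.I • star x + Complex.I • x + 1 := by
  simp only [star_add, star_smul, star_one, add_mul, mul_add, one_mul, mul_one, smul_mul_assoc,
    mul_smul_comm, smul_smul, Complex.star_def, Complex.conj_I, neg_smul, Complex.I_mul_I, neg_neg,
    one_smul, smul_neg, neg_mul, smul_add]
  abel

/-- The trace is real on `y⋆ y`. For `y = i x + 1`, the imaginary part of the cross terms is `tr x -
tr (star x)`. -/
lemma FiniteTrace.tr_star (τ : FiniteTrace M) (x : M) : τ.tr (star x) = τ.tr x := by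
  have him : ∀ y : M, (τ.toLinearMap (star y * y)).im = 0 := fun y =>
    ((Complex.le_def.mp (τ.map_star_mul_self_nonneg y)).2).symm
  have h := him (Complex.I • x + 1)
  have e : star (Complex.I • x + 1) * (Complex.I • x + 1)
      = star x * x - Complex.I • star x + Complex.I • x + 1 :=
    star_I_smul_add_one_mul x
  rw [e, map_add, map_add, map_sub, map_smul, map_smul, τ.map_one] at h
  simp only [smul_eq_mul, Complex.add_im, Complex.sub_im, Complex.mul_im, Complex.I_re,
    Complex.I_im, him, Complex.one_im] at h
  simp only [FiniteTrace.tr]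
  linarith

/-- The tracial state given by a finite trace. -/
def FiniteTrace.state (τ : FiniteTrace M) : TracialState M where
  tr :=
    { toFun := τ.tr
      map_add' := τ.tr_add
      map_smul' := fun r x => by
        have : (r • x : M) = (r : ℂ) • x := rfl
        simp only [FiniteTrace.tr]
        rw [this, map_smul, smul_eq_mul, Complex.re_ofReal_mul]
        rfl }
  tr_comm := τ.tr_comm
  tr_star_mul_self := τ.tr_nonneg
  tr_star := τ.tr_star
  tr_one := by
    change (τ.toLinearMap 1).re = 1
    rw [τ.map_one, Complex.one_re]

variable (τ : FiniteTrace M)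

lemma pNorm_eq {p : ℝ} (hp : 1 ≤ p) (x : M) : pNorm τ p x = τ.state.pn p x := by
  rw [pNorm, absPow_eq (by linarith)]
  rfl

/-! ### Convergence in measure -/

/-- Neighbourhoods in measure are stable under the involution. -/
lemma star_mem_measureNhd {ε δ : ℝ} {x : M} (hx : x ∈ measureNhd τ ε δ) :
    star x ∈ measureNhd τ ε δ := by
  obtain ⟨e, he, h1, h2⟩ := hx
  -- The right support of `e x⋆` has trace at most that of `e`. Off `q` the operator `x⋆` agrees
  -- with `(1 - e) x⋆`, the adjoint of the small operator `x (1 - e)`.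
  obtain ⟨q, hq, h3, -, h4⟩ := τ.exists_support (e * star x)
  refine ⟨q, hq, (h4 e he (by rw [← mul_assoc, he.isIdempotentElem.eq])).trans_lt h1, ?_⟩
  have h5 : star x * (1 - q) = ((1 - e) * star x) * (1 - q) := by
    have : e * star x * (1 - q) = 0 := by rw [mul_sub, mul_one, h3, sub_self]
    rw [sub_mul, one_mul, sub_mul, this, sub_zero]
  rw [h5]
  refine (norm_one_sub_proj_le hq _).trans_lt ?_
  have h6 : star (x * (1 - e)) = (1 - e) * star x := by
    rw [star_mul, he.one_sub.isSelfAdjoint.star_eq]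
  rwa [← h6, norm_star]

lemma conj_mem_measureNhd {ε δ C D : ℝ} (hδ : 0 < δ) {a x b : M} (ha : ‖a‖ ≤ C) (hb : ‖b‖ ≤ D)
    (hx : x ∈ measureNhd τ ε δ) :
    a * x * b ∈ measureNhd τ ((C + 1) * ε * (D + 1)) (3 * δ) := by
  have h1 := mem_measureNhd_of_norm_lt τ hδ (ha.trans_lt (lt_add_one C))
  have h2 := mem_measureNhd_of_norm_lt τ hδ (hb.trans_lt (lt_add_one D))
  exact measureNhd_mono τ le_rfl (by linarith)
    (mul_mem_measureNhd τ (mul_mem_measureNhd τ h1 hx) h2)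

/-- A bounded element which is small in measure has a small `p`-norm. -/
lemma pn_le_of_mem_measureNhd {p : ℝ} (hp : 1 ≤ p) {ε δ C : ℝ} {x : M} (hC : ‖x‖ ≤ C)
    (hx : x ∈ measureNhd τ ε δ) : τ.state.pn p x ≤ ε + C * δ ^ (1 / p) := by
  obtain ⟨e, he, h1, h2⟩ := hx
  -- The first term is small in operator norm; the second is small because the projection `e` has
  -- small `p`-norm. The factor `1` puts it in the two-sided form of `pn_conj_le`.
  have h3 : x = x * (1 - e) + x * e * 1 := by noncomm_ring
  have hn : ‖(1 : M)‖ ≤ 1 := norm_one_le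
  have hp0 := τ.state.pn_nonneg p e
  have h4 : τ.state.pn p (x * e * 1) ≤ C * δ ^ (1 / p) := by
    refine (τ.state.pn_conj_le hp x e 1).trans ?_
    have h5 : τ.state.pn p e ≤ δ ^ (1 / p) := (τ.state.pn_proj_le hp he).trans
      (Real.rpow_le_rpow (τ.tr_proj_nonneg he) h1.le (by positivity))
    have hC0 : 0 ≤ C := (norm_nonneg _).trans hC
    have hδ0 : 0 ≤ δ ^ (1 / p) := hp0.trans h5
    calc ‖x‖ * τ.state.pn p e * ‖(1 : M)‖ ≤ C * δ ^ (1 / p) * 1 := by gcongr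
      _ = _ := mul_one _
  calc τ.state.pn p x ≤ τ.state.pn p (x * (1 - e)) + τ.state.pn p (x * e * 1) := by
        conv_lhs => rw [h3]
        exact τ.state.pn_add_le hp _ _
    _ ≤ _ := add_le_add ((τ.state.pn_le_norm hp _).trans h2.le) h4

/-! ### Smooth truncation -/

section Truncation

variable {A : Type*} [CStarAlgebra A] [PartialOrder A] [StarOrderedRing A]

lemma continuousOn_inv_one_add {d : ℝ} (hd : 0 ≤ d) :
    ContinuousOn (fun t : ℝ => (1 + d * t)⁻¹) (Set.Ici 0) :=
  ContinuousOn.inv₀ (by fun_prop) fun t ht => by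
    have : 0 ≤ d * t := mul_nonneg hd ht
    positivity

/-- The bounded truncation `x (1 + d x⋆ x)⁻¹` of `x`. -/
def truncation (d : ℝ) (x : A) : A := x * cfc (fun t => (1 + d * t)⁻¹) (star x * x)

lemma inv_one_add_mem {d t : ℝ} (hd : 0 ≤ d) (ht : 0 ≤ t) :
    0 ≤ (1 + d * t)⁻¹ ∧ (1 + d * t)⁻¹ ≤ 1 := by
  have : 0 ≤ d * t := mul_nonneg hd ht
  exact ⟨by positivity, inv_le_one_of_one_le₀ (by linarith)⟩

lemma norm_cfc_inv_one_add_le {d : ℝ} (hd : 0 ≤ d) {b : A} (hb : 0 ≤ b) :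
    ‖cfc (fun t => (1 + d * t)⁻¹) b‖ ≤ 1 :=
  norm_cfc_le zero_le_one fun t ht => by
    have := inv_one_add_mem hd (spectrum_subset_Ici hb ht)
    rw [Real.norm_of_nonneg this.1]
    exact this.2

lemma norm_sqrt_smul_truncation_le {d : ℝ} (hd : 0 < d) (x : A) : ‖√d • truncation d x‖ ≤ 1 := by
  have hs : ‖√d‖ = √d := Real.norm_of_nonneg (Real.sqrt_nonneg d)
  have hd' : 0 < √d := Real.sqrt_pos.2 hd
  have h : ‖truncation d x‖ ≤ (√d)⁻¹ := by
    refine norm_mul_cfc_le x (continuousOn_inv_one_add hd.le) (by positivity) fun t ht => ?_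
    have hdt : 0 ≤ d * t := mul_nonneg hd.le ht
    rw [inv_pow, inv_pow, Real.sq_sqrt hd.le, ← div_eq_mul_inv, div_le_iff₀ (by positivity),
      inv_mul_eq_div, le_div_iff₀ hd]
    nlinarith
  rw [norm_smul, hs]
  calc √d * ‖truncation d x‖ ≤ √d * (√d)⁻¹ := by gcongr
    _ = 1 := mul_inv_cancel₀ hd'.ne'

lemma one_add_mul_cfc_inv {d : ℝ} (hd : 0 ≤ d) {b : A} (hb : 0 ≤ b) :
    (1 + d • b) * cfc (fun t => (1 + d * t)⁻¹) b = 1 ∧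
      cfc (fun t => (1 + d * t)⁻¹) b * (1 + d • b) = 1 := by
  have h1 : (1 + d • b) = cfc (fun t => 1 + d * t) b := by
    rw [cfc_const_add _ _ b (by fun_prop), cfc_const_mul_id d b, map_one]
  have hc : ContinuousOn (fun t : ℝ => 1 + d * t) (Set.Ici 0) := by fun_prop
  have h2 : cfc (fun _ => (1 : ℝ)) b = 1 := cfc_const_one ℝ b
  rw [h1, cfc_mul_Ici hc (continuousOn_inv_one_add hd) hb,
    cfc_mul_Ici (continuousOn_inv_one_add hd) hc hb, ← h2]
  constructor
  · refine cfc_congr_Ici (fun t ht => mul_inv_cancel₀ ?_) hb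
    have : 0 ≤ d * t := mul_nonneg hd ht
    positivity
  · refine cfc_congr_Ici (fun t ht => inv_mul_cancel₀ ?_) hb
    have : 0 ≤ d * t := mul_nonneg hd ht
    positivity

/-- A resolvent identity. The difference `x - y` and its adjoint appear only between contractions,
so truncation is uniformly continuous in measure on all of `M`, with a modulus independent of `d`.
-/
lemma truncation_sub {d : ℝ} (hd : 0 ≤ d) (x y : A) :
    truncation d x - truncation d y =
      cfc (fun t => (1 + d * t)⁻¹) (x * star x) * (x - y) * cfc (fun t => (1 + d * t)⁻¹)
        (star y * y) - (√d • truncation d x) * star (x - y) * (√d • truncation d y) := by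
  have hx : truncation d x = cfc (fun t => (1 + d * t)⁻¹) (x * star x) * x :=
    mul_cfc_star_mul_self x (continuousOn_inv_one_add hd)
  have h1 := (one_add_mul_cfc_inv hd (mul_star_self_nonneg x)).2
  have h2 := (one_add_mul_cfc_inv hd (star_mul_self_nonneg y)).1
  rw [smul_mul_assoc, mul_smul_comm, smul_mul_assoc, smul_smul, Real.mul_self_sqrt hd, hx]
  unfold truncation
  set c := cfc (fun t => (1 + d * t)⁻¹) (x * star x)
  set b := cfc (fun t => (1 + d * t)⁻¹) (star y * y)
  have e1 : c * x = c * x * ((1 + d • (star y * y)) * b) := by rw [h2, mul_one]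
  have e2 : y * b = (c * (1 + d • (x * star x))) * (y * b) := by rw [h1, one_mul]
  conv_lhs => rw [e1, e2]
  rw [star_sub]
  simp only [mul_add, add_mul, mul_sub, sub_mul, mul_one, one_mul, smul_mul_assoc, mul_smul_comm,
    smul_sub, mul_assoc]
  abel

lemma norm_truncation_sub_self_le {d : ℝ} (hd : 0 ≤ d) (x : A) :
    ‖truncation d x - x‖ ≤ ‖x‖ * (d * ‖star x * x‖) := by
  have hb := star_mul_self_nonneg x
  have e : truncation d x - x = x * cfc (fun t => (1 + d * t)⁻¹ - 1) (star x * x) := by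
    rw [cfc_sub _ _ _ (continuousOn_spectrum (continuousOn_inv_one_add hd) hb)
      continuousOn_const, cfc_const_one ℝ (star x * x), mul_sub, mul_one]
    rfl
  rw [e]
  refine (norm_mul_le _ _).trans (mul_le_mul_of_nonneg_left ?_ (norm_nonneg _))
  refine norm_cfc_le (by positivity) fun t ht => ?_
  have h := spectrum_subset_Icc hb le_rfl ht
  have hdt : 0 ≤ d * t := mul_nonneg hd h.1
  have h2 := inv_one_add_mem hd h.1
  have h3 : d * t ≤ d * ‖star x * x‖ := mul_le_mul_of_nonneg_left h.2 hd
  rw [Real.norm_eq_abs, abs_of_nonpos (by linarith)]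
  have h4 : 1 - (1 + d * t)⁻¹ ≤ d * t := by
    have h5 : (1 + d * t)⁻¹ * (1 + d * t) = 1 := inv_mul_cancel₀ (by positivity)
    nlinarith
  linarith

end Truncation

lemma truncation_sub_mem_measureNhd {ε δ : ℝ} (hδ : 0 < δ) {d : ℝ} (hd : 0 < d) {x y : M}
    (h : x - y ∈ measureNhd τ ε δ) :
    truncation d x - truncation d y ∈ measureNhd τ (8 * ε) (6 * δ) := by
  rw [truncation_sub hd.le, sub_eq_add_neg]
  have h1 := conj_mem_measureNhd τ hδ (norm_cfc_inv_one_add_le hd.le (mul_star_self_nonneg x))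
    (norm_cfc_inv_one_add_le hd.le (star_mul_self_nonneg y)) h
  have h2 := conj_mem_measureNhd τ hδ (norm_sqrt_smul_truncation_le hd x)
    (norm_sqrt_smul_truncation_le hd y) (star_mem_measureNhd τ h)
  -- Each of the two sandwiched terms costs `(1+1) ε (1+1) = 4 ε` and `3 δ`.
  exact measureNhd_mono τ (by linarith) (by linarith)
    (add_mem_measureNhd τ h1 (neg_mem_measureNhd τ h2))

end

section

variable {H : Type u} [NormedAddCommGroup H] [InnerProductSpace ℂ H] [CompleteSpace H]
variable {M : VonNeumannAlgebra H} (τ : FiniteTrace M)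

/-! ### The topology of `L₀` -/

lemma hasBasis_nhds_zero_measureAlg :
    (𝓝 (0 : MeasureAlg τ)).HasBasis (fun ε : ℝ => 0 < ε) (fun ε => measureNhd τ ε ε) := by
  refine ((measureBasis τ).toAddGroupFilterBasis.nhds_zero_hasBasis).to_hasBasis ?_ ?_
  · rintro _ ⟨ε, hε, δ, hδ, rfl⟩
    exact ⟨min ε δ, lt_min hε hδ, measureNhd_mono τ (min_le_left _ _) (min_le_right _ _)⟩
  · intro ε hε
    exact ⟨_, ⟨ε, hε, ε, hε, rfl⟩, subset_rfl⟩

lemma tendsto_toL0_zero {ι : Type*} {l : Filter ι} {x : ι → M} :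
    Tendsto (fun i => toL0 τ (x i)) l (𝓝 0) ↔ ∀ ε : ℝ, 0 < ε → ∀ᶠ i in l, x i ∈ measureNhd τ ε ε := by
  let x' : ι → MeasureAlg τ := x
  have h := (UniformSpace.Completion.isUniformInducing_coe (MeasureAlg τ)).isInducing.tendsto_nhds_iff
    (f := x') (l := l) (y := (0 : MeasureAlg τ))
  exact h.symm.trans (hasBasis_nhds_zero_measureAlg τ).tendsto_right_iff

lemma tendsto_toL0 {ι : Type*} {l : Filter ι} {x : ι → M} {y : M} :
    Tendsto (fun i => toL0 τ (x i)) l (𝓝 (toL0 τ y)) ↔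
      ∀ ε : ℝ, 0 < ε → ∀ᶠ i in l, x i - y ∈ measureNhd τ ε ε := by
  rw [← tendsto_toL0_zero, ← tendsto_sub_nhds_zero_iff]
  simp only [map_sub]

lemma cauchySeq_toL0 {x : ℕ → M} : CauchySeq (fun i => toL0 τ (x i)) ↔
    ∀ ε : ℝ, 0 < ε → ∃ N, ∀ m ≥ N, ∀ n ≥ N, x m - x n ∈ measureNhd τ ε ε := by
  have h1 : CauchySeq (fun i => toL0 τ (x i)) ↔
      Tendsto (fun p : ℕ × ℕ => toL0 τ (x p.2 - x p.1)) atTop (𝓝 0) := by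
    rw [cauchySeq_iff_tendsto, uniformity_eq_comap_nhds_zero, tendsto_comap_iff]
    simp only [map_sub]
    rfl
  rw [h1, tendsto_toL0_zero]
  refine forall₂_congr fun ε hε => ?_
  rw [← prod_atTop_atTop_eq, (atTop_basis.prod_self).eventually_iff]
  constructor
  · rintro ⟨N, -, hN⟩
    exact ⟨N, fun m hm n hn => hN (x := (n, m)) ⟨hn, hm⟩⟩
  · rintro ⟨N, hN⟩
    exact ⟨N, trivial, fun {p} hp => hN p.2 hp.2 p.1 hp.1⟩

/-- Radii `1 / (n + 1)` suffice. Consequently closures in `L0 τ` are described by sequences. -/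
instance : (𝓝 (0 : L0 τ)).IsCountablyGenerated := by
  have h1 := (hasBasis_nhds_zero_measureAlg τ).hasBasis_of_isDenseInducing
    (UniformSpace.Completion.isDenseInducing_coe (α := MeasureAlg τ))
  have h2 : (𝓝 (0 : L0 τ)).HasBasis (fun _ : ℕ => True)
      (fun n => closure ((fun x : MeasureAlg τ => (x : L0 τ)) ''
        measureNhd τ (1 / ((n : ℝ) + 1)) (1 / ((n : ℝ) + 1)))) := by
    refine h1.to_hasBasis (fun ε hε => ?_) fun n _ => ⟨_, Nat.one_div_pos_of_nat, subset_rfl⟩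
    obtain ⟨n, hn⟩ := exists_nat_one_div_lt hε
    exact ⟨n, trivial, closure_mono (Set.image_mono (measureNhd_mono τ hn.le hn.le))⟩
  exact h2.isCountablyGenerated

instance : (uniformity (L0 τ)).IsCountablyGenerated :=
  IsUniformAddGroup.uniformity_countably_generated

lemma exists_seq_toL0 {S : Set M} {g : L0 τ} (hg : g ∈ closure (toL0 τ '' S)) :
    ∃ x : ℕ → M, (∀ k, x k ∈ S) ∧ Tendsto (fun k => toL0 τ (x k)) atTop (𝓝 g) := by
  obtain ⟨y, hy, hlim⟩ := mem_closure_iff_seq_limit.1 hg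
  choose x hx hxy using hy
  exact ⟨x, hx, by simpa only [hxy] using hlim⟩

/-! ### Suprema of projections and strong limits -/

lemma mem_of_strong_limit {x : ℕ → M} {T : H →L[ℂ] H}
    (h : ∀ v, Tendsto (fun k => (x k : H →L[ℂ] H) v) atTop (𝓝 (T v))) : T ∈ M := by
  rw [← VonNeumannAlgebra.commutant_commutant M, VonNeumannAlgebra.mem_commutant_iff]
  intro z hz
  ext v
  have h1 : Tendsto (fun k => z ((x k : H →L[ℂ] H) v)) atTop (𝓝 (z (T v))) :=
    (z.continuous.tendsto _).comp (h v)
  refine tendsto_nhds_unique h1 ((h (z v)).congr fun k => ?_)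
  exact (congrArg (fun S : H →L[ℂ] H => S v)
    (VonNeumannAlgebra.mem_commutant_iff.1 hz _ (x k).2) : _)

lemma isStarProjection_coe {e : M} (he : IsStarProjection e) :
    IsStarProjection (e : H →L[ℂ] H) :=
  ⟨congrArg Subtype.val he.isIdempotentElem.eq, congrArg Subtype.val he.isSelfAdjoint.star_eq⟩

lemma isStarProjection_of_coe {e : M} (he : IsStarProjection (e : H →L[ℂ] H)) :
    IsStarProjection e :=
  ⟨Subtype.ext he.isIdempotentElem.eq, Subtype.ext he.isSelfAdjoint.star_eq⟩

/-- Countable subadditivity of the trace on projections. -/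
lemma FiniteTrace.exists_countable_sup {e : ℕ → M} (he : ∀ k, IsStarProjection (e k)) {C : ℝ}
    (hC : ∀ n, ∑ k ∈ Finset.range n, τ.tr (e k) ≤ C) :
    ∃ E : M, IsStarProjection E ∧ (∀ k, e k * (1 - E) = 0) ∧ τ.tr E ≤ C := by
  let S := {e : M // IsStarProjection e}
  have hsup : ∀ g f : S, ∃ h : S, g.1 * (1 - h.1) = 0 ∧ f.1 * (1 - h.1) = 0 ∧
      τ.tr h.1 ≤ τ.tr g.1 + τ.tr f.1 := fun g f => by
    obtain ⟨h, h1, h2⟩ := τ.exists_sup g.2 f.2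
    exact ⟨⟨h, h1⟩, h2⟩
  choose sup hsup1 hsup2 hsup3 using hsup
  -- Successive upper bounds of `e 0, …, e (n-1)`. They increase, so they converge strongly to the
  -- projection onto the closed span of their ranges; normality passes the trace bound to the limit.
  let G : ℕ → S := fun n => Nat.rec ⟨0, .zero _⟩ (fun n g => sup g ⟨e n, he n⟩) n
  have hGs : ∀ n, G (n + 1) = sup (G n) ⟨e n, he n⟩ := fun n => rfl
  have htr : ∀ n, τ.tr (G n).1 ≤ ∑ k ∈ Finset.range n, τ.tr (e k) := by
    intro n
    induction n with
    | zero => simp [G, FiniteTrace.tr]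
    | succ n ih =>
      rw [hGs, Finset.sum_range_succ]
      exact (hsup3 _ _).trans (by linarith)
  have hstep : ∀ (y : M) n, y * (1 - (G n).1) = 0 → y * (1 - (G (n + 1)).1) = 0 := by
    intro y n h
    have h1 : y = y * (G n).1 := by rwa [mul_sub, mul_one, sub_eq_zero] at h
    rw [h1, mul_assoc, hGs, hsup1, mul_zero]
  have hle : ∀ (y : M) m n, m ≤ n → y * (1 - (G m).1) = 0 → y * (1 - (G n).1) = 0 := by
    intro y m n hmn h
    induction n, hmn using Nat.le_induction with
    | base => exact h
    | succ n _ ih => exact hstep y n ih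
  have hself : ∀ n, (G n).1 * (1 - (G n).1) = 0 := fun n => by
    rw [mul_sub, mul_one, (G n).2.isIdempotentElem.eq, sub_self]
  have hek : ∀ k n, k < n → e k * (1 - (G n).1) = 0 := fun k n hkn =>
    hle _ (k + 1) n hkn (by rw [hGs]; exact hsup2 (G k) ⟨e k, he k⟩)
  let U : ℕ → Submodule ℂ H := fun n => ((G n).1 : H →L[ℂ] H).range
  have hGp : ∀ n, IsStarProjection ((G n).1 : H →L[ℂ] H) := fun n => isStarProjection_coe (G n).2
  have hUc : ∀ n, (U n).HasOrthogonalProjection := fun n =>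
    (isStarProjection_iff_eq_starProjection_range.1 (hGp n)).choose
  have hGU : ∀ n, ((G n).1 : H →L[ℂ] H) = (U n).starProjection := fun n =>
    (isStarProjection_iff_eq_starProjection_range.1 (hGp n)).choose_spec
  have hmono : Monotone U := by
    refine monotone_nat_of_le_succ fun n => ?_
    rintro _ ⟨v, rfl⟩
    have h1 := hstep _ n (hself n)
    have h2 : (1 - (G (n + 1)).1) * (G n).1 = 0 := by
      have := congrArg star h1
      rwa [star_mul, star_zero, (G (n + 1)).2.one_sub.isSelfAdjoint.star_eq,
        (G n).2.isSelfAdjoint.star_eq] at this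
    rw [sub_mul, one_mul, sub_eq_zero] at h2
    refine ⟨((G n).1 : H →L[ℂ] H) v, ?_⟩
    exact (congrArg (fun S : M => (S : H →L[ℂ] H) v) h2).symm
  have : CompleteSpace (⨆ n, U n).topologicalClosure :=
    (Submodule.isClosed_topologicalClosure _).completeSpace_coe
  have hlim : ∀ v, Tendsto (fun n => ((G n).1 : H →L[ℂ] H) v) atTop
      (𝓝 ((⨆ n, U n).topologicalClosure.starProjection v)) := by
    intro v
    simp only [hGU]
    exact Submodule.starProjection_tendsto_closure_iSup U hmono v
  have hE := mem_of_strong_limit hlim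
  refine ⟨⟨_, hE⟩, isStarProjection_of_coe isStarProjection_starProjection, fun k => ?_, ?_⟩
  · apply Subtype.ext
    ext v
    have h1 : Tendsto (fun n => (e k : H →L[ℂ] H) (v - ((G n).1 : H →L[ℂ] H) v)) atTop
        (𝓝 ((e k : H →L[ℂ] H) (v - (⨆ n, U n).topologicalClosure.starProjection v))) :=
      ((e k : H →L[ℂ] H).continuous.tendsto _).comp (tendsto_const_nhds.sub (hlim v))
    refine tendsto_nhds_unique h1 (tendsto_const_nhds.congr' ?_)
    filter_upwards [eventually_gt_atTop k] with n hn
    exact (congrArg (fun S : M => (S : H →L[ℂ] H) v) (hek k n hn)).symm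
  · refine le_of_tendsto' (τ.tendsto_tr (x := fun n => (G n).1) (C := 1)
      (fun n => (hGp n).norm_le) hlim) fun n => (htr n).trans (hC n)

lemma FiniteTrace.eq_zero_of_tr_nonpos {q : M} (hq : IsStarProjection q) (h : τ.tr q ≤ 0) :
    q = 0 := by
  have h1 : star q * q = q := by rw [hq.isSelfAdjoint.star_eq, hq.isIdempotentElem.eq]
  refine τ.faithful q (Complex.ext ?_ ?_)
  · rw [h1]
    exact le_antisymm h (τ.tr_proj_nonneg hq)
  · exact ((Complex.le_def.mp (τ.map_star_mul_self_nonneg q)).2).symm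

end

section

variable {H : Type u} [NormedAddCommGroup H] [InnerProductSpace ℂ H] [CompleteSpace H]
variable {M : VonNeumannAlgebra H} (τ : FiniteTrace M)

/-! ### Completeness of balls of `M` for convergence in measure -/

lemma proj_mul_of_mul_one_sub {e E : M} (h : e * (1 - E) = 0) (y : M) :
    y * (1 - e) * (1 - E) = y * (1 - E) := by
  rw [mul_assoc, mul_one_sub_of_mul_one_sub_eq_zero h]

lemma proj_mem {K : Submodule ℂ H} [K.HasOrthogonalProjection]
    (h : ∀ z ∈ M.commutant, ∀ v ∈ K, z v ∈ K) : K.starProjection ∈ M := by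
  rw [VonNeumannAlgebra.IsStarProjection.mem_iff isStarProjection_starProjection]
  intro y hy v hv
  rw [Submodule.range_starProjection] at hv ⊢
  exact h y hy v hv

/-- The vectors on which a bounded sequence of operators converges. -/
def cauchySubmodule (y : ℕ → M) : Submodule ℂ H where
  carrier := {v | CauchySeq fun k => (y k : H →L[ℂ] H) v}
  add_mem' {a b} ha hb := by
    simp only [Set.mem_ofPred_eq, map_add] at *
    exact ha.add hb
  zero_mem' := by simpa using cauchySeq_const (0 : H)
  smul_mem' c v hv := by
    simp only [Set.mem_ofPred_eq, map_smul] at *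
    exact hv.map (uniformContinuous_const_smul c)

lemma mem_cauchySubmodule {y : ℕ → M} {v : H} :
    v ∈ cauchySubmodule y ↔ CauchySeq fun k => (y k : H →L[ℂ] H) v := Iff.rfl

lemma isClosed_cauchySubmodule {y : ℕ → M} {C : ℝ} (hC : ∀ k, ‖y k‖ ≤ C) :
    IsClosed (cauchySubmodule y : Set H) := by
  have hC0 : 0 ≤ C := (norm_nonneg _).trans (hC 0)
  have hle : ∀ k w, ‖(y k : H →L[ℂ] H) w‖ ≤ C * ‖w‖ := fun k w =>
    ContinuousLinearMap.le_of_opNorm_le _ (hC k) w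
  refine isClosed_of_closure_subset fun v hv => ?_
  rw [SetLike.mem_coe, mem_cauchySubmodule, Metric.cauchySeq_iff]
  intro ε hε
  obtain ⟨w, hw, hvw⟩ := Metric.mem_closure_iff.1 hv (ε / (4 * (C + 1))) (by positivity)
  rw [SetLike.mem_coe, mem_cauchySubmodule, Metric.cauchySeq_iff] at hw
  obtain ⟨N, hN⟩ := hw (ε / 2) (half_pos hε)
  refine ⟨N, fun m hm n hn => ?_⟩
  have h1 := hN m hm n hn
  rw [dist_eq_norm] at *
  have h2 : ∀ k, ‖(y k : H →L[ℂ] H) v - (y k : H →L[ℂ] H) w‖ ≤ ε / 4 := fun k => by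
    rw [← map_sub]
    refine (hle k _).trans ?_
    calc C * ‖v - w‖ ≤ (C + 1) * (ε / (4 * (C + 1))) := by gcongr; linarith
      _ = ε / 4 := by field_simp
  calc _ = ‖((y m : H →L[ℂ] H) v - (y m : H →L[ℂ] H) w)
        + ((y m : H →L[ℂ] H) w - (y n : H →L[ℂ] H) w)
        - ((y n : H →L[ℂ] H) v - (y n : H →L[ℂ] H) w)‖ := by congr 1; abel
    _ ≤ ‖(y m : H →L[ℂ] H) v - (y m : H →L[ℂ] H) w‖
        + ‖(y m : H →L[ℂ] H) w - (y n : H →L[ℂ] H) w‖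
        + ‖(y n : H →L[ℂ] H) v - (y n : H →L[ℂ] H) w‖ :=
      (norm_sub_le _ _).trans (add_le_add_left (norm_add_le _ _) _)
    _ < ε := by linarith [h2 m, h2 n]

/-- A bounded sequence in `M` which converges in `L₀` has its limit in `M`. -/
lemma exists_toL0_eq_of_tendsto {x : ℕ → M} {C : ℝ} (hC : ∀ k, ‖x k‖ ≤ C) {g : L0 τ}
    (hx : Tendsto (fun k => toL0 τ (x k)) atTop (𝓝 g)) :
    ∃ y : M, toL0 τ y = g ∧ ‖y‖ ≤ C := by
  have hC0 : 0 ≤ C := (norm_nonneg _).trans (hC 0)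
  -- A subsequence whose consecutive differences have norm below `2⁻ʲ` off a projection of trace
  -- below `2⁻ʲ`.
  have hcau := (cauchySeq_toL0 τ).1 hx.cauchySeq
  obtain ⟨φ, hφ, hφ2⟩ := extraction_forall_of_eventually
    (P := fun j k => ∀ m ≥ k, ∀ n ≥ k,
      x m - x n ∈ measureNhd τ ((1 / 2 : ℝ) ^ j) ((1 / 2 : ℝ) ^ j)) (fun j => by
      obtain ⟨N, hN⟩ := hcau ((1 / 2 : ℝ) ^ j) (by positivity)
      filter_upwards [eventually_ge_atTop N] with k hk m hm n hn
      exact hN m (hk.trans hm) n (hk.trans hn))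
  set y : ℕ → M := fun j => x (φ j) with hy
  have hyC : ∀ k, ‖y k‖ ≤ C := fun k => hC _
  have hylim : Tendsto (fun k => toL0 τ (y k)) atTop (𝓝 g) := hx.comp hφ.tendsto_atTop
  have hstep : ∀ j, ∃ e : M, IsStarProjection e ∧ τ.tr e < (1 / 2 : ℝ) ^ j ∧
      ‖(y (j + 1) - y j) * (1 - e)‖ < (1 / 2 : ℝ) ^ j := fun j =>
    hφ2 j _ (hφ.monotone (Nat.le_succ j)) _ le_rfl
  choose e he hetr heny using hstep
  -- Off `E N`, which dominates all exceptional projections from index `N` on, the subsequence is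
  -- uniformly Cauchy.
  have hE : ∀ N : ℕ, ∃ E : M, IsStarProjection E ∧ (∀ k, e (N + k) * (1 - E) = 0) ∧
      τ.tr E ≤ 2 * (1 / 2 : ℝ) ^ N := by
    intro N
    refine τ.exists_countable_sup (fun k => he (N + k)) fun n => ?_
    calc ∑ k ∈ Finset.range n, τ.tr (e (N + k))
        ≤ ∑ k ∈ Finset.range n, (1 / 2 : ℝ) ^ N * (1 / 2 : ℝ) ^ k :=
          Finset.sum_le_sum fun k _ => by rw [← pow_add]; exact (hetr _).le
      _ = (1 / 2 : ℝ) ^ N * ∑ k ∈ Finset.range n, (1 / 2 : ℝ) ^ k := by rw [Finset.mul_sum]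
      _ ≤ (1 / 2 : ℝ) ^ N * 2 := by
          gcongr
          exact sum_geometric_two_le n
      _ = _ := mul_comm _ _
  choose E hEp hEe hEtr using hE
  have hunif : ∀ N i j, N ≤ j → j ≤ i → ‖(y i - y j) * (1 - E N)‖
      ≤ 2 * (1 / 2 : ℝ) ^ j - 2 * (1 / 2 : ℝ) ^ i := by
    intro N i j hNj hji
    induction i, hji using Nat.le_induction with
    | base => simp
    | succ i hji ih =>
      have h1 : (y (i + 1) - y j) * (1 - E N)
          = (y (i + 1) - y i) * (1 - E N) + (y i - y j) * (1 - E N) := by noncomm_ring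
      have h2 : ‖(y (i + 1) - y i) * (1 - E N)‖ ≤ (1 / 2 : ℝ) ^ i := by
        obtain ⟨k, rfl⟩ := Nat.exists_eq_add_of_le (hNj.trans hji)
        rw [← proj_mul_of_mul_one_sub (hEe N k)]
        exact (norm_one_sub_proj_le (hEp N) _).trans (heny _).le
      rw [h1]
      refine (norm_add_le _ _).trans ((add_le_add h2 ih).trans (le_of_eq ?_))
      rw [pow_succ]; ring
  have hsmall : ∀ N i j, N ≤ i → N ≤ j → ‖(y i - y j) * (1 - E N)‖ ≤ 2 * (1 / 2 : ℝ) ^ min i j := by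
    intro N i j hi hj
    rcases le_total j i with h | h
    · rw [min_eq_right h]
      refine (hunif N i j hj h).trans ?_
      have : (0 : ℝ) ≤ 2 * (1 / 2) ^ i := by positivity
      linarith
    · rw [min_eq_left h, ← neg_sub, neg_mul, norm_neg]
      refine (hunif N j i hi h).trans ?_
      have : (0 : ℝ) ≤ 2 * (1 / 2) ^ j := by positivity
      linarith
  set K := cauchySubmodule y with hK
  have hKE : ∀ N v, ((1 - E N : M) : H →L[ℂ] H) v ∈ K := by
    intro N v
    rw [mem_cauchySubmodule, Metric.cauchySeq_iff]
    intro ε hε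
    have hlim : Tendsto (fun n : ℕ => 2 * (1 / 2 : ℝ) ^ n * ‖v‖) atTop (𝓝 (2 * 0 * ‖v‖)) :=
      ((tendsto_pow_atTop_nhds_zero_of_lt_one (by norm_num) (by norm_num)).const_mul 2).mul_const _
    rw [mul_zero, zero_mul] at hlim
    obtain ⟨n0, hn0⟩ := eventually_atTop.1 (hlim.eventually_lt_const hε)
    refine ⟨max N n0, fun i hi j hj => ?_⟩
    rw [dist_eq_norm]
    have h1 : (y i : H →L[ℂ] H) (((1 - E N : M) : H →L[ℂ] H) v)
        - (y j : H →L[ℂ] H) (((1 - E N : M) : H →L[ℂ] H) v)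
        = (((y i - y j) * (1 - E N) : M) : H →L[ℂ] H) v := rfl
    rw [h1]
    refine (ContinuousLinearMap.le_of_opNorm_le _ (hsmall N i j ((le_max_left _ _).trans hi)
      ((le_max_left _ _).trans hj)) v).trans_lt (hn0 _ ?_)
    exact (le_max_right _ _).trans (le_min hi hj)
  have hKcl : IsClosed (K : Set H) := isClosed_cauchySubmodule hyC
  have : CompleteSpace K := hKcl.completeSpace_coe
  have hPM : K.starProjection ∈ M := by
    refine proj_mem fun z hz v hv => ?_
    rw [mem_cauchySubmodule] at hv ⊢
    have h1 : (fun k => (y k : H →L[ℂ] H) (z v)) = fun k => z ((y k : H →L[ℂ] H) v) := by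
      funext k
      exact (congrArg (fun S : H →L[ℂ] H => S v)
        (VonNeumannAlgebra.mem_commutant_iff.1 hz _ (y k).2) : _)
    rw [h1]
    exact hv.map z.uniformContinuous
  let P : M := ⟨K.starProjection, hPM⟩
  have hP : IsStarProjection P := isStarProjection_of_coe isStarProjection_starProjection
  -- The projection `1 - P` onto the complement of the convergence space lies below every `E N`, so
  -- its trace vanishes and faithfulness applies. Hence the subsequence converges strongly
  -- everywhere.
  have hQ : 1 - P = 0 := by
    refine τ.eq_zero_of_tr_nonpos hP.one_sub ?_
    have hle : ∀ N, τ.tr (1 - P) ≤ 2 * (1 / 2 : ℝ) ^ N := by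
      intro N
      have h1 : P * (1 - E N) = 1 - E N := by
        apply Subtype.ext
        ext v
        exact Submodule.starProjection_eq_self_iff.2 (hKE N v)
      have h2 : (1 - P) * E N = 1 - P := by
        have : (1 - P) * E N = 1 - P - ((1 - E N) - P * (1 - E N)) := by noncomm_ring
        rw [this, h1, sub_self, sub_zero]
      have h3 : E N * (1 - P) = 1 - P := by
        have := congrArg star h2
        rwa [star_mul, hP.one_sub.isSelfAdjoint.star_eq, (hEp N).isSelfAdjoint.star_eq] at this
      have h4 : IsStarProjection (E N - (1 - P)) := by
        refine ⟨?_, (hEp N).isSelfAdjoint.sub hP.one_sub.isSelfAdjoint⟩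
        change (E N - (1 - P)) * (E N - (1 - P)) = E N - (1 - P)
        rw [sub_mul, mul_sub, mul_sub (1 - P), h2, h3, (hEp N).isIdempotentElem.eq,
          hP.one_sub.isIdempotentElem.eq]
        abel
      have h5 := τ.tr_proj_nonneg h4
      rw [τ.tr_sub] at h5
      linarith [hEtr N]
    refine ge_of_tendsto' (x := atTop) (f := fun N : ℕ => 2 * (1 / 2 : ℝ) ^ N) ?_ hle
    simpa using (tendsto_pow_atTop_nhds_zero_of_lt_one (r := (1 / 2 : ℝ)) (by norm_num)
      (by norm_num)).const_mul 2
  have hall : ∀ v, CauchySeq fun k => (y k : H →L[ℂ] H) v := by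
    intro v
    rw [← mem_cauchySubmodule, ← hK, ← Submodule.starProjection_eq_self_iff]
    exact (congrArg (fun S : M => (S : H →L[ℂ] H) v) (sub_eq_zero.1 hQ)).symm
  choose f hf using fun v => cauchySeq_tendsto_of_complete (hall v)
  let T : H →L[ℂ] H := continuousLinearMapOfTendsto (fun k => (y k : H →L[ℂ] H))
    (tendsto_pi_nhds.2 hf)
  have hT : ∀ v, Tendsto (fun k => (y k : H →L[ℂ] H) v) atTop (𝓝 (T v)) := hf
  have hTM : T ∈ M := mem_of_strong_limit hT
  refine ⟨⟨T, hTM⟩, ?_, ?_⟩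
  · refine tendsto_nhds_unique ((tendsto_toL0 τ).2 fun ε hε => ?_) hylim
    have hlim : Tendsto (fun n : ℕ => 2 * (1 / 2 : ℝ) ^ n) atTop (𝓝 0) := by
      simpa using (tendsto_pow_atTop_nhds_zero_of_lt_one (r := (1 / 2 : ℝ)) (by norm_num)
        (by norm_num)).const_mul 2
    obtain ⟨N, hN⟩ := eventually_atTop.1 (hlim.eventually_lt_const hε)
    filter_upwards [eventually_ge_atTop N] with j hj
    refine ⟨E N, hEp N, (hEtr N).trans_lt (hN N le_rfl), lt_of_le_of_lt ?_ (hN j hj)⟩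
    -- The uniform Cauchy estimate off `E N` passes to the strong limit vector by vector.
    refine ContinuousLinearMap.opNorm_le_bound _ (by positivity) fun v => ?_
    have h1 : Tendsto (fun i => ‖(((y j - y i) * (1 - E N) : M) : H →L[ℂ] H) v‖) atTop
        (𝓝 ‖(((y j - ⟨T, hTM⟩) * (1 - E N) : M) : H →L[ℂ] H) v‖) :=
      ((tendsto_const_nhds (x := (y j : H →L[ℂ] H) (((1 - E N : M) : H →L[ℂ] H) v))).sub
        (hT (((1 - E N : M) : H →L[ℂ] H) v))).norm
    refine le_of_tendsto h1 ?_
    filter_upwards [eventually_ge_atTop j] with i hi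
    have h2 := hsmall N j i hj (hj.trans hi)
    rw [min_eq_left hi] at h2
    exact ContinuousLinearMap.le_of_opNorm_le _ h2 v
  · refine ContinuousLinearMap.opNorm_le_bound _ hC0 fun v => ?_
    exact le_of_tendsto' (hT v).norm fun k => ContinuousLinearMap.le_of_opNorm_le _ (hyC k) v

end

section

/-! ### Sequences bounded in `L_p` -/

namespace TracialState

variable {A : Type*} [CStarAlgebra A] [PartialOrder A] [StarOrderedRing A] (φ : TracialState A)
variable {p : ℝ}

lemma pn_neg (x : A) : φ.pn p (-x) = φ.pn p x := by
  rw [pn, pn, mabs, mabs, star_neg, neg_mul_neg]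

lemma pn_sub_comm (x y : A) : φ.pn p (x - y) = φ.pn p (y - x) := by
  rw [← neg_sub, pn_neg]

lemma pn_sub_le (hp : 1 ≤ p) (x y z : A) : φ.pn p (x - z) ≤ φ.pn p (x - y) + φ.pn p (y - z) := by
  have := φ.pn_add_le hp (x - y) (y - z)
  rwa [sub_add_sub_cancel] at this

lemma abs_pn_sub_pn_le (hp : 1 ≤ p) (x y : A) : |φ.pn p x - φ.pn p y| ≤ φ.pn p (x - y) := by
  have h1 := φ.pn_add_le hp (x - y) y
  have h2 := φ.pn_add_le hp (y - x) x
  rw [sub_add_cancel] at h1 h2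
  rw [φ.pn_sub_comm y x] at h2
  exact abs_sub_le_iff.2 ⟨by linarith, by linarith⟩

lemma pn_truncation_le (hp : 1 ≤ p) {d : ℝ} (hd : 0 ≤ d) (x : A) :
    φ.pn p (truncation d x) ≤ φ.pn p x :=
  φ.pn_mul_cfc_le hp x fun t ht => by
    have := inv_one_add_mem hd ht
    rw [abs_of_nonneg this.1]
    exact this.2

lemma pn_truncation_sub_rpow_le (hp : 1 ≤ p) {d d' : ℝ} (hd : 0 ≤ d) (hdd : d ≤ d') (x : A) :
    φ.pn p (truncation d x - truncation d' x) ^ p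
      ≤ φ.pn p (truncation d x) ^ p - φ.pn p (truncation d' x) ^ p := by
  have hd' := hd.trans hdd
  refine φ.pn_mul_cfc_sub_rpow_le hp x (continuousOn_inv_one_add hd) (continuousOn_inv_one_add hd')
    (fun t ht => (inv_one_add_mem hd' ht).1) fun t ht => ?_
  have : 0 ≤ d * t := mul_nonneg hd ht
  gcongr

end TracialState

lemma norm_truncation_le {A : Type*} [CStarAlgebra A] [PartialOrder A] [StarOrderedRing A] {d : ℝ}
    (hd : 0 < d) (x : A) : ‖truncation d x‖ ≤ (√d)⁻¹ := by
  have h := norm_sqrt_smul_truncation_le hd x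
  have hd' : 0 < √d := Real.sqrt_pos.2 hd
  rw [norm_smul, Real.norm_of_nonneg (Real.sqrt_nonneg d)] at h
  rwa [← one_div, le_div_iff₀ hd', mul_comm]

variable {H : Type u} [NormedAddCommGroup H] [InnerProductSpace ℂ H] [CompleteSpace H]
variable {M : VonNeumannAlgebra H} (τ : FiniteTrace M)

/-- On bounded sets, convergence in measure implies convergence in the `p`-norm. -/
lemma exists_forall_mem_measureNhd_pn_lt {p : ℝ} (hp : 1 ≤ p) (C : ℝ) {ε : ℝ} (hε : 0 < ε) :
    ∃ δ : ℝ, 0 < δ ∧ ∀ x : M, ‖x‖ ≤ C → x ∈ measureNhd τ δ δ → τ.state.pn p x < ε := by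
  have h1 : Tendsto (fun δ : ℝ => δ + C * δ ^ (1 / p)) (𝓝[>] 0) (𝓝 (0 + C * 0 ^ (1 / p))) :=
    ((continuous_id.add (continuous_const.mul (Real.continuous_rpow_const (by positivity)))).tendsto
      0).mono_left nhdsWithin_le_nhds
  rw [Real.zero_rpow (by positivity), mul_zero, add_zero] at h1
  obtain ⟨δ, h2, h3⟩ := ((h1.eventually_lt_const hε).and self_mem_nhdsWithin).exists
  exact ⟨δ, h3, fun x hx hm => (pn_le_of_mem_measureNhd τ hp hx hm).trans_lt h2⟩

lemma sub_mem_measureNhd_comm {ε δ : ℝ} {x y : M} (h : x - y ∈ measureNhd τ ε δ) :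
    y - x ∈ measureNhd τ ε δ := by
  rw [← neg_sub]
  exact neg_mem_measureNhd τ h

/-- A limit in measure of a sequence which is bounded in the `p`-norm is the limit in measure of a
sequence with the same bound which is Cauchy for the `p`-norm. -/
lemma exists_cauchy_pn_of_tendsto {p : ℝ} (hp : 1 ≤ p) {x : ℕ → M} {c : ℝ}
    (hc : ∀ k, τ.state.pn p (x k) ≤ c) {g : L0 τ}
    (hx : Tendsto (fun k => toL0 τ (x k)) atTop (𝓝 g)) :
    ∃ y : ℕ → M, (∀ ε : ℝ, 0 < ε → ∃ N, ∀ m ≥ N, ∀ n ≥ N, τ.state.pn p (y m - y n) < ε) ∧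
      Tendsto (fun k => toL0 τ (y k)) atTop (𝓝 g) ∧ ∀ k, τ.state.pn p (y k) ≤ c := by
  have hp0 : 0 < p := by linarith
  have hcau := (cauchySeq_toL0 τ).1 hx.cauchySeq
  set N : M → ℝ := τ.state.pn p with hN
  have hN0 : ∀ z, 0 ≤ N z := τ.state.pn_nonneg p
  let d : ℕ → ℝ := fun j => 1 / ((j : ℝ) + 1)
  have hd : ∀ j, 0 < d j := fun j => Nat.one_div_pos_of_nat
  have hdanti : ∀ i j, i ≤ j → d j ≤ d i := fun i j h => Nat.one_div_le_one_div h
  have hdlim : Tendsto d atTop (𝓝 0) := tendsto_one_div_add_atTop_nhds_zero_nat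
  -- At a fixed truncation level the sequence is bounded in `M`, so being Cauchy in measure makes it
  -- Cauchy in the `p`-norm.
  have hT : ∀ j, ∀ ε : ℝ, 0 < ε → ∃ K, ∀ m ≥ K, ∀ n ≥ K,
      N (truncation (d j) (x m) - truncation (d j) (x n)) < ε := by
    intro j ε hε
    obtain ⟨δ, hδ, h⟩ := exists_forall_mem_measureNhd_pn_lt τ hp ((√(d j))⁻¹ + (√(d j))⁻¹) hε
    obtain ⟨K, hK⟩ := hcau (δ / 8) (by positivity)
    refine ⟨K, fun m hm n hn => h _ ?_ ?_⟩
    · exact (norm_sub_le _ _).trans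
        (add_le_add (norm_truncation_le (hd j) _) (norm_truncation_le (hd j) _))
    · exact measureNhd_mono τ (by linarith) (by linarith)
        (truncation_sub_mem_measureNhd τ (by positivity) (hd j) (hK m hm n hn))
  have hL : ∀ j, ∃ L, Tendsto (fun k => N (truncation (d j) (x k))) atTop (𝓝 L) := by
    intro j
    refine cauchySeq_tendsto_of_complete (Metric.cauchySeq_iff.2 fun ε hε => ?_)
    obtain ⟨K, hK⟩ := hT j ε hε
    exact ⟨K, fun m hm n hn => (τ.state.abs_pn_sub_pn_le hp _ _).trans_lt (hK m hm n hn)⟩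
  choose L hL using hL
  have hLA : ∀ j, Tendsto (fun k => N (truncation (d j) (x k)) ^ p) atTop (𝓝 (L j ^ p)) :=
    fun j => ((Real.continuous_rpow_const hp0.le).tendsto _).comp (hL j)
  have hdiff : ∀ i j k, i ≤ j → N (truncation (d j) (x k) - truncation (d i) (x k)) ^ p
      ≤ N (truncation (d j) (x k)) ^ p - N (truncation (d i) (x k)) ^ p := fun i j k h =>
    τ.state.pn_truncation_sub_rpow_le hp (hd j).le (hdanti i j h) _
  -- As the truncation is relaxed, the limiting `p`-th powers of the norms increase and stay below
  -- `c^p`. Their convergence, through `hdiff`, controls the change from one level to another.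
  have hAmono : Monotone fun j => L j ^ p := by
    intro i j h
    refine le_of_tendsto_of_tendsto' (hLA i) (hLA j) fun k => ?_
    have h1 : 0 ≤ N (truncation (d j) (x k) - truncation (d i) (x k)) ^ p :=
      Real.rpow_nonneg (hN0 _) _
    linarith [hdiff i j k h]
  have hAbdd : BddAbove (Set.range fun j => L j ^ p) := by
    refine ⟨c ^ p, ?_⟩
    rintro _ ⟨j, rfl⟩
    refine le_of_tendsto' (hLA j) fun k => Real.rpow_le_rpow (hN0 _) ?_ hp0.le
    exact (τ.state.pn_truncation_le hp (hd j).le _).trans (hc k)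
  have hAcau := (tendsto_atTop_ciSup hAmono hAbdd).cauchySeq
  -- A diagonal sequence: at level `j` the index is so large that later truncations at that level
  -- vary by less than `d j`.
  choose K hK using fun j => hT j (d j) (hd j)
  let k : ℕ → ℕ := fun j => max j (K j)
  refine ⟨fun j => truncation (d j) (x (k j)), ?_, ?_, fun j =>
    (τ.state.pn_truncation_le hp (hd j).le _).trans (hc _)⟩
  · have key : ∀ ε : ℝ, 0 < ε → ∃ N0, ∀ i ≥ N0, ∀ j ≥ i,
        N (truncation (d j) (x (k j)) - truncation (d i) (x (k i))) < ε := by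
      intro ε hε
      have hε3 : 0 < ε / 3 := by positivity
      obtain ⟨N1, hN1⟩ := eventually_atTop.1 (hdlim.eventually_lt_const hε3)
      obtain ⟨N2, hN2⟩ := Metric.cauchySeq_iff.1 hAcau ((ε / 3) ^ p) (Real.rpow_pos_of_pos hε3 _)
      refine ⟨max N1 N2, fun i hi j hj => ?_⟩
      have h1 : L j ^ p - L i ^ p < (ε / 3) ^ p :=
        (le_abs_self _).trans_lt (hN2 j ((le_max_right _ _).trans (hi.trans hj)) i
          ((le_max_right _ _).trans hi))
      obtain ⟨m, hm, hm1⟩ := ((((hLA j).sub (hLA i)).eventually_lt_const h1).and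
        (eventually_ge_atTop (max (k i) (k j)))).exists
      have h2 : N (truncation (d j) (x m) - truncation (d i) (x m)) < ε / 3 :=
        (Real.rpow_lt_rpow_iff (hN0 _) hε3.le hp0).1 ((hdiff i j m hj).trans_lt hm)
      have h3 : N (truncation (d j) (x (k j)) - truncation (d j) (x m)) < ε / 3 :=
        (hK j _ (le_max_right _ _) _ ((le_max_right _ _).trans ((le_max_right _ _).trans hm1))).trans
          (hN1 j ((le_max_left _ _).trans (hi.trans hj)))
      have h4 : N (truncation (d i) (x m) - truncation (d i) (x (k i))) < ε / 3 :=
        (hK i _ ((le_max_right _ _).trans ((le_max_left _ _).trans hm1)) _ (le_max_right _ _)).trans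
          (hN1 i ((le_max_left _ _).trans hi))
      have h5 := τ.state.pn_sub_le hp (truncation (d j) (x (k j))) (truncation (d j) (x m))
        (truncation (d i) (x (k i)))
      have h6 := τ.state.pn_sub_le hp (truncation (d j) (x m)) (truncation (d i) (x m))
        (truncation (d i) (x (k i)))
      linarith
    intro ε hε
    obtain ⟨N0, h⟩ := key ε hε
    refine ⟨N0, fun m hm n hn => ?_⟩
    rcases le_total n m with hnm | hnm
    · exact h n hn m hnm
    · refine (τ.state.pn_sub_comm _ _).trans_lt ?_
      exact h m hm n hnm
  · have hk : Tendsto k atTop atTop := tendsto_atTop_mono (fun j => le_max_left _ _) tendsto_id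
    have h1 : Tendsto (fun j => toL0 τ (truncation (d j) (x (k j)) - x (k j))) atTop (𝓝 0) := by
      refine (tendsto_toL0_zero τ).2 fun ε hε => ?_
      have hη : 0 < ε / 10 := by positivity
      -- Truncation is compared with the identity on the single operator `x N0`, where the error
      -- tends to zero in norm as `d j → 0`. Equicontinuity in measure carries this over to `x (k
      -- j)`.
      obtain ⟨N0, hN0⟩ := hcau (ε / 10) hη
      have h2 : Tendsto (fun j => ‖x N0‖ * (d j * ‖star (x N0) * x N0‖)) atTop
          (𝓝 (‖x N0‖ * (0 * ‖star (x N0) * x N0‖))) := (hdlim.mul_const _).const_mul _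
      rw [zero_mul, mul_zero] at h2
      filter_upwards [h2.eventually_lt_const hη, eventually_ge_atTop N0] with j hj hjN
      have hkj : N0 ≤ k j := hjN.trans (le_max_left _ _)
      have h3 := truncation_sub_mem_measureNhd τ hη (hd j) (hN0 _ hkj N0 le_rfl)
      have h4 := mem_measureNhd_of_norm_lt τ hη
        ((norm_truncation_sub_self_le (hd j).le (x N0)).trans_lt hj)
      have h5 := add_mem_measureNhd τ (add_mem_measureNhd τ h3 h4) (hN0 N0 le_rfl _ hkj)
      rw [sub_add_sub_cancel, sub_add_sub_cancel] at h5
      exact measureNhd_mono τ (by linarith) (by linarith) h5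
    have h2 := h1.add (hx.comp hk)
    rw [zero_add] at h2
    refine h2.congr fun j => ?_
    rw [Function.comp_apply, ← map_add, sub_add_cancel]

end

section

variable {H : Type u} [NormedAddCommGroup H] [InnerProductSpace ℂ H] [CompleteSpace H]
variable {M : VonNeumannAlgebra H} (τ : FiniteTrace M)

/-! ### The norms of `L_p` on `M` -/

open Classical in
/-- The norm of `L_p` on `M`, for `1 ≤ p ≤ ∞`. -/
def mNorm (p : ℝ≥0∞) (x : M) : ℝ := if p = ∞ then ‖x‖ else τ.state.pn p.toReal x

lemma mNorm_top (x : M) : mNorm τ ∞ x = ‖x‖ := if_pos rfl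

lemma mNorm_of_ne_top {p : ℝ≥0∞} (h : p ≠ ∞) (x : M) : mNorm τ p x = τ.state.pn p.toReal x :=
  if_neg h

lemma one_le_toReal {p : ℝ≥0∞} (hp : 1 ≤ p) (h : p ≠ ∞) : 1 ≤ p.toReal := by
  simpa using ENNReal.toReal_mono h hp

lemma two_mul_ne_top {p : ℝ≥0∞} (h : p ≠ ∞) : 2 * p ≠ ∞ := ENNReal.mul_ne_top (by simp) h

lemma one_le_two_mul {p : ℝ≥0∞} (hp : 1 ≤ p) : 1 ≤ 2 * p := by
  simpa using mul_le_mul' (one_le_two (α := ℝ≥0∞)) hp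

variable {p : ℝ≥0∞}

lemma mNorm_nonneg (x : M) : 0 ≤ mNorm τ p x := by
  rcases eq_or_ne p ∞ with rfl | h
  · rw [mNorm_top]; exact norm_nonneg x
  · rw [mNorm_of_ne_top τ h]; exact τ.state.pn_nonneg _ x

lemma mNorm_add_le (hp : 1 ≤ p) (x y : M) : mNorm τ p (x + y) ≤ mNorm τ p x + mNorm τ p y := by
  rcases eq_or_ne p ∞ with rfl | h
  · simp only [mNorm_top]; exact norm_add_le x y
  · simp only [mNorm_of_ne_top τ h]; exact τ.state.pn_add_le (one_le_toReal hp h) x y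

lemma mNorm_le_norm (hp : 1 ≤ p) (x : M) : mNorm τ p x ≤ ‖x‖ := by
  rcases eq_or_ne p ∞ with rfl | h
  · rw [mNorm_top]
  · rw [mNorm_of_ne_top τ h]; exact τ.state.pn_le_norm (one_le_toReal hp h) x

lemma mNorm_conj_le (hp : 1 ≤ p) {a b : M} (ha : ‖a‖ ≤ 1) (hb : ‖b‖ ≤ 1) (x : M) :
    mNorm τ p (a * x * b) ≤ mNorm τ p x := by
  have key : mNorm τ p (a * x * b) ≤ ‖a‖ * mNorm τ p x * ‖b‖ := by
    rcases eq_or_ne p ∞ with rfl | h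
    · simp only [mNorm_top]
      exact (norm_mul_le _ _).trans (mul_le_mul_of_nonneg_right (norm_mul_le _ _) (norm_nonneg _))
    · simp only [mNorm_of_ne_top τ h]; exact τ.state.pn_conj_le (one_le_toReal hp h) a x b
  have h0 := mNorm_nonneg τ (p := p) x
  calc _ ≤ ‖a‖ * mNorm τ p x * ‖b‖ := key
    _ ≤ 1 * mNorm τ p x * 1 := by gcongr
    _ = _ := by ring

lemma mNorm_mul_mul_le (hp : 1 ≤ p) (a h b : M) :
    mNorm τ p (a * h * b) ≤ mNorm τ (2 * p) a * ‖h‖ * mNorm τ (2 * p) b := by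
  rcases eq_or_ne p ∞ with rfl | hp'
  · rw [ENNReal.mul_top two_ne_zero]
    simp only [mNorm_top]
    exact (norm_mul_le _ _).trans (mul_le_mul_of_nonneg_right (norm_mul_le _ _) (norm_nonneg _))
  · simp only [mNorm_of_ne_top τ hp', mNorm_of_ne_top τ (two_mul_ne_top hp'), ENNReal.toReal_mul,
      ENNReal.toReal_ofNat]
    exact τ.state.pn_mul_mul_le (one_le_toReal hp hp') a h b

/-! ### Characterization of the norm of `L_p` -/

/-- With its converse `lpNorm_le_of_mem_closure`, this replaces Cauchy sequences in the definition
of the norm by closures in measure of balls of `M`; continuity of the ring operations of `L0 τ` then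
transfers inequalities from `M`. -/
lemma mem_closure_of_lpNorm_lt (hp : 1 ≤ p) {g : L0 τ} {c : ℝ}
    (h : lpNorm τ p g < ENNReal.ofReal c) : g ∈ closure (toL0 τ '' {x | mNorm τ p x ≤ c}) := by
  have hc : 0 < c := ENNReal.ofReal_pos.1 (bot_le.trans_lt h)
  rcases eq_or_ne p ∞ with rfl | hp'
  · rw [lpNorm, if_pos rfl] at h
    simp only [iInf_lt_iff] at h
    obtain ⟨x, rfl, hx⟩ := h
    refine subset_closure ⟨x, ?_, rfl⟩
    rw [← ofReal_norm, ENNReal.ofReal_lt_ofReal_iff hc] at hx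
    rw [Set.mem_ofPred_eq, mNorm_top]
    exact hx.le
  · rw [lpNorm, if_neg hp'] at h
    simp only [iInf_lt_iff] at h
    obtain ⟨x, -, hxg, hx⟩ := h
    have h1 := frequently_lt_of_liminf_lt (by isBoundedDefault) hx
    refine mem_closure_of_frequently_of_tendsto (h1.mono fun k hk => ⟨x k, ?_, rfl⟩) hxg
    rw [ENNReal.ofReal_lt_ofReal_iff hc, pNorm_eq τ (one_le_toReal hp hp')] at hk
    rw [Set.mem_ofPred_eq, mNorm_of_ne_top τ hp']
    exact hk.le

/-- The Fatou property. For `p = ∞` a bounded limit in measure is again in `M`; for finite `p` the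
sequence is replaced by truncations, which are Cauchy in the `p`-norm as the definition demands. -/
lemma lpNorm_le_of_tendsto (hp : 1 ≤ p) {g : L0 τ} {c : ℝ} {x : ℕ → M}
    (hx : ∀ k, mNorm τ p (x k) ≤ c) (hlim : Tendsto (fun k => toL0 τ (x k)) atTop (𝓝 g)) :
    lpNorm τ p g ≤ ENNReal.ofReal c := by
  rcases eq_or_ne p ∞ with rfl | hp'
  · simp only [mNorm_top] at hx
    obtain ⟨y, rfl, hy⟩ := exists_toL0_eq_of_tendsto τ hx hlim
    rw [lpNorm, if_pos rfl]
    refine (iInf_le_of_le y (iInf_le _ rfl) : _ ≤ ‖y‖ₑ).trans ?_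
    rw [← ofReal_norm]
    exact ENNReal.ofReal_le_ofReal hy
  · have hp1 := one_le_toReal hp hp'
    simp only [mNorm_of_ne_top τ hp'] at hx
    obtain ⟨y, hy, hylim, hyc⟩ := exists_cauchy_pn_of_tendsto τ hp1 hx hlim
    rw [lpNorm, if_neg hp']
    have hy' : IsCauchyLp τ p.toReal y := fun ε hε => by
      obtain ⟨N, hN⟩ := hy ε hε
      exact ⟨N, fun m hm n hn => by rw [pNorm_eq τ hp1]; exact hN m hm n hn⟩
    refine (iInf_le_of_le y (iInf₂_le hy' hylim)).trans ?_
    have hle : ∀ k, ENNReal.ofReal (pNorm τ p.toReal (y k)) ≤ ENNReal.ofReal c := fun k => by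
      rw [pNorm_eq τ hp1]
      exact ENNReal.ofReal_le_ofReal (hyc k)
    exact liminf_le_of_frequently_le' (Frequently.of_forall hle)

lemma lpNorm_le_of_mem_closure (hp : 1 ≤ p) {g : L0 τ} {c : ℝ}
    (h : g ∈ closure (toL0 τ '' {x | mNorm τ p x ≤ c})) : lpNorm τ p g ≤ ENNReal.ofReal c := by
  obtain ⟨x, hx, hlim⟩ := exists_seq_toL0 τ h
  exact lpNorm_le_of_tendsto τ hp hx hlim

lemma mem_closure_of_lpNorm_ne_top (hp : 1 ≤ p) {g : L0 τ} (h : lpNorm τ p g ≠ ∞) {ε : ℝ}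
    (hε : 0 < ε) : g ∈ closure (toL0 τ '' {x | mNorm τ p x ≤ (lpNorm τ p g).toReal + ε}) := by
  refine mem_closure_of_lpNorm_lt τ hp ?_
  rw [ENNReal.lt_ofReal_iff_toReal_lt h]
  exact lt_add_of_pos_right _ hε

lemma le_ofReal_of_forall_pos {X : ℝ≥0∞} {F : ℝ → ℝ} (hF : Continuous F)
    (h : ∀ ε : ℝ, 0 < ε → X ≤ ENNReal.ofReal (F ε)) : X ≤ ENNReal.ofReal (F 0) := by
  have h1 : Tendsto (fun ε => ENNReal.ofReal (F ε)) (𝓝[>] 0) (𝓝 (ENNReal.ofReal (F 0))) :=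
    ((ENNReal.continuous_ofReal.comp hF).tendsto 0).mono_left nhdsWithin_le_nhds
  exact ge_of_tendsto h1 (eventually_mem_nhdsWithin.mono h)

lemma isClosed_lpNorm_le (hp : 1 ≤ p) (C : ℝ≥0∞) : IsClosed {g : L0 τ | lpNorm τ p g ≤ C} := by
  rcases eq_or_ne C ∞ with rfl | hC
  · simp
  refine isClosed_of_closure_subset fun g hg => ?_
  have key := le_ofReal_of_forall_pos (X := lpNorm τ p g) (F := fun ε => C.toReal + ε)
    (by fun_prop) fun ε hε => by
      refine lpNorm_le_of_mem_closure τ hp ?_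
      refine closure_minimal (fun f hf => ?_) isClosed_closure hg
      refine mem_closure_of_lpNorm_lt τ hp (lt_of_le_of_lt hf ?_)
      rw [ENNReal.lt_ofReal_iff_toReal_lt hC]
      exact lt_add_of_pos_right _ hε
  simpa [hC] using key

lemma lpNorm_toL0_le (hp : 1 ≤ p) (x : M) : lpNorm τ p (toL0 τ x) ≤ ‖x‖ₑ := by
  rw [← ofReal_norm]
  exact lpNorm_le_of_mem_closure τ hp (subset_closure ⟨x, mNorm_le_norm τ hp x, rfl⟩)

lemma lpNorm_one_le (hp : 1 ≤ p) : lpNorm τ p 1 ≤ 1 := by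
  have := lpNorm_toL0_le τ hp 1
  rw [map_one] at this
  refine this.trans ?_
  rw [← ofReal_norm, ← ENNReal.ofReal_one]
  exact ENNReal.ofReal_le_ofReal norm_one_le

lemma memLp_one (hp : 1 ≤ p) : MemLp τ p 1 := (lpNorm_one_le τ hp).trans_lt ENNReal.one_lt_top

lemma lpNorm_add_le (hp : 1 ≤ p) (f g : L0 τ) :
    lpNorm τ p (f + g) ≤ lpNorm τ p f + lpNorm τ p g := by
  rcases eq_or_ne (lpNorm τ p f) ∞ with hf | hf
  · simp [hf]
  rcases eq_or_ne (lpNorm τ p g) ∞ with hg | hg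
  · simp [hg]
  have key := le_ofReal_of_forall_pos (X := lpNorm τ p (f + g))
    (F := fun ε => ((lpNorm τ p f).toReal + ε) + ((lpNorm τ p g).toReal + ε)) (by fun_prop)
    fun ε hε => by
      refine lpNorm_le_of_mem_closure τ hp (map_mem_closure₂ continuous_add
        (mem_closure_of_lpNorm_ne_top τ hp hf hε) (mem_closure_of_lpNorm_ne_top τ hp hg hε) ?_)
      rintro _ ⟨x, hx, rfl⟩ _ ⟨y, hy, rfl⟩
      exact ⟨x + y, (mNorm_add_le τ hp x y).trans (add_le_add hx hy), map_add _ _ _⟩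
  rwa [add_zero, add_zero, ENNReal.ofReal_add (by positivity) (by positivity),
    ENNReal.ofReal_toReal hf, ENNReal.ofReal_toReal hg] at key

/-- Hölder's inequality. -/
lemma lpNorm_mul_mul_le (hp : 1 ≤ p) {α β : L0 τ} (hα : MemLp τ (2 * p) α)
    (hβ : MemLp τ (2 * p) β) (h : M) :
    lpNorm τ p (α * toL0 τ h * β) ≤ lpNorm τ (2 * p) α * ‖h‖ₑ * lpNorm τ (2 * p) β := by
  have h2 := one_le_two_mul hp
  have key := le_ofReal_of_forall_pos (X := lpNorm τ p (α * toL0 τ h * β))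
    (F := fun ε => ((lpNorm τ (2 * p) α).toReal + ε) * ‖h‖ * ((lpNorm τ (2 * p) β).toReal + ε))
    (by fun_prop) fun ε hε => by
      refine lpNorm_le_of_mem_closure τ hp (map_mem_closure₂
        (f := fun a b => a * toL0 τ h * b)
        ((continuous_fst.mul continuous_const).mul continuous_snd)
        (mem_closure_of_lpNorm_ne_top τ h2 hα.ne hε)
        (mem_closure_of_lpNorm_ne_top τ h2 hβ.ne hε) ?_)
      rintro _ ⟨x, hx, rfl⟩ _ ⟨y, hy, rfl⟩
      refine ⟨x * h * y, (mNorm_mul_mul_le τ hp x h y).trans ?_, by simp only [map_mul]⟩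
      have := mNorm_nonneg τ (p := 2 * p) y
      have hx' : mNorm τ (2 * p) x ≤ _ := hx
      have hy' : mNorm τ (2 * p) y ≤ _ := hy
      gcongr
  rwa [add_zero, add_zero, ENNReal.ofReal_mul (by positivity), ENNReal.ofReal_mul (by positivity),
    ENNReal.ofReal_toReal hα.ne, ENNReal.ofReal_toReal hβ.ne, ofReal_norm] at key

lemma lpNorm_conj_le (hp : 1 ≤ p) {a b : M} (ha : ‖a‖ ≤ 1) (hb : ‖b‖ ≤ 1) (g : L0 τ) :
    lpNorm τ p (toL0 τ a * g * toL0 τ b) ≤ lpNorm τ p g := by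
  rcases eq_or_ne (lpNorm τ p g) ∞ with hg | hg
  · simp [hg]
  have key := le_ofReal_of_forall_pos (X := lpNorm τ p (toL0 τ a * g * toL0 τ b))
    (F := fun ε => (lpNorm τ p g).toReal + ε) (by fun_prop) fun ε hε => by
      refine lpNorm_le_of_mem_closure τ hp (map_mem_closure
        (f := fun g => toL0 τ a * g * toL0 τ b) (by fun_prop)
        (mem_closure_of_lpNorm_ne_top τ hp hg hε) ?_)
      rintro _ ⟨x, hx, rfl⟩
      exact ⟨a * x * b, (mNorm_conj_le τ hp ha hb x).trans hx, by simp only [map_mul]⟩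
  rwa [add_zero, ENNReal.ofReal_toReal hg] at key

lemma norm_one_sub_le {e : M} (he : IsStarProjection e) : ‖1 - e‖ ≤ 1 := by
  have := norm_one_sub_proj_le he 1
  rw [one_mul] at this
  exact this.trans norm_one_le

lemma lpNorm_corner_le (hp : 1 ≤ p) {e : M} (he : IsStarProjection e) (g : L0 τ) :
    lpNorm τ p (corner τ e g) ≤ lpNorm τ p g :=
  lpNorm_conj_le τ hp (norm_one_sub_le he) (norm_one_sub_le he) g

lemma exists_toL0_eq_of_lpNorm_top_ne_top {g : L0 τ} {c : ℝ≥0∞} (h : lpNorm τ ∞ g < c) :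
    ∃ x : M, toL0 τ x = g ∧ ‖x‖ₑ < c := by
  rw [lpNorm, if_pos rfl] at h
  simp only [iInf_lt_iff] at h
  obtain ⟨x, hx, h⟩ := h
  exact ⟨x, hx, h⟩

lemma lpNorm_le_lpNorm_top (hp : 1 ≤ p) (g : L0 τ) : lpNorm τ p g ≤ lpNorm τ ∞ g := by
  refine le_of_forall_gt_imp_ge_of_dense fun c hc => ?_
  obtain ⟨x, rfl, hx⟩ := exists_toL0_eq_of_lpNorm_top_ne_top τ hc
  exact (lpNorm_toL0_le τ hp x).trans hx.le

lemma lpNorm_le_lpLinftyNorm (hp : 1 ≤ p) (f : ℕ → L0 τ) (n : ℕ) :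
    lpNorm τ p (f n) ≤ lpLinftyNorm τ p f := by
  refine le_iInf₂ fun α β => le_iInf₂ fun h hα => le_iInf₂ fun hβ _ => le_iInf fun hf => ?_
  rw [hf n]
  refine (lpNorm_mul_mul_le τ hp hα hβ _).trans ?_
  gcongr
  exact le_iSup (fun n => ‖h n‖ₑ) n

end

section

variable {H : Type u} [NormedAddCommGroup H] [InnerProductSpace ℂ H] [CompleteSpace H]
variable {M : VonNeumannAlgebra H} (τ : FiniteTrace M)

/-! ### Functional calculus and convergence in measure -/

section Resolvent

variable {A : Type*} [CStarAlgebra A] [PartialOrder A] [StarOrderedRing A]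

/-- The resolvent `(1 + b)⁻¹`. -/
def res (b : A) : A := cfc (fun t : ℝ => (1 + t)⁻¹) b

lemma continuousOn_inv_one_add' : ContinuousOn (fun t : ℝ => (1 + t)⁻¹) (Set.Ici 0) := by
  simpa using continuousOn_inv_one_add (zero_le_one (α := ℝ))

lemma res_nonneg {b : A} (hb : 0 ≤ b) : 0 ≤ res b :=
  cfc_nonneg fun t ht => by
    have : 0 ≤ t := spectrum_subset_Ici hb ht
    positivity

lemma norm_res_le {b : A} (hb : 0 ≤ b) : ‖res b‖ ≤ 1 := by
  simpa [res] using norm_cfc_inv_one_add_le zero_le_one hb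

lemma res_sub {b c : A} (hb : 0 ≤ b) (hc : 0 ≤ c) : res b - res c = res b * (c - b) * res c := by
  have h1 : res b * (1 + b) = 1 := by
    simpa [res] using (one_add_mul_cfc_inv (zero_le_one (α := ℝ)) hb).2
  have h2 : (1 + c) * res c = 1 := by
    simpa [res] using (one_add_mul_cfc_inv (zero_le_one (α := ℝ)) hc).1
  calc res b - res c = res b * ((1 + c) * res c) - res b * (1 + b) * res c := by
        rw [h1, h2, mul_one, one_mul]
    _ = _ := by noncomm_ring

lemma cfc_res {f : ℝ → ℝ} (hf : Continuous f) {b : A} (hb : 0 ≤ b) :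
    cfc f (res b) = cfc (fun t => f (1 + t)⁻¹) b :=
  cfc_comp_Ici continuousOn_inv_one_add' hf.continuousOn (fun t ht => by positivity) hb

end Resolvent

lemma exists_tendsto_toL0_iff {x : ℕ → M} : (∃ L, Tendsto (fun k => toL0 τ (x k)) atTop (𝓝 L)) ↔
    ∀ ε : ℝ, 0 < ε → ∃ N, ∀ m ≥ N, ∀ n ≥ N, x m - x n ∈ measureNhd τ ε ε := by
  rw [← cauchySeq_toL0]
  exact ⟨fun ⟨_, h⟩ => h.cauchySeq, cauchySeq_tendsto_of_complete⟩

/-- The limit of the adjoints stands in for the adjoint of the limit, as `L0 τ` is given no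
involution here. -/
lemma exists_tendsto_toL0_star {x : ℕ → M} {L : L0 τ}
    (h : Tendsto (fun k => toL0 τ (x k)) atTop (𝓝 L)) :
    ∃ L', Tendsto (fun k => toL0 τ (star (x k))) atTop (𝓝 L') := by
  have h1 := (exists_tendsto_toL0_iff τ).1 ⟨L, h⟩
  refine (exists_tendsto_toL0_iff τ).2 fun ε hε => ?_
  obtain ⟨N, hN⟩ := h1 ε hε
  refine ⟨N, fun m hm n hn => ?_⟩
  rw [← star_sub]
  exact star_mem_measureNhd τ (hN m hm n hn)

lemma exists_tendsto_toL0_aeval {c : ℕ → M} {L : L0 τ}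
    (h : Tendsto (fun k => toL0 τ (c k)) atTop (𝓝 L)) (P : Polynomial ℝ) :
    ∃ L', Tendsto (fun k => toL0 τ (Polynomial.aeval (c k) P)) atTop (𝓝 L') := by
  induction P using Polynomial.induction_on with
  | C a => exact ⟨toL0 τ (algebraMap ℝ M a), by simp⟩
  | add P Q hP hQ =>
    obtain ⟨L1, h1⟩ := hP
    obtain ⟨L2, h2⟩ := hQ
    exact ⟨L1 + L2, by simpa only [map_add] using h1.add h2⟩
  | monomial n a hP =>
    obtain ⟨L1, h1⟩ := hP
    refine ⟨L1 * L, (h1.mul h).congr fun k => ?_⟩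
    rw [pow_succ, ← mul_assoc, map_mul (Polynomial.aeval (c k)) _ Polynomial.X, Polynomial.aeval_X,
      map_mul (toL0 τ)]

/-- Polynomials preserve convergence in measure because `L0 τ` is a topological ring, and on a
bounded set they approximate `f` uniformly in norm. -/
lemma exists_tendsto_toL0_cfc {c : ℕ → M} {L : L0 τ} (hc0 : ∀ k, 0 ≤ c k) {R : ℝ}
    (hR : ∀ k, ‖c k‖ ≤ R) (h : Tendsto (fun k => toL0 τ (c k)) atTop (𝓝 L)) {f : ℝ → ℝ}
    (hf : Continuous f) : ∃ L', Tendsto (fun k => toL0 τ (cfc f (c k))) atTop (𝓝 L') := by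
  refine (exists_tendsto_toL0_iff τ).2 fun ε hε => ?_
  obtain ⟨P, hP⟩ := exists_polynomial_near_cfc (A := M) hf.continuousOn R
    (show 0 < ε / 4 by positivity)
  obtain ⟨N, hN⟩ := (exists_tendsto_toL0_iff τ).1 (exists_tendsto_toL0_aeval τ h P) (ε / 3)
    (by positivity)
  have hP' : ∀ k, cfc f (c k) - Polynomial.aeval (c k) P ∈ measureNhd τ (ε / 3) (ε / 3) :=
    fun k => mem_measureNhd_of_norm_lt τ (by positivity)
      ((hP _ (hc0 k) (hR k)).trans_lt (by linarith))
  refine ⟨N, fun m hm n hn => ?_⟩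
  have h1 := add_mem_measureNhd τ (add_mem_measureNhd τ (hP' m) (hN m hm n hn))
    (sub_mem_measureNhd_comm τ (hP' n))
  rw [sub_add_sub_cancel, sub_add_sub_cancel] at h1
  exact measureNhd_mono τ (by linarith) (by linarith) h1

/-- A continuous function of the resolvent preserves convergence in measure. -/
lemma exists_tendsto_toL0_cfc_res {b : ℕ → M} (hb : ∀ k, 0 ≤ b k) {L : L0 τ}
    (h : Tendsto (fun k => toL0 τ (b k)) atTop (𝓝 L)) {f : ℝ → ℝ} (hf : Continuous f) :
    ∃ L', Tendsto (fun k => toL0 τ (cfc (fun t => f (1 + t)⁻¹) (b k))) atTop (𝓝 L') := by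
  -- The resolvent identity sandwiches `b n - b m` between contractions. This moves the unbounded
  -- sequence into the unit ball, where `exists_tendsto_toL0_cfc` applies.
  have h1 : ∃ L', Tendsto (fun k => toL0 τ (res (b k))) atTop (𝓝 L') := by
    refine (exists_tendsto_toL0_iff τ).2 fun ε hε => ?_
    obtain ⟨N, hN⟩ := (exists_tendsto_toL0_iff τ).1 ⟨L, h⟩ (ε / 4) (by positivity)
    refine ⟨N, fun m hm n hn => ?_⟩
    rw [res_sub (hb m) (hb n)]
    exact measureNhd_mono τ (by linarith) (by linarith) (conj_mem_measureNhd τ (by positivity)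
      (norm_res_le (hb m)) (norm_res_le (hb n)) (hN n hn m hm))
  obtain ⟨L', hL'⟩ := h1
  obtain ⟨L'', h2⟩ := exists_tendsto_toL0_cfc τ (fun k => res_nonneg (hb k))
    (fun k => norm_res_le (hb k)) hL' hf
  exact ⟨L'', by simpa only [cfc_res hf (hb _)] using h2⟩

/-- If `f` and `g` are continuous with `f r * g r = r` then `f` of the resolvents of a sequence
which converges in measure has a limit in measure which is bounded and invertible. -/
lemma exists_tendsto_inverse {b : ℕ → M} (hb : ∀ k, 0 ≤ b k) {L : L0 τ}
    (h : Tendsto (fun k => toL0 τ (b k)) atTop (𝓝 L)) {f g : ℝ → ℝ} (hf : Continuous f)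
    (hg : Continuous g) (hfg : ∀ r, 0 ≤ r → f r * g r = r) {C : ℝ}
    (hfC : ∀ r, 0 ≤ r → r ≤ 1 → |f r| ≤ C) :
    ∃ (d : M) (γ : L0 τ), Tendsto (fun k => toL0 τ (cfc (fun t => f (1 + t)⁻¹) (b k))) atTop
        (𝓝 (toL0 τ d)) ∧
      Tendsto (fun k => toL0 τ (cfc (fun t => (1 + t) * g (1 + t)⁻¹) (b k))) atTop (𝓝 γ) ∧
      γ * toL0 τ d = 1 ∧ toL0 τ d * γ = 1 := by
  have hC : 0 ≤ C := (abs_nonneg _).trans (hfC 0 le_rfl zero_le_one)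
  obtain ⟨L1, h1⟩ := exists_tendsto_toL0_cfc_res τ hb h hf
  obtain ⟨L2, h2⟩ := exists_tendsto_toL0_cfc_res τ hb h hg
  have hfc : ContinuousOn (fun t : ℝ => f (1 + t)⁻¹) (Set.Ici 0) :=
    hf.comp_continuousOn continuousOn_inv_one_add'
  have hgc : ContinuousOn (fun t : ℝ => g (1 + t)⁻¹) (Set.Ici 0) :=
    hg.comp_continuousOn continuousOn_inv_one_add'
  have hadd : ContinuousOn (fun t : ℝ => 1 + t) (Set.Ici 0) := by fun_prop
  obtain ⟨d, rfl, -⟩ := exists_toL0_eq_of_tendsto τ (C := C) (fun k => norm_cfc_le hC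
    fun t ht => by
      have : 0 ≤ t := spectrum_subset_Ici (hb k) ht
      exact hfC _ (by positivity) (inv_le_one_of_one_le₀ (by linarith))) h1
  have h3 : Tendsto (fun k => toL0 τ (cfc (fun t => (1 + t) * g (1 + t)⁻¹) (b k))) atTop
      (𝓝 ((1 + L) * L2)) := by
    refine ((tendsto_const_nhds.add h).mul h2).congr fun k => ?_
    rw [← cfc_mul_Ici hadd hgc (hb k), map_mul, cfc_const_add _ _ (b k) (by fun_prop),
      cfc_id' ℝ (b k), map_one, map_add, map_one]
  -- With `r = (1 + t)⁻¹` the relation `f r * g r = r` says that `(1 + t) g r` inverts `f r`.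
  have hone : ∀ t : ℝ, 0 ≤ t → (1 + t) * g (1 + t)⁻¹ * f (1 + t)⁻¹ = 1 := fun t ht => by
    have h4 := hfg (1 + t)⁻¹ (by positivity)
    rw [mul_assoc, mul_comm (g _), h4, mul_inv_cancel₀ (by positivity)]
  refine ⟨d, _, h1, h3, ?_, ?_⟩
  · refine tendsto_nhds_unique (h3.mul h1) (tendsto_const_nhds.congr fun k => ?_)
    rw [← map_mul, cfc_mul_Ici (hadd.fun_mul hgc) hfc (hb k), cfc_congr_Ici hone (hb k),
      cfc_const_one ℝ (b k), map_one]
  · refine tendsto_nhds_unique (h1.mul h3) (tendsto_const_nhds.congr fun k => ?_)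
    rw [← map_mul, cfc_mul_Ici hfc (hadd.fun_mul hgc) (hb k),
      cfc_congr_Ici (fun t ht => (mul_comm _ _).trans (hone t ht)) (hb k),
      cfc_const_one ℝ (b k), map_one]

end

section

/-! ### Factorization in `L_p` -/

namespace TracialState

variable {A : Type*} [CStarAlgebra A] [PartialOrder A] [StarOrderedRing A] (φ : TracialState A)
variable {p : ℝ}

lemma pn_cfc_sqrt_add_le (hp : 1 ≤ p) (x : A) {δ : ℝ} (hδ : 0 < δ) :
    φ.pn (2 * p) (cfc (fun t => √(√t + δ)) (star x * x)) ≤ √(φ.pn p x + δ) := by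
  refine Real.le_sqrt_of_sq_le ?_
  rw [φ.sq_pn_two_mul hp, star_cfc_real, cfc_sqrt_add_sq (star_mul_self_nonneg x) hδ]
  refine (φ.nrm_add_le hp (mabs_nonneg x) (algebraMap_nonneg A hδ.le)).trans ?_
  rw [φ.nrm_algebraMap hp hδ.le]
  rfl

end TracialState

/-- With `r = (1 + t)⁻¹` one has `√t + δ = (√(1 - r) + δ √r) / √r`. Positivity of the numerator for
every real `r` makes the reciprocals continuous on the whole line. -/
lemma sqrt_one_sub_add_pos {δ : ℝ} (hδ : 0 < δ) (r : ℝ) : 0 < √(1 - r) + δ * √r := by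
  have h1 := Real.sqrt_nonneg (1 - r)
  have h2 := Real.sqrt_nonneg r
  rcases lt_or_ge r 1 with h | h
  · have : 0 < √(1 - r) := Real.sqrt_pos.2 (by linarith)
    positivity
  · have : 0 < √r := Real.sqrt_pos.2 (by linarith)
    positivity

lemma sqrt_one_sub_inv {t : ℝ} (ht : 0 ≤ t) : √(1 - (1 + t)⁻¹) = √t / √(1 + t) := by
  rw [← Real.sqrt_div ht]
  congr 1
  field_simp
  ring

lemma sqrt_div_sqrt_one_sub_add {δ t : ℝ} (hδ : 0 < δ) (ht : 0 ≤ t) :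
    √(1 + t)⁻¹ / (√(1 - (1 + t)⁻¹) + δ * √(1 + t)⁻¹) = (√t + δ)⁻¹ := by
  rw [sqrt_one_sub_inv ht, Real.sqrt_inv]
  have h1 : 0 < √(1 + t) := Real.sqrt_pos.2 (by positivity)
  have h2 := Real.sqrt_nonneg t
  have h3 : 0 < √t + δ := by positivity
  field_simp

lemma one_add_mul_sqrt {δ t : ℝ} (hδ : 0 < δ) (ht : 0 ≤ t) :
    (1 + t) * √((1 + t)⁻¹ * (√(1 + t)⁻¹ * (√(1 - (1 + t)⁻¹) + δ * √(1 + t)⁻¹)))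
      = √(√t + δ) := by
  rw [sqrt_one_sub_inv ht, Real.sqrt_inv]
  have h1 : 0 < √(1 + t) := Real.sqrt_pos.2 (by positivity)
  have h2 := Real.sqrt_nonneg t
  have h3 : 0 < √t + δ := by positivity
  have h4 : √(1 + t) * √(1 + t) = 1 + t := Real.mul_self_sqrt (by positivity)
  have h5 : (√(1 + t))⁻¹ * (√t / √(1 + t) + δ * (√(1 + t))⁻¹) = (√t + δ) * (1 + t)⁻¹ := by
    nth_rw 4 [← h4]
    generalize √(1 + t) = s at *
    field_simp
  have h6 : (1 + t)⁻¹ * ((√t + δ) * (1 + t)⁻¹) = (√t + δ) * ((1 + t)⁻¹) ^ 2 := by ring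
  rw [h5, h6, Real.sqrt_mul h3.le, Real.sqrt_sq (by positivity), mul_comm (√_), ← mul_assoc,
    mul_inv_cancel₀ (by positivity), one_mul]

variable {H : Type u} [NormedAddCommGroup H] [InnerProductSpace ℂ H] [CompleteSpace H]
variable {M : VonNeumannAlgebra H} (τ : FiniteTrace M)

/-- If `b` converges in measure then so do `(√b + δ) ^ (1/2)`, to an invertible limit, and
`(√b + δ)⁻¹`. -/
lemma exists_tendsto_sqrt_add {b : ℕ → M} (hb : ∀ k, 0 ≤ b k) {L : L0 τ}
    (h : Tendsto (fun k => toL0 τ (b k)) atTop (𝓝 L)) {δ : ℝ} (hδ : 0 < δ) :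
    ∃ (d : M) (γ : L0 τ), Tendsto (fun k => toL0 τ (cfc (fun t => √(√t + δ)) (b k))) atTop (𝓝 γ) ∧
      γ * toL0 τ d = 1 ∧ toL0 τ d * γ = 1 := by
  have hpos := sqrt_one_sub_add_pos hδ
  -- In terms of `r = (1 + t)⁻¹`, this function is `(√t + δ)^(-1/2)`, while the next one multiplied
  -- by `1 + t` is `(√t + δ)^(1/2)`.
  have h1 : Continuous fun r => √(√r / (√(1 - r) + δ * √r)) :=
    (Continuous.div (by fun_prop) (by fun_prop) fun r => (hpos r).ne').sqrt
  have h2 : Continuous fun r : ℝ => √(r * (√r * (√(1 - r) + δ * √r))) := by fun_prop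
  obtain ⟨d, γ, -, h3, h4, h5⟩ := exists_tendsto_inverse τ hb h h1 h2 (C := √(δ⁻¹))
    (fun r hr => by
      have h6 := hpos r
      have h7 : √r * √r = r := Real.mul_self_sqrt hr
      have h8 := Real.sqrt_nonneg r
      have h9 : √r / (√(1 - r) + δ * √r) * (r * (√r * (√(1 - r) + δ * √r))) = r ^ 2 := by
        rw [div_mul_eq_mul_div, div_eq_iff h6.ne']
        linear_combination r * (√(1 - r) + δ * √r) * h7
      rw [← Real.sqrt_mul (by positivity), h9, Real.sqrt_sq hr])
    (fun r hr _ => by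
      have h6 := hpos r
      have h7 := Real.sqrt_nonneg (1 - r)
      rw [abs_of_nonneg (Real.sqrt_nonneg _)]
      refine Real.sqrt_le_sqrt ?_
      rw [div_le_iff₀ h6, mul_add, inv_mul_cancel_left₀ hδ.ne']
      have : 0 ≤ δ⁻¹ * √(1 - r) := by positivity
      linarith)
  refine ⟨d, γ, ?_, h4, h5⟩
  simpa only [cfc_congr_Ici (fun t ht => one_add_mul_sqrt hδ ht) (hb _)] using h3

lemma exists_tendsto_inv_sqrt_add {b : ℕ → M} (hb : ∀ k, 0 ≤ b k) {L : L0 τ}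
    (h : Tendsto (fun k => toL0 τ (b k)) atTop (𝓝 L)) {δ : ℝ} (hδ : 0 < δ) :
    ∃ L', Tendsto (fun k => toL0 τ (cfc (fun t => (√t + δ)⁻¹) (b k))) atTop (𝓝 L') := by
  have h1 : Continuous fun r => √r / (√(1 - r) + δ * √r) :=
    Continuous.div (by fun_prop) (by fun_prop) fun r => (sqrt_one_sub_add_pos hδ r).ne'
  obtain ⟨L', h2⟩ := exists_tendsto_toL0_cfc_res τ hb h h1
  refine ⟨L', ?_⟩
  simpa only [cfc_congr_Ici (fun t ht => sqrt_div_sqrt_one_sub_add hδ ht) (hb _)] using h2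

variable {p : ℝ≥0∞}

/-- An almost optimal factorization of an element of `L_p`, with invertible outer factors. -/
lemma exists_lp_factorization (hp : 1 ≤ p) {g : L0 τ} (hg : lpNorm τ p g ≠ ∞) {η : ℝ}
    (hη : 0 < η) : ∃ (α β : L0 τ) (t a b : M), MemLp τ (2 * p) α ∧ MemLp τ (2 * p) β ∧
      g = α * toL0 τ t * β ∧ α * toL0 τ a = 1 ∧ toL0 τ b * β = 1 ∧
      lpNorm τ (2 * p) α * ‖t‖ₑ * lpNorm τ (2 * p) β ≤ lpNorm τ p g + ENNReal.ofReal η := by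
  have h2p := one_le_two_mul hp
  rcases eq_or_ne p ∞ with rfl | hp'
  · obtain ⟨x, rfl, hx⟩ := exists_toL0_eq_of_lpNorm_top_ne_top τ
      (ENNReal.lt_add_right hg (ENNReal.ofReal_pos.2 hη).ne')
    refine ⟨1, 1, x, 1, 1, memLp_one τ h2p, memLp_one τ h2p, by simp, by simp, by simp, ?_⟩
    have h1 := lpNorm_one_le τ h2p
    calc _ ≤ 1 * ‖x‖ₑ * 1 := by gcongr
      _ ≤ _ := by simpa using hx.le
  · have hP := one_le_toReal hp hp'
    -- One half of `η` enlarges the ball containing the approximating sequence, the other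
    -- regularizes the moduli.
    have hη2 : 0 < η / 2 := half_pos hη
    set c : ℝ := (lpNorm τ p g).toReal + η / 2 with hc
    have hc0 : 0 ≤ c := by positivity
    obtain ⟨x, hxc, hx⟩ := exists_seq_toL0 τ (mem_closure_of_lpNorm_ne_top τ hp hg hη2)
    have hxc' : ∀ k, τ.state.pn p.toReal (x k) ≤ c := fun k => by
      rw [← mNorm_of_ne_top τ hp']; exact hxc k
    obtain ⟨L, hL⟩ := exists_tendsto_toL0_star τ hx
    have hb : Tendsto (fun k => toL0 τ (star (x k) * x k)) atTop (𝓝 (L * g)) := by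
      simpa only [map_mul] using hL.mul hx
    have hb' : Tendsto (fun k => toL0 τ (x k * star (x k))) atTop (𝓝 (g * L)) := by
      simpa only [map_mul] using hx.mul hL
    -- The outer factors are the limits of `(|x k⋆| + η/2)^(1/2)` and `(|x k| + η/2)^(1/2)`. They
    -- have bounded inverses, and the middle factors are contractions, whose limit therefore stays
    -- in `M`.
    obtain ⟨a, α, hα, ha, -⟩ := exists_tendsto_sqrt_add τ (fun k => mul_star_self_nonneg (x k)) hb'
      hη2
    obtain ⟨b, β, hβ, -, hb1⟩ := exists_tendsto_sqrt_add τ (fun k => star_mul_self_nonneg (x k)) hb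
      hη2
    obtain ⟨L', hL'⟩ := exists_tendsto_inv_sqrt_add τ (fun k => star_mul_self_nonneg (x k)) hb hη2
    have ht := hx.mul hL'
    simp only [← map_mul] at ht
    obtain ⟨t, ht1, ht2⟩ := exists_toL0_eq_of_tendsto τ
      (fun k => (exists_factorization (x k) hη2).2) ht
    have hle : ∀ y : M, τ.state.pn p.toReal y ≤ c →
        mNorm τ (2 * p) (cfc (fun t => √(√t + η / 2)) (star y * y)) ≤ √(c + η / 2) := fun y hy => by
      rw [mNorm_of_ne_top τ (two_mul_ne_top hp'), ENNReal.toReal_mul, ENNReal.toReal_ofNat]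
      exact (τ.state.pn_cfc_sqrt_add_le hP y hη2).trans (Real.sqrt_le_sqrt (by linarith))
    have hα1 : lpNorm τ (2 * p) α ≤ ENNReal.ofReal √(c + η / 2) :=
      lpNorm_le_of_tendsto τ h2p (fun k => by
        have := hle (star (x k)) (by rw [τ.state.pn_star hP]; exact hxc' k)
        rwa [star_star] at this) hα
    have hβ1 : lpNorm τ (2 * p) β ≤ ENNReal.ofReal √(c + η / 2) :=
      lpNorm_le_of_tendsto τ h2p (fun k => hle (x k) (hxc' k)) hβ
    refine ⟨α, β, t, a, b, hα1.trans_lt ENNReal.ofReal_lt_top, hβ1.trans_lt ENNReal.ofReal_lt_top,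
      ?_, ha, hb1, ?_⟩
    · rw [ht1]
      refine tendsto_nhds_unique hx (((hα.mul ht).mul hβ).congr fun k => ?_)
      rw [← map_mul, ← map_mul, ← (exists_factorization (x k) hη2).1]
    · have ht3 : ‖t‖ₑ ≤ 1 := by
        rw [← ofReal_norm, ← ENNReal.ofReal_one]
        exact ENNReal.ofReal_le_ofReal ht2
      calc _ ≤ ENNReal.ofReal √(c + η / 2) * 1 * ENNReal.ofReal √(c + η / 2) := by gcongr
        _ = ENNReal.ofReal ((lpNorm τ p g).toReal + η) := by
          rw [mul_one, ← ENNReal.ofReal_mul (Real.sqrt_nonneg _),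
            Real.mul_self_sqrt (by positivity), hc]
          congr 1; ring
        _ = _ := by rw [ENNReal.ofReal_add (by positivity) hη.le, ENNReal.ofReal_toReal hg]

/-! ### Common factors -/

/-- From `a a⋆ ≤ b` follows `f(b) a a⋆ f(b) ≤ f(b) b f(b) ≤ 1`. With `f t = (1 + t)^(-1/2)` this
exhibits `a` as `(1 + b)^(1/2)` times a contraction. -/
lemma norm_cfc_mul_le {A : Type*} [CStarAlgebra A] [PartialOrder A] [StarOrderedRing A] {a b : A}
    (hab : a * star a ≤ b) {f : ℝ → ℝ} (hf : ContinuousOn f (Set.Ici 0))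
    (h1 : ∀ t, 0 ≤ t → f t * t * f t ≤ 1) : ‖cfc f b * a‖ ≤ 1 := by
  have hb : 0 ≤ b := (mul_star_self_nonneg a).trans hab
  have hid : ContinuousOn (fun t : ℝ => t) (Set.Ici 0) := continuousOn_id
  have h2 : (cfc f b * a) * star (cfc f b * a) ≤ cfc (fun t => f t * t * f t) b := by
    rw [star_mul, star_cfc_real]
    have h3 := star_left_conjugate_le_conjugate hab (cfc f b)
    rw [star_cfc_real] at h3
    have h4 : cfc f b * b * cfc f b = cfc (fun t => f t * t * f t) b := by
      have h5 : cfc f b * cfc (fun t : ℝ => t) b * cfc f b = cfc (fun t => f t * t * f t) b := by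
        rw [cfc_mul_Ici hf hid hb, cfc_mul_Ici (hf.fun_mul hid) hf hb]
      rwa [cfc_id' ℝ b] at h5
    rw [← h4]
    simpa only [mul_assoc] using h3
  have h5 := CStarAlgebra.norm_le_norm_of_nonneg_of_le (mul_star_self_nonneg _) h2
  rw [CStarRing.norm_self_mul_star] at h5
  have h6 : ‖cfc (fun t => f t * t * f t) b‖ ≤ 1 := norm_cfc_le zero_le_one fun t ht => by
    have ht0 : 0 ≤ t := spectrum_subset_Ici hb ht
    rw [Real.norm_of_nonneg (by nlinarith [mul_self_nonneg (f t)])]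
    exact h1 t ht0
  nlinarith [norm_nonneg (cfc f b * a)]

/-- The square root of `1 + b`, and its inverse, for a sequence `b` which is bounded for the
`p`-norm and converges in measure. -/
lemma exists_sqrt_one_add (hp : 1 ≤ p) (hp' : p ≠ ∞) {b : ℕ → M} (hb : ∀ k, 0 ≤ b k) {B : ℝ}
    (hB : ∀ k, τ.state.nrm p.toReal (b k) ≤ B) {L : L0 τ}
    (h : Tendsto (fun k => toL0 τ (b k)) atTop (𝓝 L)) :
    ∃ (d : M) (γ : L0 τ), MemLp τ (2 * p) γ ∧
      Tendsto (fun k => toL0 τ (cfc (fun t => √(1 + t)⁻¹) (b k))) atTop (𝓝 (toL0 τ d)) ∧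
      γ * toL0 τ d = 1 ∧ toL0 τ d * γ = 1 := by
  have hP := one_le_toReal hp hp'
  obtain ⟨d, γ, h1, h2, h3, h4⟩ := exists_tendsto_inverse τ hb h (f := Real.sqrt) (g := Real.sqrt)
    (C := 1) Real.continuous_sqrt Real.continuous_sqrt (fun r hr => Real.mul_self_sqrt hr)
    (fun r hr hr1 => by
      rw [abs_of_nonneg (Real.sqrt_nonneg r)]
      exact Real.sqrt_le_one.2 hr1)
  refine ⟨d, γ, ?_, h1, h3, h4⟩
  refine (lpNorm_le_of_tendsto τ (one_le_two_mul hp) (c := √(B + 1)) (fun k => ?_) h2).trans_lt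
    ENNReal.ofReal_lt_top
  rw [mNorm_of_ne_top τ (two_mul_ne_top hp'), ENNReal.toReal_mul, ENNReal.toReal_ofNat]
  -- The squared `2p`-norm of `(1 + b)^(1/2)` is the `p`-norm of `1 + b`, at most `B + 1`. The
  -- square root appears in the form `(1 + t) √(1 + t)⁻¹` produced by `exists_tendsto_inverse`.
  refine Real.le_sqrt_of_sq_le ?_
  have hc : ContinuousOn (fun t : ℝ => (1 + t) * √(1 + t)⁻¹) (Set.Ici 0) :=
    ContinuousOn.fun_mul (by fun_prop)
      (Real.continuous_sqrt.comp_continuousOn continuousOn_inv_one_add')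
  have e : cfc (fun t : ℝ => (1 + t) * √(1 + t)⁻¹ * ((1 + t) * √(1 + t)⁻¹)) (b k)
      = b k + algebraMap ℝ M 1 := by
    have h5 : cfc (fun t : ℝ => t + 1) (b k) = b k + algebraMap ℝ M 1 := by
      rw [cfc_add_const _ _ (b k) (by fun_prop), cfc_id' ℝ (b k)]
    rw [← h5]
    refine cfc_congr_Ici (fun t ht => ?_) (hb k)
    have h6 : √(1 + t)⁻¹ * √(1 + t)⁻¹ = (1 + t)⁻¹ := Real.mul_self_sqrt (by positivity)
    have h7 : (1 + t) * (1 + t)⁻¹ = 1 := mul_inv_cancel₀ (by positivity)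
    linear_combination (1 + t) ^ 2 * h6 + (1 + t) * h7
  rw [τ.state.sq_pn_two_mul hP, star_cfc_real, cfc_mul_Ici hc hc (hb k), e]
  refine (τ.state.nrm_add_le hP (hb k) (algebraMap_nonneg M zero_le_one)).trans ?_
  rw [τ.state.nrm_algebraMap hP zero_le_one]
  linarith [hB k]

lemma continuousOn_sqrt_inv_one_add : ContinuousOn (fun t : ℝ => √(1 + t)⁻¹) (Set.Ici 0) :=
  Real.continuous_sqrt.comp_continuousOn continuousOn_inv_one_add'

lemma sqrt_inv_mul_mul_le_one {t : ℝ} (ht : 0 ≤ t) : √(1 + t)⁻¹ * t * √(1 + t)⁻¹ ≤ 1 := by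
  have h6 : √(1 + t)⁻¹ * √(1 + t)⁻¹ = (1 + t)⁻¹ := Real.mul_self_sqrt (by positivity)
  rw [mul_right_comm, h6, inv_mul_le_iff₀ (by positivity)]
  linarith

/-- Sequences in `M` with bounded norms in `L_{2p}`, converging to an element of `L_{2p}`. -/
lemma exists_seq_of_memLp (hp : 1 ≤ p) (hp' : p ≠ ∞) {α : L0 τ} (hα : MemLp τ (2 * p) α) :
    ∃ (x : ℕ → M) (C : ℝ) (L : L0 τ), (∀ k, τ.state.nrm p.toReal (star (x k) * x k) ≤ C) ∧
      Tendsto (fun k => toL0 τ (x k)) atTop (𝓝 α) ∧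
      Tendsto (fun k => toL0 τ (star (x k))) atTop (𝓝 L) := by
  obtain ⟨x, hx, hlim⟩ := exists_seq_toL0 τ
    (mem_closure_of_lpNorm_ne_top τ (one_le_two_mul hp) hα.ne one_pos)
  obtain ⟨L, hL⟩ := exists_tendsto_toL0_star τ hlim
  refine ⟨x, ((lpNorm τ (2 * p) α).toReal + 1) ^ 2, L, fun k => ?_, hlim, hL⟩
  rw [← τ.state.sq_pn_two_mul (one_le_toReal hp hp')]
  have h1 : mNorm τ (2 * p) (x k) ≤ _ := hx k
  rw [mNorm_of_ne_top τ (two_mul_ne_top hp'), ENNReal.toReal_mul, ENNReal.toReal_ofNat] at h1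
  exact pow_le_pow_left₀ (τ.state.pn_nonneg _ _) h1 2

/-- Two elements of `L_{2p}` are right multiples of a common element of `L_{2p}`. -/
lemma exists_common_left_factor (hp : 1 ≤ p) {α α' : L0 τ} (hα : MemLp τ (2 * p) α)
    (hα' : MemLp τ (2 * p) α') : ∃ (γ : L0 τ) (c c' : M), MemLp τ (2 * p) γ ∧
      α = γ * toL0 τ c ∧ α' = γ * toL0 τ c' := by
  rcases eq_or_ne p ∞ with rfl | hp'
  · rw [ENNReal.mul_top two_ne_zero] at *
    obtain ⟨x, rfl, -⟩ := exists_toL0_eq_of_lpNorm_top_ne_top τ hα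
    obtain ⟨y, rfl, -⟩ := exists_toL0_eq_of_lpNorm_top_ne_top τ hα'
    exact ⟨1, x, y, memLp_one τ hp, (one_mul _).symm, (one_mul _).symm⟩
  · have hP := one_le_toReal hp hp'
    obtain ⟨x, C, L, hx, hxα, hxL⟩ := exists_seq_of_memLp τ hp hp' hα
    obtain ⟨y, C', L', hy, hyα, hyL⟩ := exists_seq_of_memLp τ hp hp' hα'
    -- The common factor is the limit of `(1 + b k)^(1/2)`. Since `b k` dominates both summands, the
    -- quotients by it are contractions, and their limits lie in `M`.
    let b : ℕ → M := fun k => x k * star (x k) + y k * star (y k)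
    have hb : Tendsto (fun k => toL0 τ (b k)) atTop (𝓝 (α * L + α' * L')) := by
      simpa only [b, map_mul, map_add] using (hxα.mul hxL).add (hyα.mul hyL)
    obtain ⟨d, γ, hγ, hd, hγd, -⟩ := exists_sqrt_one_add τ hp hp' (b := b)
      (fun k => add_nonneg (mul_star_self_nonneg _) (mul_star_self_nonneg _)) (B := C + C')
      (fun k => (τ.state.nrm_add_le hP (mul_star_self_nonneg _) (mul_star_self_nonneg _)).trans (by
        rw [← τ.state.nrm_star_mul_self hP, ← τ.state.nrm_star_mul_self hP]
        exact add_le_add (hx k) (hy k))) hb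
    have key : ∀ (z : ℕ → M) (ζ : L0 τ), (∀ k, z k * star (z k) ≤ b k) →
        Tendsto (fun k => toL0 τ (z k)) atTop (𝓝 ζ) → ∃ c, ζ = γ * toL0 τ c := by
      intro z ζ hz hzlim
      have h1 := hd.mul hzlim
      simp only [← map_mul] at h1
      obtain ⟨c, hc, -⟩ := exists_toL0_eq_of_tendsto τ (fun k => norm_cfc_mul_le (hz k)
        continuousOn_sqrt_inv_one_add fun t ht => sqrt_inv_mul_mul_le_one ht) h1
      exact ⟨c, by rw [hc, ← mul_assoc, hγd, one_mul]⟩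
    obtain ⟨c, hc⟩ := key x α (fun k => le_add_of_nonneg_right (mul_star_self_nonneg _)) hxα
    obtain ⟨c', hc'⟩ := key y α' (fun k => le_add_of_nonneg_left (mul_star_self_nonneg _)) hyα
    exact ⟨γ, c, c', hγ, hc, hc'⟩

/-- Two elements of `L_{2p}` are left multiples of a common element of `L_{2p}`. -/
lemma exists_common_right_factor (hp : 1 ≤ p) {β β' : L0 τ} (hβ : MemLp τ (2 * p) β)
    (hβ' : MemLp τ (2 * p) β') : ∃ (γ : L0 τ) (c c' : M), MemLp τ (2 * p) γ ∧
      β = toL0 τ c * γ ∧ β' = toL0 τ c' * γ := by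
  rcases eq_or_ne p ∞ with rfl | hp'
  · rw [ENNReal.mul_top two_ne_zero] at *
    obtain ⟨x, rfl, -⟩ := exists_toL0_eq_of_lpNorm_top_ne_top τ hβ
    obtain ⟨y, rfl, -⟩ := exists_toL0_eq_of_lpNorm_top_ne_top τ hβ'
    exact ⟨1, x, y, memLp_one τ hp, (mul_one _).symm, (mul_one _).symm⟩
  · have hP := one_le_toReal hp hp'
    obtain ⟨x, C, L, hx, hxβ, hxL⟩ := exists_seq_of_memLp τ hp hp' hβ
    obtain ⟨y, C', L', hy, hyβ, hyL⟩ := exists_seq_of_memLp τ hp hp' hβ'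
    let b : ℕ → M := fun k => star (x k) * x k + star (y k) * y k
    have hb : Tendsto (fun k => toL0 τ (b k)) atTop (𝓝 (L * β + L' * β')) := by
      simpa only [b, map_mul, map_add] using (hxL.mul hxβ).add (hyL.mul hyβ)
    obtain ⟨d, γ, hγ, hd, -, hγd⟩ := exists_sqrt_one_add τ hp hp' (b := b)
      (fun k => add_nonneg (star_mul_self_nonneg _) (star_mul_self_nonneg _)) (B := C + C')
      (fun k => (τ.state.nrm_add_le hP (star_mul_self_nonneg _) (star_mul_self_nonneg _)).trans
        (add_le_add (hx k) (hy k))) hb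
    have key : ∀ (z : ℕ → M) (ζ : L0 τ), (∀ k, star (z k) * z k ≤ b k) →
        Tendsto (fun k => toL0 τ (z k)) atTop (𝓝 ζ) → ∃ c, ζ = toL0 τ c * γ := by
      intro z ζ hz hzlim
      have h1 := hzlim.mul hd
      simp only [← map_mul] at h1
      obtain ⟨c, hc, -⟩ := exists_toL0_eq_of_tendsto τ (C := 1) (fun k => by
        -- The estimate for left multiplication, applied to the adjoint.
        have h2 := norm_cfc_mul_le (a := star (z k)) (b := b k) (by rw [star_star]; exact hz k)
          continuousOn_sqrt_inv_one_add fun t ht => sqrt_inv_mul_mul_le_one ht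
        rwa [← norm_star, star_mul, star_star, star_cfc_real] at h2) h1
      exact ⟨c, by rw [hc, mul_assoc, hγd, mul_one]⟩
    obtain ⟨c, hc⟩ := key x β (fun k => le_add_of_nonneg_right (star_mul_self_nonneg _)) hxβ
    obtain ⟨c', hc'⟩ := key y β' (fun k => le_add_of_nonneg_left (star_mul_self_nonneg _)) hyβ
    exact ⟨γ, c, c', hγ, hc, hc'⟩

end

section

variable {H : Type u} [NormedAddCommGroup H] [InnerProductSpace ℂ H] [CompleteSpace H]
variable {M : VonNeumannAlgebra H} (τ : FiniteTrace M) {p : ℝ≥0∞}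

/-! ### The mixed norm -/

lemma lpLinftyNorm_le {f : ℕ → L0 τ} {α β : L0 τ} (hα : MemLp τ (2 * p) α)
    (hβ : MemLp τ (2 * p) β) {h : ℕ → M} {C : ℝ} (hC : ∀ n, ‖h n‖ ≤ C)
    (hf : ∀ n, f n = α * toL0 τ (h n) * β) :
    lpLinftyNorm τ p f ≤ lpNorm τ (2 * p) α * ENNReal.ofReal C * lpNorm τ (2 * p) β := by
  refine (iInf₂_le_of_le α β (iInf₂_le_of_le h hα (iInf₂_le_of_le hβ
    ⟨C, Set.forall_mem_range.2 hC⟩ (iInf_le _ hf)))).trans ?_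
  gcongr
  refine iSup_le fun n => ?_
  rw [← ofReal_norm]
  exact ENNReal.ofReal_le_ofReal (hC n)

lemma memLpLinfty_iff {f : ℕ → L0 τ} : MemLpLinfty τ p f ↔
    ∃ (α β : L0 τ) (h : ℕ → M) (C : ℝ), MemLp τ (2 * p) α ∧ MemLp τ (2 * p) β ∧
      (∀ n, ‖h n‖ ≤ C) ∧ ∀ n, f n = α * toL0 τ (h n) * β := by
  constructor
  · intro hf
    rw [MemLpLinfty, lpLinftyNorm] at hf
    simp only [iInf_lt_iff] at hf
    obtain ⟨α, β, h, hα, hβ, ⟨C, hC⟩, hfh, -⟩ := hf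
    exact ⟨α, β, h, C, hα, hβ, Set.forall_mem_range.1 hC, hfh⟩
  · rintro ⟨α, β, h, C, hα, hβ, hC, hfh⟩
    exact (lpLinftyNorm_le τ hα hβ hC hfh).trans_lt
      (ENNReal.mul_lt_top (ENNReal.mul_lt_top hα ENNReal.ofReal_lt_top) hβ)

lemma lpLinftyNorm_zero (hp : 1 ≤ p) : lpLinftyNorm τ p (fun _ => 0) = 0 := by
  have h1 := memLp_one τ (one_le_two_mul hp)
  have := lpLinftyNorm_le τ (f := fun _ => 0) h1 h1 (h := fun _ => 0) (C := 0) (by simp) (by simp)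
  simpa using this

/-- Factorizations with different outer factors cannot be subtracted. Over common outer factors the
difference falls on the bounded middle terms. -/
lemma MemLpLinfty.sub (hp : 1 ≤ p) {f g : ℕ → L0 τ} (hf : MemLpLinfty τ p f)
    (hg : MemLpLinfty τ p g) : MemLpLinfty τ p (fun n => f n - g n) := by
  rw [memLpLinfty_iff] at *
  obtain ⟨α, β, h, C, hα, hβ, hC, hf⟩ := hf
  obtain ⟨α', β', h', C', hα', hβ', hC', hg⟩ := hg
  obtain ⟨γ, c, c', hγ, rfl, rfl⟩ := exists_common_left_factor τ hp hα hα'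
  obtain ⟨ζ, d, d', hζ, rfl, rfl⟩ := exists_common_right_factor τ hp hβ hβ'
  refine ⟨γ, ζ, fun n => c * h n * d - c' * h' n * d', ‖c‖ * C * ‖d‖ + ‖c'‖ * C' * ‖d'‖, hγ, hζ,
    fun n => ?_, fun n => ?_⟩
  · have h1 : ∀ (a x b : M) (D : ℝ), ‖x‖ ≤ D → ‖a * x * b‖ ≤ ‖a‖ * D * ‖b‖ := fun a x b D hx =>
      (norm_mul_le _ _).trans (by gcongr; exact (norm_mul_le _ _).trans (by gcongr))
    exact (norm_sub_le _ _).trans (add_le_add (h1 _ _ _ _ (hC n)) (h1 _ _ _ _ (hC' n)))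
  · rw [hf, hg]
    simp only [map_sub, map_mul]
    noncomm_ring

/-- Bounded perturbations of a constant sequence. -/
lemma exists_lpLinftyNorm_add_le (hp : 1 ≤ p) {g : L0 τ} (hg : lpNorm τ p g ≠ ∞) {η : ℝ}
    (hη : 0 < η) : ∃ s : ℝ, 0 < s ∧ ∀ (q : M) (y : ℕ → M), ‖q‖ ≤ 1 → (∀ n, ‖y n‖ ≤ s) →
      lpLinftyNorm τ p (fun n => toL0 τ q * (g + toL0 τ (y n)) * toL0 τ q)
        ≤ lpNorm τ p g + ENNReal.ofReal η := by
  have h2p := one_le_two_mul hp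
  have hη2 : 0 < η / 2 := half_pos hη
  obtain ⟨α, β, t, a, b, hα, hβ, hgt, ha, hb, hle⟩ := exists_lp_factorization τ hp hg hη2
  set A := lpNorm τ (2 * p) α
  set B := lpNorm τ (2 * p) β
  set K : ℝ := A.toReal * (‖a‖ * ‖b‖) * B.toReal with hK
  have hK0 : 0 ≤ K := by positivity
  -- Chosen so that `K s ≤ η / 2`; the other half of `η` is spent on the factorization, and the `1`
  -- covers `K = 0`.
  refine ⟨η / 2 / (K + 1), by positivity, fun q y hq hy => ?_⟩
  set s := η / 2 / (K + 1) with hs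
  have hs0 : 0 ≤ s := by positivity
  have hn1 : ‖(1 : M)‖ ≤ 1 := norm_one_le
  have hqα : lpNorm τ (2 * p) (toL0 τ q * α) ≤ A := by
    simpa using lpNorm_conj_le τ h2p hq hn1 α
  have hβq : lpNorm τ (2 * p) (β * toL0 τ q) ≤ B := by
    simpa using lpNorm_conj_le τ h2p hn1 hq β
  have hnorm : ∀ n, ‖t + a * y n * b‖ ≤ ‖t‖ + ‖a‖ * s * ‖b‖ := fun n =>
    (norm_add_le _ _).trans (by
      gcongr
      exact (norm_mul_le _ _).trans (by
        gcongr
        exact (norm_mul_le _ _).trans (by gcongr; exact hy n)))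
  refine (lpLinftyNorm_le τ (hqα.trans_lt hα) (hβq.trans_lt hβ) hnorm fun n => ?_).trans ?_
  · have h2 : g + toL0 τ (y n) = α * toL0 τ (t + a * y n * b) * β := by
      have h3 : α * toL0 τ (t + a * y n * b) * β
          = α * toL0 τ t * β + (α * toL0 τ a) * toL0 τ (y n) * (toL0 τ b * β) := by
        simp only [map_add, map_mul]
        noncomm_ring
      rw [h3, ha, hb, one_mul, mul_one, ← hgt]
    rw [h2]
    noncomm_ring
  · have h4 : ENNReal.ofReal (‖t‖ + ‖a‖ * s * ‖b‖) = ‖t‖ₑ + ENNReal.ofReal (‖a‖ * s * ‖b‖) := by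
      rw [ENNReal.ofReal_add (norm_nonneg _) (by positivity), ofReal_norm]
    have h5 : A * ENNReal.ofReal (‖a‖ * s * ‖b‖) * B ≤ ENNReal.ofReal (η / 2) := by
      have hA : A ≠ ∞ := hα.ne
      have hB : B ≠ ∞ := hβ.ne
      rw [← ENNReal.ofReal_toReal hA, ← ENNReal.ofReal_toReal hB,
        ← ENNReal.ofReal_mul (by positivity), ← ENNReal.ofReal_mul (by positivity)]
      refine ENNReal.ofReal_le_ofReal ?_
      calc A.toReal * (‖a‖ * s * ‖b‖) * B.toReal = K * s := by rw [hK]; ring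
        _ ≤ (K + 1) * s := by gcongr; linarith
        _ = η / 2 := by rw [hs]; field_simp
    calc _ ≤ A * (‖t‖ₑ + ENNReal.ofReal (‖a‖ * s * ‖b‖)) * B := by rw [h4]; gcongr
      _ = A * ‖t‖ₑ * B + A * ENNReal.ofReal (‖a‖ * s * ‖b‖) * B := by ring
      _ ≤ lpNorm τ p g + ENNReal.ofReal (η / 2) + ENNReal.ofReal (η / 2) := add_le_add hle h5
      _ = _ := by rw [add_assoc, ← ENNReal.ofReal_add hη2.le hη2.le, add_halves]

/-! ### Compressions -/

lemma corner_add (e : M) (f g : L0 τ) : corner τ e (f + g) = corner τ e f + corner τ e g := by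
  rw [corner, mul_add, add_mul]; rfl

lemma corner_sub (e : M) (f g : L0 τ) : corner τ e (f - g) = corner τ e f - corner τ e g := by
  rw [corner, mul_sub, sub_mul]; rfl

lemma corner_corner {e E : M} (he : IsStarProjection e) (hE : IsStarProjection E)
    (h : e * (1 - E) = 0) (f : L0 τ) : corner τ E (corner τ e f) = corner τ E f := by
  have h1 := mul_one_sub_of_mul_one_sub_eq_zero h
  have h2 : (1 - E) * (1 - e) = 1 - E := by
    have := congrArg star h1
    rwa [star_mul, he.one_sub.isSelfAdjoint.star_eq, hE.one_sub.isSelfAdjoint.star_eq] at this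
  calc corner τ E (corner τ e f)
      = (toL0 τ (1 - E) * toL0 τ (1 - e)) * f * (toL0 τ (1 - e) * toL0 τ (1 - E)) := by
        simp only [corner, mul_assoc]
    _ = _ := by rw [← map_mul, ← map_mul, h1, h2]; rfl

lemma corner_self {e : M} (he : IsStarProjection e) (f : L0 τ) :
    corner τ e (corner τ e f) = corner τ e f :=
  corner_corner τ he he (by rw [mul_sub, mul_one, he.isIdempotentElem.eq, sub_self]) f

lemma lpNorm_corner_mono (hp : 1 ≤ p) {e E : M} (he : IsStarProjection e)
    (hE : IsStarProjection E) (h : e * (1 - E) = 0) (f : L0 τ) :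
    lpNorm τ p (corner τ E f) ≤ lpNorm τ p (corner τ e f) := by
  rw [← corner_corner τ he hE h f]
  exact lpNorm_corner_le τ hp hE _

lemma lpNorm_neg_le (hp : 1 ≤ p) (f : L0 τ) : lpNorm τ p (-f) ≤ lpNorm τ p f := by
  have hn1 : ‖(1 : M)‖ ≤ 1 := norm_one_le
  have := lpNorm_conj_le τ hp (a := -1) (b := 1) (by rwa [norm_neg]) hn1 f
  simpa using this

/-- Projections of trace tending to zero tend to zero in measure, since `e (1 - e) = 0`;
multiplication in `L0 τ` is continuous. -/
lemma tendsto_corner {e : ℕ → M} (he : ∀ k, IsStarProjection (e k))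
    (h : Tendsto (fun k => τ.tr (e k)) atTop (𝓝 0)) (g : L0 τ) :
    Tendsto (fun k => corner τ (e k) g) atTop (𝓝 g) := by
  have h1 : Tendsto (fun k => toL0 τ (e k)) atTop (𝓝 0) := by
    refine (tendsto_toL0_zero τ).2 fun ε hε => ?_
    filter_upwards [h.eventually_lt_const hε] with k hk
    refine ⟨e k, he k, hk, ?_⟩
    rwa [mul_sub, mul_one, (he k).isIdempotentElem.eq, sub_self, norm_zero]
  have h2 : Tendsto (fun k => toL0 τ (1 - e k)) atTop (𝓝 1) := by
    have := (tendsto_const_nhds (x := (1 : L0 τ))).sub h1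
    rw [sub_zero] at this
    exact this.congr fun k => by rw [map_sub, map_one]
  have h3 := (h2.mul (tendsto_const_nhds (x := g))).mul h2
  rwa [one_mul, mul_one] at h3

variable {τ}

/-- The bilateral almost uniform limit inherits uniform bounds on compressions. -/
lemma TendstoBAU.lpNorm_le (hp : 1 ≤ p) {f : ℕ → L0 τ} {g : L0 τ} (hfg : TendstoBAU τ f g)
    {C : ℝ≥0∞} (hC : ∀ ε : ℝ, 0 < ε → ∃ e : M, IsStarProjection e ∧ τ.tr e < ε ∧
      ∃ N : ℕ, ∀ n > N, lpNorm τ p (corner τ e (f n)) ≤ C) : lpNorm τ p g ≤ C := by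
  have key : ∀ k : ℕ, ∃ E : M, IsStarProjection E ∧ τ.tr E < 1 / ((k : ℝ) + 1) ∧
      lpNorm τ p (corner τ E g) ≤ C := by
    intro k
    have hk : (0 : ℝ) < 1 / ((k : ℝ) + 1) := Nat.one_div_pos_of_nat
    obtain ⟨e, he, het, helim⟩ := hfg _ (half_pos hk)
    obtain ⟨e', he', het', N, hN⟩ := hC _ (half_pos hk)
    obtain ⟨E, hE, h1, h2, h3⟩ := τ.exists_sup he he'
    refine ⟨E, hE, by linarith, ?_⟩
    have h4 : Tendsto (fun n => C + lpNorm τ ∞ (corner τ e (f n - g))) atTop (𝓝 (C + 0)) :=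
      tendsto_const_nhds.add helim
    rw [add_zero] at h4
    refine ge_of_tendsto h4 ?_
    filter_upwards [eventually_gt_atTop N] with n hn
    -- The first term is at most `C`, as `E` dominates `e'`; the second is bounded by the operator
    -- norm off `e`, which tends to zero.
    have h5 : corner τ E g = corner τ E (f n) + -corner τ E (f n - g) := by
      rw [corner_sub]; abel
    rw [h5]
    refine (lpNorm_add_le τ hp _ _).trans (add_le_add ?_ ?_)
    · exact (lpNorm_corner_mono τ hp he' hE h2 _).trans (hN n hn)
    · exact (lpNorm_neg_le τ hp _).trans ((lpNorm_corner_mono τ hp he hE h1 _).trans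
        (lpNorm_le_lpNorm_top τ hp _))
  choose E hE hEt hEC using key
  have h1 : Tendsto (fun k => τ.tr (E k)) atTop (𝓝 0) :=
    squeeze_zero (fun k => τ.tr_proj_nonneg (hE k)) (fun k => (hEt k).le)
      tendsto_one_div_add_atTop_nhds_zero_nat
  exact (isClosed_lpNorm_le τ hp C).mem_of_tendsto (tendsto_corner τ hE h1 g)
    (Eventually.of_forall hEC)

lemma le_of_forall_le_add_ofReal {a b : ℝ≥0∞}
    (h : ∀ η : ℝ, 0 < η → a ≤ b + ENNReal.ofReal η) : a ≤ b :=
  ENNReal.le_of_forall_pos_le_add fun ε hε _ => by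
    simpa using h ε hε

/-! ### The noncommutative limsup -/

lemma TendstoBAU.lpNorm_le_limsupNorm (hp : 1 ≤ p) {f : ℕ → L0 τ} {g : L0 τ}
    (hfg : TendstoBAU τ f g) : lpNorm τ p g ≤ limsupNorm τ p f := by
  refine le_of_forall_gt_imp_ge_of_dense fun C hC => hfg.lpNorm_le hp fun ε hε => ?_
  have h1 : (⨅ (e : M) (_ : IsStarProjection e) (_ : τ.tr e < ε), ⨅ N : ℕ,
      lpLinftyNorm τ p (fun k => corner τ e (f (N + 1 + k)))) < C := by
    refine lt_of_le_of_lt ?_ hC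
    rw [limsupNorm]
    exact le_iSup₂_of_le ε hε le_rfl
  simp only [iInf_lt_iff] at h1
  obtain ⟨e, he, het, N, hN⟩ := h1
  refine ⟨e, he, het, N, fun n hn => ?_⟩
  -- The tail `n > N` is enumerated as `N + 1 + k`.
  have hn' : N + 1 ≤ n := hn
  obtain ⟨k, rfl⟩ := Nat.exists_eq_add_of_le hn'
  have h2 := lpNorm_le_lpLinftyNorm τ hp (fun k => corner τ e (f (N + 1 + k))) k
  exact h2.trans hN.le

/-- Off an exceptional projection the tail of `f` coincides with the compression of `g` plus a
uniformly small bounded sequence, whose mixed norm `exists_lpLinftyNorm_add_le` controls. -/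
lemma TendstoBAU.limsupNorm_le (hp : 1 ≤ p) {f : ℕ → L0 τ} {g : L0 τ}
    (hfg : TendstoBAU τ f g) : limsupNorm τ p f ≤ lpNorm τ p g := by
  rcases eq_or_ne (lpNorm τ p g) ∞ with hg | hg
  · rw [hg]; exact le_top
  refine le_of_forall_le_add_ofReal fun η hη => iSup₂_le fun ε hε => ?_
  obtain ⟨s, hs, h⟩ := exists_lpLinftyNorm_add_le τ hp hg hη
  obtain ⟨e, he, het, hlim⟩ := hfg ε hε
  obtain ⟨N, hN⟩ := eventually_atTop.1 (hlim.eventually_lt_const (ENNReal.ofReal_pos.2 hs))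
  choose y hy hys using fun k : ℕ => exists_toL0_eq_of_lpNorm_top_ne_top τ
    (hN (N + 1 + k) (by omega))
  refine (iInf₂_le_of_le e he (iInf₂_le_of_le het N ?_)).trans
    (h (1 - e) y (norm_one_sub_le he) fun n => ?_)
  · refine le_of_eq (congrArg _ (funext fun k => ?_))
    change corner τ e _ = corner τ e _
    rw [corner_add, hy, corner_self τ he, ← corner_add, add_sub_cancel]
  · have := hys n
    rw [← ofReal_norm, ENNReal.ofReal_lt_ofReal_iff hs] at this
    exact this.le

/-- A member of the closure is within `η` of an almost finite sequence, which disappears after a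
suitable compression. What remains of `f n` is controlled by `f n - h n` and the error `η`. -/
lemma TendstoBAU.lpNorm_le_limsupQuotientNorm (hp : 1 ≤ p) {f : ℕ → L0 τ} {g : L0 τ}
    (hfg : TendstoBAU τ f g) : lpNorm τ p g ≤ limsupQuotientNorm τ p f := by
  refine le_iInf₂ fun h hh => le_of_forall_le_add_ofReal fun η hη => ?_
  obtain ⟨h', hh', hlt⟩ := hh.2 (ENNReal.ofReal η) (ENNReal.ofReal_pos.2 hη)
  refine hfg.lpNorm_le hp fun ε hε => ?_
  obtain ⟨e, he, het, N, hN⟩ := hh'.2 ε hε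
  refine ⟨e, he, het, N, fun n hn => ?_⟩
  have h1 : corner τ e (f n) = corner τ e (f n - h n) + corner τ e (h n - h' n) := by
    rw [← corner_add, sub_add_sub_cancel, corner_sub, hN n hn, sub_zero]
  rw [h1]
  refine (lpNorm_add_le τ hp _ _).trans (add_le_add ?_ ?_)
  · exact (lpNorm_corner_le τ hp he _).trans (lpNorm_le_lpLinftyNorm τ hp (fun n => f n - h n) n)
  · exact (lpNorm_corner_le τ hp he _).trans
      ((lpNorm_le_lpLinftyNorm τ hp (fun n => h n - h' n) n).trans hlt.le)

/-- Diagonal choice of indices. -/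
lemma exists_tendsto_atTop_le (N : ℕ → ℕ) :
    ∃ k : ℕ → ℕ, Tendsto k atTop atTop ∧ ∀ n ≥ N 0, N (k n) ≤ n := by
  -- The largest `m ≤ n` with `N m ≤ n`. The search defaults to `0`, which is admissible exactly
  -- when `N 0 ≤ n`.
  refine ⟨fun n => Nat.findGreatest (fun m => N m ≤ n) n, ?_, fun n hn =>
    Nat.findGreatest_spec (P := fun m => N m ≤ n) (Nat.zero_le n) hn⟩
  refine tendsto_atTop.2 fun K => ?_
  filter_upwards [eventually_ge_atTop K, eventually_ge_atTop (N K)] with n h1 h2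
  exact Nat.le_findGreatest h1 h2

lemma TendstoBAU.limsupQuotientNorm_le (hp : 1 ≤ p) {f : ℕ → L0 τ} {g : L0 τ}
    (hfg : TendstoBAU τ f g) (hf : MemLpLinfty τ p f) :
    limsupQuotientNorm τ p f ≤ lpNorm τ p g := by
  rcases eq_or_ne (lpNorm τ p g) ∞ with hg | hg
  · rw [hg]; exact le_top
  refine le_of_forall_le_add_ofReal fun η hη => ?_
  obtain ⟨s, hs, h⟩ := exists_lpLinftyNorm_add_le τ hp hg hη
  choose e he het hlim using fun m : ℕ => hfg ((1 / 2 : ℝ) ^ m) (by positivity)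
  choose N hN using fun m => eventually_atTop.1
    ((hlim m).eventually_lt_const (ENNReal.ofReal_pos.2 hs))
  obtain ⟨k, hk, hkN⟩ := exists_tendsto_atTop_le N
  -- From `N 0` on, the perturbation is the compression of `f n - g` at the slowly growing level `k
  -- n`; the finitely many earlier terms are set to zero.
  have hy : ∀ n, ∃ y : M, ‖y‖ ≤ s ∧ (N 0 ≤ n → toL0 τ y = corner τ (e (k n)) (f n - g)) := by
    intro n
    by_cases hn : N 0 ≤ n
    · obtain ⟨y, hy, hys⟩ := exists_toL0_eq_of_lpNorm_top_ne_top τ (hN (k n) n (hkN n hn))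
      rw [← ofReal_norm, ENNReal.ofReal_lt_ofReal_iff hs] at hys
      exact ⟨y, hys.le, fun _ => hy⟩
    · exact ⟨0, by simpa using hs.le, fun h => absurd h hn⟩
  choose y hys hy using hy
  have hn1 : ‖(1 : M)‖ ≤ 1 := norm_one_le
  have hgy := h 1 y hn1 hys
  simp only [map_one, one_mul, mul_one] at hgy
  have hgy' : MemLpLinfty τ p fun n => g + toL0 τ (y n) :=
    hgy.trans_lt (ENNReal.add_lt_top.2 ⟨hg.lt_top, ENNReal.ofReal_lt_top⟩)
  have hmem := MemLpLinfty.sub τ hp hf hgy'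
  have hfin : IsAlmostFinite τ p fun n => f n - (g + toL0 τ (y n)) := by
    refine ⟨hmem, fun ε hε => ?_⟩
    have hlim2 : Tendsto (fun n : ℕ => (1 / 2 : ℝ) ^ n * 2) atTop (𝓝 0) := by
      simpa using (tendsto_pow_atTop_nhds_zero_of_lt_one (r := (1 / 2 : ℝ)) (by norm_num)
        (by norm_num)).mul_const 2
    obtain ⟨K, hK⟩ := (hlim2.eventually_lt_const hε).exists
    -- One projection dominates every `e m` with `m ≥ K`. Once `k n ≥ K`, compressing by it makes `f
    -- n - g` and `y n` indistinguishable.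
    obtain ⟨E, hE, hEe, hEt⟩ := τ.exists_countable_sup (fun j => he (K + j))
      (C := (1 / 2 : ℝ) ^ K * 2) fun n => by
        calc ∑ j ∈ Finset.range n, τ.tr (e (K + j))
            ≤ ∑ j ∈ Finset.range n, (1 / 2 : ℝ) ^ K * (1 / 2 : ℝ) ^ j :=
              Finset.sum_le_sum fun j _ => by rw [← pow_add]; exact (het _).le
          _ = (1 / 2 : ℝ) ^ K * ∑ j ∈ Finset.range n, (1 / 2 : ℝ) ^ j := by rw [Finset.mul_sum]
          _ ≤ _ := by
            gcongr
            exact sum_geometric_two_le n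
    obtain ⟨N', hN'⟩ := eventually_atTop.1
      ((tendsto_atTop.1 hk K).and (eventually_ge_atTop (N 0)))
    refine ⟨E, hE, hEt.trans_lt hK, N', fun n hn => ?_⟩
    obtain ⟨h1, h2⟩ := hN' n hn.le
    obtain ⟨j, hj⟩ := Nat.exists_eq_add_of_le h1
    change corner τ E (f n - (g + toL0 τ (y n))) = 0
    rw [← sub_sub, corner_sub, hy n h2, corner_corner τ (he _) hE (by rw [hj]; exact hEe j),
      sub_self]
  have hloc : MemLpLocC0 τ p fun n => f n - (g + toL0 τ (y n)) := by
    -- The sequence is itself almost finite, so it serves as its own approximation.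
    refine ⟨hmem, fun δ hδ => ⟨_, hfin, ?_⟩⟩
    simpa only [sub_self, lpLinftyNorm_zero τ hp] using hδ
  refine (iInf₂_le _ hloc).trans ?_
  simpa only [sub_sub_cancel] using hgy

end

end NCInt

end

theorem mainTheorem9 {H : Type*} [NormedAddCommGroup H] [InnerProductSpace ℂ H]
    [CompleteSpace H] (M : VonNeumannAlgebra H) (τ : NCInt.FiniteTrace M)
    (p : ℝ≥0∞) (hp : 1 ≤ p) (f : ℕ → NCInt.L0 τ) (g : NCInt.L0 τ)
    (hf : ∀ n, NCInt.MemLp τ p (f n)) (hfg : NCInt.TendstoBAU τ f g) :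
    NCInt.limsupNorm τ p f = NCInt.lpNorm τ p g ∧
      (NCInt.MemLpLinfty τ p f → NCInt.limsupQuotientNorm τ p f = NCInt.lpNorm τ p g) :=
  ⟨(hfg.limsupNorm_le hp).antisymm (hfg.lpNorm_le_limsupNorm hp), fun h =>
    (hfg.limsupQuotientNorm_le hp h).antisymm (hfg.lpNorm_le_limsupQuotientNorm hp)⟩
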